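/- Let $M$ be a smooth $n$-dimensional manifold and let $F:TM\to[0,\infty)$ be a Finsler metric: $F$ is smooth outside the zero section, $F(x,cv)=cF(x,v)$ for $c>0$, and $F(x,\cdot)^2$ has positive definite Hessian on $T_xM\setminus\{0\}$. Let $L=\tfrac12F^2$, let $H(x,p)=\sup_{v\in T_xM}\,(p(v)-L(x,v))$ on $T^*M$, and let $\mathbb L:TM\to T^*M$, $\mathbb L(x,v)(w)=\frac{d}{dt}L(x,v+tw)\big|_{t=0}$, be the Legendre map, with differential $\mathbb L_*$. Let $\vec H=\sum_i(H_{p_i}\partial_{x_i}-H_{x_i}\partial_{p_i})$ be the Hamiltonian vector field of $H$, and assume that it is complete, with flow $\Phi_t$. *Curvature operator of the Hamiltonian system.* Let $\pi:T^*M\to M$ be the projection, $\mathcal V=\ker d\pi$, $\omega=\sum_i dp_i\wedge dx_i$. For $q\in T^*M$ let $J^t=(d\Phi_t)^{-1}(\mathcal V_{\Phi_t(q)})\subset T_qT^*M$. A canonical frame at $q$ is a family $e_1^t,\dots,e_n^t\in J^t$, smooth in $t$ near $0$, such that $\ddot e_i^t\in J^t$, $\omega(\dot e_i^t,e_j^t)=\delta_{ij}$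 and $\omega(e_i^t,e_j^t)=\omega(\dot e_i^t,\dot e_j^t)=0$. The curvature operator $\mathbf R_q:\mathcal V_q\to\mathcal V_q$ is the linear map with $\mathbf R_q(e_i^0)=-\ddot e_i^0$ for a canonical frame. *Riemann curvature of the Finsler metric.* In the coordinates $(x,v)$ on $TM$ and $(x,p)$ on $T^*M$ induced by a chart of $M$, put $$G^i=\frac12\sum_l H_{p_ip_l}\Big(\sum_k L_{x_kv_l}v_k-L_{x_l}\Big),\qquad N_i^j=\partial_{v_i}G^j,$$ where $H_{p_ip_l}$ is evaluated at $\mathbb L(x,v)$, and define $R_{ij}^l$ and $\mathcal R$ by $$\sum_lR_{ij}^l\,\partial_{v_l}=\Big[\partial_{x_j}-\sum_kN_j^k\partial_{v_k},\ \partial_{x_i}-\sum_kN_i^k\partial_{v_k}\Big],\qquad \mathcal R(\partial_{v_i})=\sum_{j,l}v_jR_{ij}^l\,\partial_{v_l}.$$ **Theorem 11.2.** Let $(x,v)\in TM$ with $v\neq0$ and let $(x,p)=\mathbb L(x,v)$. Then the curvature operator $\mathbf R_{(x,p)}$ exists and does not depend on the choice of the canonical frame, and for every chart of $M$ around $x$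 and every $i$, $$\mathbf R_{(x,p)}(\mathbb L_*\partial_{v_i})=\mathbb L_*\big(\mathcal R(\partial_{v_i})\big)$$ at the point $(x,v)$. -/

import Mathlib

open scoped Manifold ContDiff Topology Bundle

noncomputable section

namespace FinslerCurvature

/-- The model space `ℝⁿ`. -/
abbrev Coord (n : ℕ) : Type := EuclideanSpace ℝ (Fin n)

/-- The dual of the model space, in which the fibre coordinates `p` of the cotangent bundle live. -/
abbrev Dual (n : ℕ) : Type := Coord n →L[ℝ] ℝ

/-- The standard basis vector `eᵢ` of `ℝⁿ`. -/
def basisVec {n : ℕ} (i : Fin n) : Coord n := EuclideanSpace.single i (1 : ℝ)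

/-- The dual basis covector `eⁱ` of `(ℝⁿ)*`. -/
def basisCovec {n : ℕ} (i : Fin n) : Dual n := EuclideanSpace.proj i

/-! ### Tangent and cotangent bundle -/

section Manifold

variable {n : ℕ} {M : Type*} [TopologicalSpace M] [ChartedSpace (Coord n) M]
  [IsManifold (𝓡 n) ∞ M]

variable (n M) in
/-- The tangent bundle `TM`. -/
abbrev TM : Type _ := TangentBundle (𝓡 n) M

variable (n M) in
/-- The cotangent bundle `T*M`, with the vector bundle (hence manifold) structure of the
bundle of linear maps from `TM` to the trivial line bundle. -/
abbrev CoTM : Type _ :=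
  Bundle.TotalSpace (Dual n) (fun x : M => TangentSpace (𝓡 n) x →L[ℝ] Bundle.Trivial M ℝ x)

/-- The model with corners of `T*M`. -/
abbrev coModel (n : ℕ) : ModelWithCorners ℝ (Coord n × Dual n) (ModelProd (Coord n) (Dual n)) :=
  (𝓡 n).prod 𝓘(ℝ, Dual n)

/-- The tangent space `T_q T*M`. -/
abbrev TCoTM (q : CoTM n M) : Type := TangentSpace (coModel n) q

/-- The components `(a, α)` of `ξ = ∑ aᵢ ∂_{xᵢ} + ∑ αᵢ ∂_{pᵢ} ∈ T_q T*M` with respect to the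
canonical coordinates `(x, p)` which the preferred chart of `M` at the base point of `q` induces
on `T*M`. (Mathlib models `T_q T*M` on exactly these coordinates.) -/
def comps {q : CoTM n M} (ξ : TCoTM q) : Coord n × Dual n := ξ

/-- The tangent vector of `T*M` at `q` with given components. -/
def ofComps (q : CoTM n M) (a : Coord n × Dual n) : TCoTM q := a

/-- The canonical symplectic form `ω = ∑ dpᵢ ∧ dxᵢ` of `T*M`. -/
def symplecticForm (q : CoTM n M) (ξ η : TCoTM q) : ℝ :=
  (comps ξ).2 (comps η).1 - (comps η).2 (comps ξ).1

/-- The vertical space `𝒱_q = ker dπ_q ⊆ T_q T*M`. -/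
def vertical (q : CoTM n M) : Submodule ℝ (TCoTM q) :=
  LinearMap.ker (mfderiv (coModel n) (𝓡 n) (fun q' : CoTM n M => q'.proj) q).toLinearMap

/-! ### Hamiltonian vector fields, Jacobi curves and the curvature operator -/

/-- The differential `dH_q`, in the components of `comps`. -/
def differential (H : CoTM n M → ℝ) (q : CoTM n M) : Coord n × Dual n →L[ℝ] ℝ :=
  mfderiv (coModel n) 𝓘(ℝ, ℝ) H q

/-- The Hamiltonian vector field `∑ H_{pᵢ} ∂_{xᵢ} - ∑ H_{xᵢ} ∂_{pᵢ}`, that is, the vector field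
given by `ω(H⃗, ·) = - dH`. -/
def hamiltonianVectorField (H : CoTM n M → ℝ) (q : CoTM n M) : TCoTM q :=
  ofComps q
    (∑ i, differential H q (0, basisCovec i) • basisVec i,
      -∑ i, differential H q (basisVec i, 0) • basisCovec i)

/-- `Φ` is the (complete) flow of the Hamiltonian vector field of `H`. -/
structure IsHamiltonianFlow (H : CoTM n M → ℝ) (Φ : ℝ → CoTM n M → CoTM n M) : Prop where
  zero : ∀ q, Φ 0 q = q
  integralCurve : ∀ q, IsMIntegralCurve (I := coModel n) (fun t => Φ t q)
    (hamiltonianVectorField H)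

/-- The Jacobi curve `J^t = (dΦ_t)⁻¹ (𝒱_{Φ_t(q)}) ⊆ T_q T*M`. -/
def jacobiCurve (Φ : ℝ → CoTM n M → CoTM n M) (q : CoTM n M) (t : ℝ) :
    Submodule ℝ (TCoTM q) :=
  (vertical (Φ t q)).comap (mfderiv (coModel n) (coModel n) (Φ t) q).toLinearMap

/-- `e₁, …, eₙ, ė₁, …, ėₙ` is a canonical frame of the Jacobi curve at `q`, on the time interval
`(-ε, ε)`: both `eᵢ` and `ëᵢ` lie in the Jacobi curve, and `(eᵢ, ėᵢ)` is a Darboux basis of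
`T_q T*M` at each time. -/
structure IsCanonicalFrame (Φ : ℝ → CoTM n M → CoTM n M) (q : CoTM n M) (ε : ℝ)
    (e : Fin n → ℝ → TCoTM q) : Prop where
  smooth : ∀ i, ContDiffOn ℝ ∞ (fun t => comps (e i t)) (Set.Ioo (-ε) ε)
  mem : ∀ i, ∀ t ∈ Set.Ioo (-ε) ε, e i t ∈ jacobiCurve Φ q t
  second_deriv_mem : ∀ i, ∀ t ∈ Set.Ioo (-ε) ε, deriv (deriv (e i)) t ∈ jacobiCurve Φ q t
  darboux_fe : ∀ i j, ∀ t ∈ Set.Ioo (-ε) ε,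
    symplecticForm q (deriv (e i) t) (e j t) = if i = j then 1 else 0
  darboux_ee : ∀ i j, ∀ t ∈ Set.Ioo (-ε) ε, symplecticForm q (e i t) (e j t) = 0
  darboux_ff : ∀ i j, ∀ t ∈ Set.Ioo (-ε) ε,
    symplecticForm q (deriv (e i) t) (deriv (e j) t) = 0

/-- `R : 𝒱_q → 𝒱_q` is the curvature operator at `q` of the Hamiltonian system with flow `Φ`:
`R (eᵢ(0)) = - ëᵢ(0)` for a canonical frame of the Jacobi curve at `q`. -/
def IsCurvatureOperator (Φ : ℝ → CoTM n M → CoTM n M) (q : CoTM n M)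
    (R : vertical q →ₗ[ℝ] vertical q) : Prop :=
  ∃ ε > 0, ∃ e : Fin n → ℝ → TCoTM q, IsCanonicalFrame Φ q ε e ∧
    ∀ i, ∃ h : e i 0 ∈ vertical q, (R ⟨e i 0, h⟩ : TCoTM q) = -deriv (deriv (e i)) 0

/-! ### Finsler metrics and the Legendre map -/

/-- `F : TM → ℝ` is a Finsler metric: non-negative, smooth outside the zero section, positively
homogeneous of degree one, and such that `F²` has positive definite Hessian on each
`T_x M ∖ {0}`. -/
structure IsFinslerMetric (F : TM n M → ℝ) : Prop where
  nonneg : ∀ ξ, 0 ≤ F ξ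
  smooth : ContMDiffOn (𝓡 n).tangent 𝓘(ℝ, ℝ) ∞ F {ξ | ξ.snd ≠ 0}
  homogeneous : ∀ (x : M) (v : TangentSpace (𝓡 n) x) (c : ℝ), 0 < c →
    F ⟨x, c • v⟩ = c * F ⟨x, v⟩
  hessian_pos : ∀ (x : M) (v u : TangentSpace (𝓡 n) x), v ≠ 0 → u ≠ 0 →
    0 < deriv (deriv (fun t : ℝ => F ⟨x, v + t • u⟩ ^ 2)) 0

/-- The Lagrangian `L = F² / 2`. -/
def lagrangian (F : TM n M → ℝ) (ξ : TM n M) : ℝ := F ξ ^ 2 / 2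

/-- The Hamiltonian `H(x, p) = sup_v (p(v) - L(x, v))`. -/
def hamiltonian (L : TM n M → ℝ) (q : CoTM n M) : ℝ :=
  ⨆ v : TangentSpace (𝓡 n) q.proj, ((q.snd v : ℝ) - L ⟨q.proj, v⟩)

/-- The Legendre map `𝕃 : TM → T*M`, where `𝕃(x, v) w` is the derivative of
`t ↦ L(x, v + t w)` at `0`, that is, `𝕃(x, v)` is the fibre derivative of `L` at `v`. -/
def legendreMap (L : TM n M → ℝ) (ξ : TM n M) : CoTM n M :=
  ⟨ξ.proj, fderiv ℝ (fun v : TangentSpace (𝓡 n) ξ.proj => L ⟨ξ.proj, v⟩) ξ.snd⟩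

/-- The pushforward `𝕃_* : T_ξ TM → T_{𝕃(ξ)} T*M`. -/
def legendrePush (L : TM n M → ℝ) (ξ : TM n M) :
    TangentSpace (𝓡 n).tangent ξ →L[ℝ] TCoTM (legendreMap L ξ) :=
  mfderiv (𝓡 n).tangent (coModel n) (legendreMap L) ξ

/-! ### Local coordinates -/

/-- The coordinate vector field `∂_{xᵢ}` of the chart `φ` at `x`. -/
def partialX (φ : OpenPartialHomeomorph M (Coord n)) (x : M) (i : Fin n) : TangentSpace (𝓡 n) x :=
  (mfderiv (𝓡 n) 𝓘(ℝ, Coord n) φ x).inverse (basisVec i)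

/-- The coordinate vector field `∂_{vᵢ}` on `TM` at `ξ = (x, v)`, where `(x, v)` are the
coordinates on `TM` induced by the chart `φ`: the image of `∂_{xᵢ}` under the differential at `v`
of the inclusion of the fibre `T_x M` into `TM`. -/
def partialV (φ : OpenPartialHomeomorph M (Coord n)) (ξ : TM n M) (i : Fin n) :
    TangentSpace (𝓡 n).tangent ξ :=
  mfderiv 𝓘(ℝ, Coord n) (𝓡 n).tangent (fun w : Coord n => (⟨ξ.proj, w⟩ : TM n M)) ξ.snd
    (partialX φ ξ.proj i)

/-- The coordinates `(x, v)` on `TM` induced by the chart `φ`. -/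
def tangentCoords (φ : OpenPartialHomeomorph M (Coord n)) (ξ : TM n M) : Coord n × Coord n :=
  (φ ξ.proj, mfderiv (𝓡 n) 𝓘(ℝ, Coord n) φ ξ.proj ξ.snd)

/-- The function `L` on `TM` in the coordinates `(x, v)`. -/
def tangentExpr (φ : OpenPartialHomeomorph M (Coord n)) (L : TM n M → ℝ)
    (z : Coord n × Coord n) : ℝ :=
  L ⟨φ.symm z.1, ∑ i, z.2 i • partialX φ (φ.symm z.1) i⟩

/-- The function `H` on `T*M` in the coordinates `(x, p)` induced by the chart `φ`. -/
def cotangentExpr (φ : OpenPartialHomeomorph M (Coord n)) (H : CoTM n M → ℝ)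
    (z : Coord n × Dual n) : ℝ :=
  H ⟨φ.symm z.1, z.2.comp (mfderiv (𝓡 n) 𝓘(ℝ, Coord n) φ (φ.symm z.1))⟩

end Manifold

/-! ### The Ehresmann connection and its curvature in local coordinates

Below, `L` and `H` are the coordinate expressions of the Lagrangian and the Hamiltonian. -/

section Coordinates

variable {n : ℕ}

/-- `f_{xₖ}` -/
def dX (k : Fin n) (f : Coord n × Coord n → ℝ) (z : Coord n × Coord n) : ℝ :=
  fderiv ℝ f z (basisVec k, 0)

/-- `f_{vₖ}` -/
def dV (k : Fin n) (f : Coord n × Coord n → ℝ) (z : Coord n × Coord n) : ℝ :=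
  fderiv ℝ f z (0, basisVec k)

/-- `f_{pₖ}` -/
def dP (k : Fin n) (f : Coord n × Dual n → ℝ) (z : Coord n × Dual n) : ℝ :=
  fderiv ℝ f z (0, basisCovec k)

/-- The Legendre map `(x, v) ↦ (x, p)`, `pᵢ = L_{vᵢ}(x, v)`, in coordinates. -/
def legendreCoord (L : Coord n × Coord n → ℝ) (z : Coord n × Coord n) : Coord n × Dual n :=
  (z.1, ∑ i, dV i L z • basisCovec i)

/-- The spray coefficients
`Gⁱ = (1/2) ∑_l H_{pᵢ p_l} (∑_k L_{xₖ v_l} vₖ - L_{x_l})`. -/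
def sprayCoeff (L : Coord n × Coord n → ℝ) (H : Coord n × Dual n → ℝ) (i : Fin n)
    (z : Coord n × Coord n) : ℝ :=
  (1 / 2 : ℝ) * ∑ l, dP i (dP l H) (legendreCoord L z) *
    ((∑ k, dX k (dV l L) z * z.2 k) - dX l L z)

/-- The connection coefficients `Nᵢʲ = ∂_{vᵢ} Gʲ`. -/
def connCoeff (L : Coord n × Coord n → ℝ) (H : Coord n × Dual n → ℝ) (i j : Fin n)
    (z : Coord n × Coord n) : ℝ :=
  dV i (sprayCoeff L H j) z

/-- The horizontal vector field `∂_{xᵢ} - ∑ⱼ Nᵢʲ ∂_{vⱼ}`. -/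
def horizontalField (L : Coord n × Coord n → ℝ) (H : Coord n × Dual n → ℝ) (i : Fin n)
    (z : Coord n × Coord n) : Coord n × Coord n :=
  (basisVec i, -∑ j, connCoeff L H i j z • basisVec j)

/-- The coefficients `R_{ij}^l` in
`∑_l R_{ij}^l ∂_{v_l} = [∂_{xⱼ} - ∑ₖ Nⱼᵏ ∂_{vₖ}, ∂_{xᵢ} - ∑ₖ Nᵢᵏ ∂_{vₖ}]`. -/
def curvCoeff (L : Coord n × Coord n → ℝ) (H : Coord n × Dual n → ℝ) (i j l : Fin n)
    (z : Coord n × Coord n) : ℝ :=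
  (VectorField.lieBracket ℝ (horizontalField L H j) (horizontalField L H i) z).2 l

end Coordinates

/-- The value `𝓡(∂_{vᵢ}) = ∑_{j,l} vⱼ R_{ij}^l ∂_{v_l}` at `ξ = (x, v)` of the Riemann curvature
`𝓡` of the Finsler metric `F`, computed in the coordinates induced by the chart `φ`. -/
def riemannCurvature {n : ℕ} {M : Type*} [TopologicalSpace M] [ChartedSpace (Coord n) M]
    [IsManifold (𝓡 n) ∞ M] (F : TM n M → ℝ) (φ : OpenPartialHomeomorph M (Coord n))
    (ξ : TM n M) (i : Fin n) : TangentSpace (𝓡 n).tangent ξ :=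
  ∑ j, ∑ l, ((tangentCoords φ ξ).2 j *
    curvCoeff (tangentExpr φ (lagrangian F)) (cotangentExpr φ (hamiltonian (lagrangian F)))
      i j l (tangentCoords φ ξ)) • partialV φ ξ l

end FinslerCurvature

end

open FinslerCurvature

/-!
A chart `φ` of `M` induces coordinates `(x, v)` on `TM` and Darboux coordinates `(x, p)` on `T*M`,
and everything is computed there. The Lagrangian becomes a function `L` which is smooth for `v ≠ 0`,
homogeneous of degree two and fibrewise strictly convex, so that `ℓ = (x, L_v)` is a local
diffeomorphism, and the supremum defining `H` is attained at `v` when `p = L_v(x, v)`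
(`isLegendreTransform`). Hence `ℓ` maps the geodesic spray `S = (v, -2G)` to the Hamiltonian vector
field (`IsFinslerLagrangian.fderiv_legendreCoord_spray`), and Euler's relation for the spray
coefficients turns `∑ⱼ vⱼ Rᵢⱼ` into the curvature `u ↦ 2 G_x u - S(N) u - N (N u)`, `N u = G_v u`,
of the spray (`IsFinslerLagrangian.sum_mul_curvCoeff`).

The Jacobi curve at `q = 𝕃(ξ)` is `{a | A_t a is vertical}`, where `A_t` is the linearised
Hamiltonian flow along the orbit of `q`. The flow `Φ` is only given as a family of integral curves,
so its differentiability near `q` for small times is part of the proof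
(`exists_hasFDerivAt_flow`). As `A_t` is symplectic, the Jacobi curve consists of isotropic
subspaces. Let `c` be the integral curve of `S` through `ξ`, let `B_t = A_t⁻¹ ∘ dℓ_{c(t)}`, and let
`P_t` be the parallel transport along `c`, `P' = -N P`. Then `e(t) = B_t (0, P_t u)` lies in the
Jacobi curve, and two differentiations give `ė = -B_t (P_t u, -N P_t u)` and
`ë = -B_t (0, R_{c(t)} P_t u)`, with `R` the curvature of the spray
(`IsFinslerLagrangian.exists_parallel_jacobi_fields`). So `ë` lies in the Jacobi curve as well.
Isotropy makes `ω(ė, f)` constant and `ω(ė, ḟ)` zero for any two such curves `e`, `f`; so vectors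
`u` which are orthonormal for the fibre Hessian of `L` give a canonical frame
(`exists_canonicalFrame`), and any other canonical frame is a constant linear combination of it
(`IsFrameOf.exists_eq_sum`), which makes the curvature operator independent of the frame. At `t = 0`
the frame is `dℓ (0, u)`, and `-ë(0) = dℓ (0, R u)`, which is the formula
(`isCurvatureOperator_iff`). It holds in every chart for the same operator, because the operator is
determined by the Jacobi curve alone.
-/

noncomputable section

namespace FinslerCurvature

/-! ### Autonomous differential equations and the variational equation -/

section ODE

open Set Metric Filter
open scoped NNReal

variable {W : Type*} [NormedAddCommGroup W] [NormedSpace ℝ W]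

/-- Local flow of a `C¹` vector field, with all trajectories staying in a prescribed
neighbourhood of the initial point. -/
theorem exists_local_flow_mem [CompleteSpace W] {f : W → W} {x₀ : W} (hf : ContDiffAt ℝ 1 f x₀)
    {O : Set W} (hO : O ∈ 𝓝 x₀) :
    ∃ r > (0 : ℝ), ∃ ε > (0 : ℝ), ∃ α : W → ℝ → W, ∀ x ∈ ball x₀ r, α x 0 = x ∧
      ∀ t ∈ Ioo (-ε) ε, HasDerivAt (α x) (f (α x t)) t ∧ α x t ∈ O := by
  obtain ⟨ε, hε, a, r, L, K, hr, hpl⟩ := IsPicardLindelof.of_contDiffAt_one hf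
  obtain ⟨α, hα, hc⟩ :=
    (hpl 0).exists_forall_mem_closedBall_eq_hasDerivWithinAt_continuousOn
  have hr' : (0 : ℝ) < r := hr
  have hcont : ContinuousAt α (x₀, 0) := by
    apply hc.continuousAt
    apply prod_mem_nhds (closedBall_mem_nhds _ hr')
    exact Icc_mem_nhds (by linarith) (by linarith)
  have h0 : α (x₀, 0) = x₀ := (hα x₀ (mem_closedBall_self hr'.le)).1
  have hmem : ∀ᶠ p in 𝓝 (x₀, (0 : ℝ)), α p ∈ O := hcont.eventually_mem (by rwa [h0])
  rw [nhds_prod_eq, Filter.eventually_iff, Filter.mem_prod_iff] at hmem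
  obtain ⟨S, hS, T, hT, hST⟩ := hmem
  obtain ⟨r', hr'0, hr'S⟩ := Metric.mem_nhds_iff.1 hS
  obtain ⟨ε', hε'0, hε'T⟩ := Metric.mem_nhds_iff.1 hT
  refine ⟨min r' r, lt_min hr'0 hr', min ε' ε, lt_min hε'0 hε, fun x t => α (x, t),
    fun x hx => ?_⟩
  have hx1 : x ∈ closedBall x₀ r :=
    ball_subset_closedBall (ball_subset_ball (min_le_right _ _) hx)
  have hx2 : x ∈ S := hr'S (ball_subset_ball (min_le_left _ _) hx)
  refine ⟨(hα x hx1).1, fun t ht => ⟨?_, ?_⟩⟩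
  · have h1 : 0 - ε < t := by linarith [ht.1, min_le_right ε' ε]
    have h2 : t < 0 + ε := by linarith [ht.2, min_le_right ε' ε]
    exact ((hα x hx1).2 t ⟨h1.le, h2.le⟩).hasDerivAt (Icc_mem_nhds h1 h2)
  · refine hST (Set.mk_mem_prod hx2 (hε'T ?_))
    rw [Real.ball_eq_Ioo]
    exact ⟨by linarith [ht.1, min_le_left ε' ε], by linarith [ht.2, min_le_left ε' ε]⟩

/-- A smooth vector field has smooth local integral curves. -/
theorem exists_smooth_integralCurve [CompleteSpace W] {f : W → W} {O : Set W} (hO : IsOpen O)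
    (hf : ContDiffOn ℝ ∞ f O) {x₀ : W} (hx₀ : x₀ ∈ O) :
    ∃ ε > (0 : ℝ), ∃ c : ℝ → W, c 0 = x₀ ∧ ContDiffOn ℝ ∞ c (Ioo (-ε) ε) ∧
      ∀ t ∈ Ioo (-ε) ε, HasDerivAt c (f (c t)) t ∧ c t ∈ O := by
  obtain ⟨r, hr, ε, hε, α, hα⟩ := exists_local_flow_mem
    ((hf.contDiffAt (hO.mem_nhds hx₀)).of_le (by exact_mod_cast le_top)) (hO.mem_nhds hx₀)
  obtain ⟨h0, h⟩ := hα x₀ (mem_ball_self hr)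
  have hsub : Icc (-(ε / 2)) (ε / 2) ⊆ Ioo (-ε) ε :=
    fun t ht => ⟨by linarith [ht.1], by linarith [ht.2]⟩
  refine ⟨ε / 2, half_pos hε, α x₀, h0, ?_,
    fun t ht => h t (hsub (Ioo_subset_Icc_self ht))⟩
  refine ContDiffOn.mono ?_ Ioo_subset_Icc_self
  refine ODE.contDiffOn_enat_Icc_of_hasDerivWithinAt (n := ⊤) (f := fun _ => f) (u := O) ?_
    (fun t ht => (h t (hsub ht)).1.hasDerivWithinAt) (fun t ht => (h t (hsub ht)).2)
  exact hf.comp contDiffOn_snd (fun p hp => hp.2)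

/-- Local uniqueness of the integral curves of a `C¹` vector field. -/
theorem integralCurve_eventuallyEq {f : W → W} {c d : ℝ → W} {t₀ : ℝ}
    (hf : ContDiffAt ℝ 1 f (c t₀)) (hc : ∀ᶠ t in 𝓝 t₀, HasDerivAt c (f (c t)) t)
    (hd : ∀ᶠ t in 𝓝 t₀, HasDerivAt d (f (d t)) t) (h : c t₀ = d t₀) : c =ᶠ[𝓝 t₀] d := by
  obtain ⟨K, s, hs, hl⟩ := hf.exists_lipschitzOnWith
  refine ODE_solution_unique_of_eventually (v := fun _ => f) (s := fun _ => s)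
    (Eventually.of_forall fun _ => hl) ?_ ?_ h
  · filter_upwards [hc, hc.self_of_nhds.continuousAt.eventually_mem hs] with t h1 h2
      using ⟨h1, h2⟩
  · filter_upwards [hd, hd.self_of_nhds.continuousAt.eventually_mem (by rwa [← h])] with t h1 h2
      using ⟨h1, h2⟩

theorem gronwallBound_zero_left_eq_mul (K c x : ℝ) :
    gronwallBound 0 K c x = c * gronwallBound 0 K 1 x := by
  unfold gronwallBound
  split_ifs <;> ring

/-- The difference of two trajectories agrees with the solution of the variational equation up to
an error which is quadratic in the difference of the initial values. -/
theorem norm_sub_sub_variation_le {f : W → W} {s : Set W} (hs : Convex ℝ s) {K K₂ : ℝ≥0}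
    (hf : ∀ x ∈ s, DifferentiableAt ℝ f x) (hK : LipschitzOnWith K f s)
    (hK' : ∀ x ∈ s, ‖fderiv ℝ f x‖ ≤ K) (hK₂ : LipschitzOnWith K₂ (fderiv ℝ f) s)
    {T : ℝ} (hT : 0 ≤ T) {α β : ℝ → W} {A : ℝ → W →L[ℝ] W}
    (hα : ∀ t ∈ Icc 0 T, HasDerivAt α (f (α t)) t ∧ α t ∈ s)
    (hβ : ∀ t ∈ Icc 0 T, HasDerivAt β (f (β t)) t ∧ β t ∈ s)
    (hA : ∀ t ∈ Icc 0 T, HasDerivAt A ((fderiv ℝ f (β t)).comp (A t)) t) (hA0 : A 0 = 1) :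
    ‖α T - β T - A T (α 0 - β 0)‖ ≤
      K₂ * Real.exp (K * T) ^ 2 * ‖α 0 - β 0‖ ^ 2 * gronwallBound 0 K 1 T := by
  have hdist : ∀ t ∈ Icc 0 T, ‖α t - β t‖ ≤ ‖α 0 - β 0‖ * Real.exp (K * T) := by
    intro t ht
    have := dist_le_of_trajectories_ODE_of_mem (v := fun _ => f) (s := fun _ => s) (K := K)
      (a := 0) (b := T) (f := α) (g := β) (δ := dist (α 0) (β 0)) (fun _ _ => hK)
      (fun t ht => (hα t ht).1.continuousAt.continuousWithinAt)
      (fun t ht => (hα t (Ico_subset_Icc_self ht)).1.hasDerivWithinAt)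
      (fun t ht => (hα t (Ico_subset_Icc_self ht)).2)
      (fun t ht => (hβ t ht).1.continuousAt.continuousWithinAt)
      (fun t ht => (hβ t (Ico_subset_Icc_self ht)).1.hasDerivWithinAt)
      (fun t ht => (hβ t (Ico_subset_Icc_self ht)).2) le_rfl t ht
    rw [dist_eq_norm, dist_eq_norm] at this
    refine this.trans ?_
    have := ht.2
    gcongr
    linarith
  rw [← gronwallBound_zero_left_eq_mul]
  set h := α 0 - β 0 with hh
  have hw : ∀ t ∈ Icc 0 T, HasDerivAt (fun t => α t - β t - A t h)
      (f (α t) - f (β t) - (fderiv ℝ f (β t)) (A t h)) t := by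
    intro t ht
    exact ((hα t ht).1.sub (hβ t ht).1).sub ((hA t ht).clm_apply (hasDerivAt_const t h)
      |>.congr_deriv (by simp))
  have := norm_le_gronwallBound_of_norm_deriv_right_le (f := fun t => α t - β t - A t h)
    (δ := 0) (K := K) (ε := K₂ * Real.exp (K * T) ^ 2 * ‖h‖ ^ 2) (a := 0) (b := T)
    (fun t ht => (hw t ht).continuousAt.continuousWithinAt)
    (fun t ht => (hw t (Ico_subset_Icc_self ht)).hasDerivWithinAt)
    (by simp [hA0, hh]) ?_ T ⟨hT, le_rfl⟩
  · simpa using this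
  intro t ht'
  have ht := Ico_subset_Icc_self ht'
  have hseg : segment ℝ (β t) (α t) ⊆ s := hs.segment_subset (hβ t ht).2 (hα t ht).2
  have key : ‖f (α t) - f (β t) - (fderiv ℝ f (β t)) (α t - β t)‖ ≤
      K₂ * ‖α t - β t‖ * ‖α t - β t‖ := by
    refine (convex_segment (β t) (α t)).norm_image_sub_le_of_norm_hasFDerivWithin_le'
      (f' := fderiv ℝ f)
      (fun x hx => (hf x (hseg hx)).hasFDerivAt.hasFDerivWithinAt) ?_
      (left_mem_segment _ _ _) (right_mem_segment _ _ _)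
    intro x hx
    have h1 := hK₂.dist_le_mul x (hseg hx) (β t) (hβ t ht).2
    rw [dist_eq_norm, dist_eq_norm] at h1
    refine h1.trans ?_
    gcongr
    exact norm_sub_le_of_mem_segment hx
  have e1 : f (α t) - f (β t) - (fderiv ℝ f (β t)) (A t h) =
      (fderiv ℝ f (β t)) (α t - β t - A t h) +
        (f (α t) - f (β t) - (fderiv ℝ f (β t)) (α t - β t)) := by
    simp only [map_sub]; abel
  rw [e1]
  refine (norm_add_le _ _).trans (add_le_add ?_ (key.trans ?_))
  · exact (ContinuousLinearMap.le_opNorm _ _).trans (by gcongr; exact hK' _ (hβ t ht).2)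
  · have := hdist t ht
    calc (K₂ : ℝ) * ‖α t - β t‖ * ‖α t - β t‖
        ≤ K₂ * (‖h‖ * Real.exp (K * T)) * (‖h‖ * Real.exp (K * T)) := by gcongr
      _ = _ := by ring

/-- The local flow of a `C²` vector field is differentiable with respect to the initial value, and
its derivative solves the variational equation. -/
theorem exists_local_flow_hasFDerivAt [CompleteSpace W] {f : W → W} {x₀ : W}
    (hf : ContDiffAt ℝ 2 f x₀) {O : Set W} (hO : O ∈ 𝓝 x₀) :
    ∃ r > (0 : ℝ), ∃ ε > (0 : ℝ), ∃ α : W → ℝ → W, ∃ A : ℝ → W →L[ℝ] W,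
      (∀ x ∈ ball x₀ r, α x 0 = x ∧
        ∀ t ∈ Ioo (-ε) ε, HasDerivAt (α x) (f (α x t)) t ∧ α x t ∈ O) ∧
      A 0 = 1 ∧ ∀ t ∈ Ioo (-ε) ε, HasDerivAt A ((fderiv ℝ f (α x₀ t)).comp (A t)) t ∧
        HasFDerivAt (fun x => α x t) (A t) x₀ := by
  have hf1 : ContDiffAt ℝ 1 f x₀ := hf.of_le (by norm_num)
  have hf' : ContDiffAt ℝ 1 (fderiv ℝ f) x₀ := hf.fderiv_right (by norm_num)
  obtain ⟨K, s₁, hs₁, hl₁⟩ := hf1.exists_lipschitzOnWith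
  obtain ⟨K₂, s₂, hs₂, hl₂⟩ := hf'.exists_lipschitzOnWith
  have hdiff : ∀ᶠ x in 𝓝 x₀, DifferentiableAt ℝ f x :=
    (hf1.eventually (by norm_num)).mono fun x hx => hx.differentiableAt (by norm_num)
  obtain ⟨ρ, hρ, hsub⟩ := Metric.mem_nhds_iff.1
    (Filter.inter_mem (Filter.inter_mem hs₁ hs₂) (Filter.inter_mem hO hdiff))
  set s := ball x₀ ρ with hs
  have hd : ∀ x ∈ s, DifferentiableAt ℝ f x := fun x hx => (hsub hx).2.2
  have hK : LipschitzOnWith K f s := hl₁.mono fun x hx => (hsub hx).1.1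
  have hK₂ : LipschitzOnWith K₂ (fderiv ℝ f) s := hl₂.mono fun x hx => (hsub hx).1.2
  have hK' : ∀ x ∈ s, ‖fderiv ℝ f x‖ ≤ K := fun x hx =>
    norm_fderiv_le_of_lipschitzOn ℝ (isOpen_ball.mem_nhds hx) hK
  -- The variational equation is solved together with the equation itself.
  let g : W × (W →L[ℝ] W) → W × (W →L[ℝ] W) := fun p => (f p.1, (fderiv ℝ f p.1).comp p.2)
  have hg : ContDiffAt ℝ 1 g (x₀, 1) := by
    have h1 : ContDiffAt ℝ 1 (fun p : W × (W →L[ℝ] W) => f p.1) (x₀, 1) :=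
      hf1.comp (x₀, (1 : W →L[ℝ] W)) contDiffAt_fst
    have h2 : ContDiffAt ℝ 1 (fun p : W × (W →L[ℝ] W) => fderiv ℝ f p.1) (x₀, 1) :=
      hf'.comp (x₀, (1 : W →L[ℝ] W)) contDiffAt_fst
    exact h1.prodMk (h2.clm_comp contDiffAt_snd)
  obtain ⟨r, hr, ε, hε, β, hβ⟩ := exists_local_flow_mem hg (O := Prod.fst ⁻¹' s)
    (continuousAt_fst.preimage_mem_nhds (ball_mem_nhds _ hρ))
  have hball : ∀ x ∈ ball x₀ r, (x, (1 : W →L[ℝ] W)) ∈ ball (x₀, (1 : W →L[ℝ] W)) r := by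
    intro x hx
    rw [← ball_prod_same]
    exact ⟨hx, mem_ball_self hr⟩
  have hα : ∀ x ∈ ball x₀ r, (β (x, 1) 0).1 = x ∧ ∀ t ∈ Ioo (-ε) ε,
      HasDerivAt (fun t => (β (x, 1) t).1) (f (β (x, 1) t).1) t ∧ (β (x, 1) t).1 ∈ s := by
    intro x hx
    obtain ⟨h0, h⟩ := hβ _ (hball x hx)
    exact ⟨by rw [h0], fun t ht => ⟨(h t ht).1.fst, (h t ht).2⟩⟩
  obtain ⟨h0, h⟩ := hβ _ (hball x₀ (mem_ball_self hr))
  have hA : ∀ t ∈ Ioo (-ε) ε, HasDerivAt (fun t => (β (x₀, 1) t).2)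
      ((fderiv ℝ f (β (x₀, 1) t).1).comp (β (x₀, 1) t).2) t := fun t ht => (h t ht).1.snd
  refine ⟨r, hr, ε, hε, fun x t => (β (x, 1) t).1, fun t => (β (x₀, 1) t).2,
    fun x hx => ⟨(hα x hx).1, fun t ht => ⟨((hα x hx).2 t ht).1,
      (hsub ((hα x hx).2 t ht).2).2.1⟩⟩, congrArg Prod.snd h0, fun t ht => ⟨hA t ht, ?_⟩⟩
  obtain ⟨C, hC⟩ : ∃ C : ℝ, ∀ x ∈ ball x₀ r,
      ‖(β (x, 1) t).1 - (β (x₀, 1) t).1 - (β (x₀, 1) t).2 (x - x₀)‖ ≤ C * ‖x - x₀‖ ^ 2 := by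
    rcases le_total 0 t with ht0 | ht0
    · refine ⟨K₂ * Real.exp (K * t) ^ 2 * gronwallBound 0 K 1 t, fun x hx => ?_⟩
      have hsubI : Icc 0 t ⊆ Ioo (-ε) ε :=
        fun u hu => ⟨by linarith [hu.1], by linarith [hu.2, ht.2]⟩
      have := norm_sub_sub_variation_le (convex_ball x₀ ρ) hd hK hK' hK₂ ht0
        (fun u hu => (hα x hx).2 u (hsubI hu))
        (fun u hu => (hα x₀ (mem_ball_self hr)).2 u (hsubI hu))
        (fun u hu => hA u (hsubI hu)) (by rw [h0])
      rw [(hα x hx).1, (hα x₀ (mem_ball_self hr)).1] at this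
      exact this.trans (le_of_eq (by ring))
    · -- Negative times are reduced to positive ones by reversing the vector field.
      refine ⟨K₂ * Real.exp (K * (-t)) ^ 2 * gronwallBound 0 K 1 (-t), fun x hx => ?_⟩
      have hsubI : ∀ u ∈ Icc 0 (-t), -u ∈ Ioo (-ε) ε :=
        fun u hu => ⟨by linarith [hu.2, ht.1], by linarith [hu.1]⟩
      have hfn : ∀ x, fderiv ℝ (fun y => -f y) x = -fderiv ℝ f x := fun x => fderiv_fun_neg
      have hrev : ∀ y ∈ ball x₀ r, ∀ u ∈ Icc 0 (-t),
          HasDerivAt (fun u => (β (y, 1) (-u)).1) (-f (β (y, 1) (-u)).1) u ∧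
            (β (y, 1) (-u)).1 ∈ s := by
        intro y hy u hu
        have := (hα y hy).2 _ (hsubI u hu)
        refine ⟨?_, this.2⟩
        exact (this.1.scomp u (hasDerivAt_neg u)).congr_deriv (by simp)
      have := norm_sub_sub_variation_le (f := fun y => -f y) (K := K) (K₂ := K₂)
        (A := fun u => (β (x₀, 1) (-u)).2) (convex_ball x₀ ρ)
        (fun y hy => (hd y hy).neg) hK.neg (fun y hy => by rw [hfn, norm_neg]; exact hK' y hy)
        (by rw [funext hfn]; exact hK₂.neg) (neg_nonneg.2 ht0) (hrev x hx)
        (hrev x₀ (mem_ball_self hr))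
        (fun u hu => by
          rw [hfn]
          exact ((hA _ (hsubI u hu)).scomp u (hasDerivAt_neg u)).congr_deriv (by ext; simp))
        (by simp [h0])
      simp only [neg_neg, neg_zero] at this
      rw [(hα x hx).1, (hα x₀ (mem_ball_self hr)).1] at this
      exact this.trans (le_of_eq (by ring))
  rw [hasFDerivAt_iff_isLittleO]
  have hO : (fun x => (β (x, 1) t).1 - (β (x₀, 1) t).1 - (β (x₀, 1) t).2 (x - x₀))
      =O[𝓝 x₀] fun x => ‖x - x₀‖ ^ 2 := by
    refine Asymptotics.IsBigO.of_bound C ?_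
    filter_upwards [ball_mem_nhds x₀ hr] with x hx
    simpa using hC x hx
  refine hO.trans_isLittleO ?_
  have h1 : Tendsto (fun x : W => x - x₀) (𝓝 x₀) (𝓝 0) := by
    simpa using (continuous_id.sub continuous_const).tendsto (f := fun x : W => x - x₀) x₀
  exact (Asymptotics.isLittleO_norm_pow_id one_lt_two).comp_tendsto h1

/-- Let `Ψ` be a family of curves in a Hausdorff space which are, in a chart `e`, integral curves
of a `C²` vector field `f`. Then the time-`t` maps are, for small `t`, differentiable at the given
point in this chart, with derivative the solution of the variational equation. -/
theorem exists_hasFDerivAt_flow [CompleteSpace W] {N : Type*} [TopologicalSpace N] [T2Space N]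
    (e : OpenPartialHomeomorph N W) {Ψ : ℝ → N → N} (hΨ0 : ∀ q, Ψ 0 q = q)
    (hΨc : ∀ q, Continuous fun t => Ψ t q) {q₀ : N} (hq₀ : q₀ ∈ e.source) {f : W → W} {O : Set W}
    (hO : IsOpen O) (hq₀O : e q₀ ∈ O) (hf : ContDiffOn ℝ 2 f O)
    (hΨ : ∀ q t, Ψ t q ∈ e.source → e (Ψ t q) ∈ O →
      HasDerivAt (fun s => e (Ψ s q)) (f (e (Ψ t q))) t) :
    ∃ ε > (0 : ℝ), ∃ A : ℝ → W →L[ℝ] W, A 0 = 1 ∧ ∀ t ∈ Ioo (-ε) ε,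
      Ψ t q₀ ∈ e.source ∧ e (Ψ t q₀) ∈ O ∧ ContinuousAt (Ψ t) q₀ ∧
      HasDerivAt A ((fderiv ℝ f (e (Ψ t q₀))).comp (A t)) t ∧
      HasFDerivAt (fun z => e (Ψ t (e.symm z))) (A t) (e q₀) := by
  obtain ⟨r, hr, ε, hε, α, A, hα, hA0, hA⟩ := exists_local_flow_hasFDerivAt
    (hf.contDiffAt (hO.mem_nhds hq₀O)) (O := O ∩ e.target)
    (Filter.inter_mem (hO.mem_nhds hq₀O) (e.open_target.mem_nhds (e.map_source hq₀)))
  -- By uniqueness, `Ψ` is the local flow of `f` read in the chart.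
  have hev : ∀ q ∈ e.source, e q ∈ ball (e q₀) r →
      EqOn (fun t => Ψ t q) (fun t => e.symm (α (e q) t)) (Ioo (-ε) ε) := by
    intro q hq hqr
    obtain ⟨h0, h⟩ := hα _ hqr
    set S := {t | Ψ t q = e.symm (α (e q) t)} ∩ Ioo (-ε) ε with hS
    have hcα : ContinuousOn (fun t => e.symm (α (e q) t)) (Ioo (-ε) ε) := by
      intro t ht
      exact ((e.continuousAt_symm (h t ht).2.2).comp
        (h t ht).1.continuousAt).continuousWithinAt
    suffices hsub : Ioo (-ε) ε ⊆ S from fun t ht => (hsub ht).1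
    apply isPreconnected_Ioo.subset_of_closure_inter_subset (s := Ioo (-ε) ε) (u := S) _
      ⟨0, ⟨by linarith, hε⟩, ⟨by simp [hΨ0, h0, e.left_inv hq], by linarith, hε⟩⟩
    · rintro t ⟨ht, htI⟩
      refine ⟨?_, htI⟩
      have : (𝓝[S] t).NeBot := mem_closure_iff_nhdsWithin_neBot.1 ht
      refine tendsto_nhds_unique_of_eventuallyEq (l := 𝓝[S] t)
        ((hΨc q).continuousAt.tendsto.mono_left nhdsWithin_le_nhds)
        ((hcα t htI).tendsto.mono_left (nhdsWithin_mono _ inter_subset_right)) ?_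
      exact eventually_mem_nhdsWithin.mono fun u hu => hu.1
    · rw [isOpen_iff_mem_nhds]
      rintro t ⟨ht, htI⟩
      have ht' : Ψ t q = e.symm (α (e q) t) := ht
      have hsrc : Ψ t q ∈ e.source := by rw [ht']; exact e.map_target (h t htI).2.2
      have hval : e (Ψ t q) = α (e q) t := by rw [ht', e.right_inv (h t htI).2.2]
      have hO' : e (Ψ t q) ∈ O := by rw [hval]; exact (h t htI).2.1
      have hIn : Ioo (-ε) ε ∈ 𝓝 t := Ioo_mem_nhds htI.1 htI.2
      have hsrc' : ∀ᶠ u in 𝓝 t, Ψ u q ∈ e.source :=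
        (hΨc q).continuousAt.eventually_mem (e.open_source.mem_nhds hsrc)
      have hO'' : ∀ᶠ u in 𝓝 t, e (Ψ u q) ∈ O :=
        (ContinuousAt.comp (f := fun u => Ψ u q) (e.continuousAt hsrc)
          (hΨc q).continuousAt).eventually_mem (hO.mem_nhds hO')
      have heq : (fun u => e (Ψ u q)) =ᶠ[𝓝 t] α (e q) := by
        refine integralCurve_eventuallyEq (f := f)
          ((hf.contDiffAt (hO.mem_nhds hO')).of_le (by norm_num)) ?_ ?_ hval
        · filter_upwards [hsrc', hO''] with u h1 h2 using hΨ q u h1 h2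
        · filter_upwards [hIn] with u hu using (h u hu).1
      filter_upwards [heq, hsrc', hIn] with u h1 h2 h3
      refine ⟨?_, h3⟩
      change Ψ u q = e.symm (α (e q) u)
      rw [← h1, e.left_inv h2]
  have hq₀r : e q₀ ∈ ball (e q₀) r := mem_ball_self hr
  have hnear : ∀ᶠ q in 𝓝 q₀, q ∈ e.source ∧ e q ∈ ball (e q₀) r :=
    (e.open_source.eventually_mem hq₀).and
      ((e.continuousAt hq₀).eventually_mem (ball_mem_nhds _ hr))
  refine ⟨ε, hε, A, hA0, fun t ht => ?_⟩
  have hval : Ψ t q₀ = e.symm (α (e q₀) t) := hev q₀ hq₀ hq₀r ht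
  have hmem := ((hα _ hq₀r).2 t ht).2
  have he : e (Ψ t q₀) = α (e q₀) t := by rw [hval, e.right_inv hmem.2]
  refine ⟨by rw [hval]; exact e.map_target hmem.2, by rw [he]; exact hmem.1, ?_,
    by rw [he]; exact (hA t ht).1, ?_⟩
  · have hcont : ContinuousAt (fun q => e.symm (α (e q) t)) q₀ :=
      ContinuousAt.comp (f := fun q => α (e q) t) (e.continuousAt_symm hmem.2)
        (ContinuousAt.comp (f := e) (hA t ht).2.continuousAt (e.continuousAt hq₀))
    refine hcont.congr ?_
    filter_upwards [hnear] with q hq using (hev q hq.1 hq.2 ht).symm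
  · refine (hA t ht).2.congr_of_eventuallyEq ?_
    filter_upwards [e.open_target.mem_nhds (e.map_source hq₀), ball_mem_nhds (e q₀) hr]
      with z hz hzr
    have h1 := hev (e.symm z) (e.map_target hz) (by rwa [e.right_inv hz]) ht
    have h2 := ((hα _ hzr).2 t ht).2
    simp only [e.right_inv hz] at h1
    rw [h1, e.right_inv h2.2]

end ODE

/-! ### Canonical frames of isotropic curves in a symplectic vector space -/

section Symplectic

open Set Filter

variable {n : ℕ}

/-- The standard symplectic form `(ξ, η) ↦ ξ_p(η_x) - η_p(ξ_x)` of `ℝⁿ × (ℝⁿ)*`, as a bilinear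
map. -/
def omega (n : ℕ) : (Coord n × Dual n) →ₗ[ℝ] (Coord n × Dual n) →ₗ[ℝ] ℝ :=
  LinearMap.mk₂ ℝ (fun a b => a.2 b.1 - b.2 a.1) (fun a a' b => by simp; ring)
    (fun c a b => by simp; ring) (fun a b b' => by simp; ring) (fun c a b => by simp; ring)

theorem omega_apply (a b : Coord n × Dual n) : omega n a b = a.2 b.1 - b.2 a.1 := rfl

theorem omega_swap (a b : Coord n × Dual n) : omega n a b = -omega n b a := by
  simp [omega_apply]

theorem eq_zero_of_omega_eq_zero {a : Coord n × Dual n} (h : ∀ b, omega n a b = 0) : a = 0 := by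
  have h2 : a.2 = 0 := by
    ext x
    simpa [omega_apply] using h (x, 0)
  have h1 : a.1 = 0 := by
    ext i
    simpa [omega_apply, basisCovec] using h (0, basisCovec i)
  exact Prod.ext h1 h2

theorem _root_.HasDerivAt.omega {a b : ℝ → Coord n × Dual n} {a' b' : Coord n × Dual n} {t : ℝ}
    (ha : HasDerivAt a a' t) (hb : HasDerivAt b b' t) :
    HasDerivAt (fun s => FinslerCurvature.omega n (a s) (b s))
      (FinslerCurvature.omega n a' (b t) + FinslerCurvature.omega n (a t) b') t := by
  have ha1 : HasDerivAt (fun s => (a s).1) a'.1 t := ha.fst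
  have ha2 : HasDerivAt (fun s => (a s).2) a'.2 t := ha.snd
  have hb1 : HasDerivAt (fun s => (b s).1) b'.1 t := hb.fst
  have hb2 : HasDerivAt (fun s => (b s).2) b'.2 t := hb.snd
  refine ((ha2.clm_apply hb1).sub (hb2.clm_apply ha1)).congr_deriv ?_
  simp only [omega_apply]
  ring

theorem finrank_phaseSpace : Module.finrank ℝ (Coord n × Dual n) = n + n := by
  have h : Module.finrank ℝ (Dual n) = n := by
    rw [← (LinearMap.toContinuousLinearMap (𝕜 := ℝ) (E := Coord n) (F' := ℝ)).finrank_eq,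
      Subspace.dual_finrank_eq]
    simp
  rw [Module.finrank_prod, h]
  simp

/-- A vector which is skew-orthogonal to a Darboux basis is zero. -/
theorem eq_zero_of_omega_darboux_eq_zero {e f : Fin n → Coord n × Dual n}
    (hfe : ∀ i j, omega n (f i) (e j) = if i = j then 1 else 0)
    (hee : ∀ i j, omega n (e i) (e j) = 0) {w : Coord n × Dual n}
    (hwe : ∀ j, omega n w (e j) = 0) (hwf : ∀ j, omega n w (f j) = 0) : w = 0 := by
  have hli : LinearIndependent ℝ (Sum.elim e f) := by
    rw [Fintype.linearIndependent_iff]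
    intro g hg
    have hg' : ∀ u, omega n (∑ i, g (Sum.inl i) • e i + ∑ i, g (Sum.inr i) • f i) u = 0 := by
      intro u
      have : ∑ i, g (Sum.inl i) • e i + ∑ i, g (Sum.inr i) • f i = 0 := by
        simpa [Fintype.sum_sum_type] using hg
      rw [this]
      simp
    have hr : ∀ j, g (Sum.inr j) = 0 := by
      intro j
      simpa [hee, hfe] using hg' (e j)
    have hl : ∀ j, g (Sum.inl j) = 0 := by
      intro j
      have hef : ∀ i, omega n (e i) (f j) = -if j = i then 1 else 0 := fun i => by
        rw [omega_swap, hfe]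
      simpa [hr, hef] using hg' (f j)
    rintro (i | i)
    exacts [hl i, hr i]
  have hspan : Submodule.span ℝ (range (Sum.elim e f)) = ⊤ :=
    hli.span_eq_top_of_card_eq_finrank' (by rw [finrank_phaseSpace]; simp)
  refine eq_zero_of_omega_eq_zero fun b => ?_
  have hb : b ∈ Submodule.span ℝ (range (Sum.elim e f)) := by rw [hspan]; trivial
  induction hb using Submodule.span_induction with
  | mem x hx =>
    obtain ⟨i | i, rfl⟩ := hx
    exacts [hwe i, hwf i]
  | zero => simp
  | add x y _ _ hx hy => simp [hx, hy]
  | smul c x _ hx => simp [hx]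

/-- `e` is a canonical frame, on the time interval `(-ε, ε)`, of the curve `J` of subspaces of
`ℝⁿ × (ℝⁿ)*`. -/
structure IsFrameOf (J : ℝ → Submodule ℝ (Coord n × Dual n)) (ε : ℝ)
    (e : Fin n → ℝ → Coord n × Dual n) : Prop where
  smooth : ∀ i, ContDiffOn ℝ ∞ (e i) (Ioo (-ε) ε)
  mem : ∀ i, ∀ t ∈ Ioo (-ε) ε, e i t ∈ J t
  second_deriv_mem : ∀ i, ∀ t ∈ Ioo (-ε) ε, deriv (deriv (e i)) t ∈ J t
  darboux_fe : ∀ i j, ∀ t ∈ Ioo (-ε) ε,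
    omega n (deriv (e i) t) (e j t) = if i = j then 1 else 0
  darboux_ee : ∀ i j, ∀ t ∈ Ioo (-ε) ε, omega n (e i t) (e j t) = 0
  darboux_ff : ∀ i j, ∀ t ∈ Ioo (-ε) ε, omega n (deriv (e i) t) (deriv (e j) t) = 0

theorem hasDerivAt_of_contDiffOn_Ioo {W : Type*} [NormedAddCommGroup W] [NormedSpace ℝ W]
    {ε : ℝ} {a : ℝ → W} (ha : ContDiffOn ℝ ∞ a (Ioo (-ε) ε)) {t : ℝ} (ht : t ∈ Ioo (-ε) ε) :
    HasDerivAt a (deriv a t) t ∧ HasDerivAt (deriv a) (deriv (deriv a) t) t := by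
  have h1 : ContDiffOn ℝ ∞ (deriv a) (Ioo (-ε) ε) :=
    ha.deriv_of_isOpen isOpen_Ioo (by simp)
  have hI := isOpen_Ioo.mem_nhds ht
  exact ⟨((ha.differentiableOn (by simp)).differentiableAt hI).hasDerivAt,
    ((h1.differentiableOn (by simp)).differentiableAt hI).hasDerivAt⟩

/-- Differentiating `ω(a, b) = 0` twice shows `ω(ȧ, ḃ) = 0`, for curves `a`, `b` which lie in an
isotropic curve `J` together with their second derivatives. Hence `ω(ȧ, b)` is constant. -/
theorem omega_deriv_of_isotropic {J : ℝ → Submodule ℝ (Coord n × Dual n)} {ε : ℝ}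
    (hJ : ∀ t ∈ Ioo (-ε) ε, ∀ a ∈ J t, ∀ b ∈ J t, omega n a b = 0)
    {a b : ℝ → Coord n × Dual n} (ha : ContDiffOn ℝ ∞ a (Ioo (-ε) ε))
    (hb : ContDiffOn ℝ ∞ b (Ioo (-ε) ε)) (haJ : ∀ t ∈ Ioo (-ε) ε, a t ∈ J t)
    (hbJ : ∀ t ∈ Ioo (-ε) ε, b t ∈ J t) (haJ₂ : ∀ t ∈ Ioo (-ε) ε, deriv (deriv a) t ∈ J t)
    (hbJ₂ : ∀ t ∈ Ioo (-ε) ε, deriv (deriv b) t ∈ J t) :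
    (∀ t ∈ Ioo (-ε) ε, omega n (deriv a t) (deriv b t) = 0) ∧
      ∀ t ∈ Ioo (-ε) ε, omega n (deriv a t) (b t) = omega n (deriv a 0) (b 0) := by
  have h1 : ∀ t ∈ Ioo (-ε) ε, omega n (deriv a t) (b t) + omega n (a t) (deriv b t) = 0 := by
    intro t ht
    have hd := (hasDerivAt_of_contDiffOn_Ioo ha ht).1.omega (hasDerivAt_of_contDiffOn_Ioo hb ht).1
    refine hd.unique ((hasDerivAt_const t (0 : ℝ)).congr_of_eventuallyEq ?_)
    filter_upwards [isOpen_Ioo.mem_nhds ht] with s hs using hJ s hs _ (haJ s hs) _ (hbJ s hs)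
  have h2 : ∀ t ∈ Ioo (-ε) ε, omega n (deriv a t) (deriv b t) = 0 := by
    intro t ht
    obtain ⟨ha1, ha2⟩ := hasDerivAt_of_contDiffOn_Ioo ha ht
    obtain ⟨hb1, hb2⟩ := hasDerivAt_of_contDiffOn_Ioo hb ht
    have hd := (ha2.omega hb1).add (ha1.omega hb2)
    have h0 := hd.unique ((hasDerivAt_const t (0 : ℝ)).congr_of_eventuallyEq
      (by filter_upwards [isOpen_Ioo.mem_nhds ht] with s hs using h1 s hs))
    have h3 := hJ t ht _ (haJ₂ t ht) _ (hbJ t ht)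
    have h4 := hJ t ht _ (haJ t ht) _ (hbJ₂ t ht)
    linarith
  refine ⟨h2, fun t ht => ?_⟩
  have hder : ∀ s ∈ Ioo (-ε) ε, HasDerivAt (fun s => omega n (deriv a s) (b s)) 0 s := by
    intro s hs
    refine ((hasDerivAt_of_contDiffOn_Ioo ha hs).2.omega
      (hasDerivAt_of_contDiffOn_Ioo hb hs).1).congr_deriv ?_
    rw [h2 s hs, hJ s hs _ (haJ₂ s hs) _ (hbJ s hs), add_zero]
  have h0 : (0 : ℝ) ∈ Ioo (-ε) ε := by
    have := ht.1.trans ht.2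
    constructor <;> linarith
  exact isOpen_Ioo.is_const_of_deriv_eq_zero isPreconnected_Ioo
    (fun s hs => (hder s hs).differentiableAt.differentiableWithinAt)
    (fun s hs => (hder s hs).deriv) ht h0

/-- For a frame of an isotropic curve with `ëᵢ` in the curve, it is enough to normalise
`ω(ėᵢ, eⱼ)` at time zero. -/
theorem IsFrameOf.of_normalised {J : ℝ → Submodule ℝ (Coord n × Dual n)} {ε : ℝ}
    (hJ : ∀ t ∈ Ioo (-ε) ε, ∀ a ∈ J t, ∀ b ∈ J t, omega n a b = 0)
    {e : Fin n → ℝ → Coord n × Dual n} (he : ∀ i, ContDiffOn ℝ ∞ (e i) (Ioo (-ε) ε))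
    (heJ : ∀ i, ∀ t ∈ Ioo (-ε) ε, e i t ∈ J t)
    (heJ₂ : ∀ i, ∀ t ∈ Ioo (-ε) ε, deriv (deriv (e i)) t ∈ J t)
    (h0 : ∀ i j, omega n (deriv (e i) 0) (e j 0) = if i = j then 1 else 0) :
    IsFrameOf J ε e where
  smooth := he
  mem := heJ
  second_deriv_mem := heJ₂
  darboux_fe i j t ht := by
    rw [(omega_deriv_of_isotropic hJ (he i) (he j) (heJ i) (heJ j) (heJ₂ i) (heJ₂ j)).2 t ht, h0]
  darboux_ee i j t ht := hJ t ht _ (heJ i t ht) _ (heJ j t ht)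
  darboux_ff i j :=
    (omega_deriv_of_isotropic hJ (he i) (he j) (heJ i) (heJ j) (heJ₂ i) (heJ₂ j)).1

/-- Two canonical frames of an isotropic curve differ by a constant matrix. -/
theorem IsFrameOf.exists_eq_sum {J : ℝ → Submodule ℝ (Coord n × Dual n)} {ε : ℝ}
    (hJ : ∀ t ∈ Ioo (-ε) ε, ∀ a ∈ J t, ∀ b ∈ J t, omega n a b = 0)
    {e e' : Fin n → ℝ → Coord n × Dual n} (he : IsFrameOf J ε e) (he' : IsFrameOf J ε e') :
    ∃ U : Fin n → Fin n → ℝ, ∀ i, ∀ t ∈ Ioo (-ε) ε, e' i t = ∑ j, U i j • e j t := by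
  refine ⟨fun i j => omega n (deriv (e j) 0) (e' i 0), fun i t ht => ?_⟩
  have hU : ∀ j, omega n (deriv (e j) 0) (e' i 0) = omega n (deriv (e j) t) (e' i t) := fun j =>
    ((omega_deriv_of_isotropic hJ (he.smooth j) (he'.smooth i) (he.mem j) (he'.mem i)
      (he.second_deriv_mem j) (he'.second_deriv_mem i)).2 t ht).symm
  simp only [hU]
  rw [← sub_eq_zero]
  refine eq_zero_of_omega_darboux_eq_zero (fun i j => he.darboux_fe i j t ht)
    (fun i j => he.darboux_ee i j t ht) (fun j => ?_)
    (fun j => ?_)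
  · simp [he.darboux_ee _ _ t ht, hJ t ht _ (he'.mem i t ht) _ (he.mem j t ht)]
  · have hef : ∀ k, omega n (e k t) (deriv (e j) t) = -if j = k then 1 else 0 := fun k => by
      rw [omega_swap, he.darboux_fe j k t ht]
    simp [hef, omega_swap (e' i t)]

/-- The second derivatives of two canonical frames are related by the same matrix as the frames
themselves. -/
theorem IsFrameOf.exists_eq_sum_zero {J : ℝ → Submodule ℝ (Coord n × Dual n)} {ε : ℝ} (hε : 0 < ε)
    (hJ : ∀ t ∈ Ioo (-ε) ε, ∀ a ∈ J t, ∀ b ∈ J t, omega n a b = 0)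
    {e e' : Fin n → ℝ → Coord n × Dual n} (he : IsFrameOf J ε e) (he' : IsFrameOf J ε e') :
    ∃ U : Fin n → Fin n → ℝ, ∀ i, e' i 0 = ∑ j, U i j • e j 0 ∧
      deriv (deriv (e' i)) 0 = ∑ j, U i j • deriv (deriv (e j)) 0 := by
  obtain ⟨U, hU⟩ := he.exists_eq_sum hJ he'
  have h0 : (0 : ℝ) ∈ Ioo (-ε) ε := ⟨by linarith, hε⟩
  refine ⟨U, fun i => ⟨hU i 0 h0, ?_⟩⟩
  have h1 : ∀ t ∈ Ioo (-ε) ε, deriv (e' i) t = ∑ j, U i j • deriv (e j) t := by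
    intro t ht
    refine HasDerivAt.deriv ?_
    refine HasDerivAt.congr_of_eventuallyEq (f := fun t => ∑ j, U i j • e j t) ?_
      (by filter_upwards [isOpen_Ioo.mem_nhds ht] with s hs using hU i s hs)
    exact HasDerivAt.fun_sum fun j _ =>
      (hasDerivAt_of_contDiffOn_Ioo (he.smooth j) ht).1.const_smul (U i j)
  refine HasDerivAt.deriv ?_
  refine HasDerivAt.congr_of_eventuallyEq (f := fun t => ∑ j, U i j • deriv (e j) t) ?_
    (by filter_upwards [isOpen_Ioo.mem_nhds h0] with s hs using h1 s hs)
  exact HasDerivAt.fun_sum fun j _ =>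
    (hasDerivAt_of_contDiffOn_Ioo (he.smooth j) h0).2.const_smul (U i j)

theorem IsFrameOf.mono {J : ℝ → Submodule ℝ (Coord n × Dual n)} {ε δ : ℝ} (h : δ ≤ ε)
    {e : Fin n → ℝ → Coord n × Dual n} (he : IsFrameOf J ε e) : IsFrameOf J δ e := by
  have hs : Ioo (-δ) δ ⊆ Ioo (-ε) ε := Ioo_subset_Ioo (by linarith) h
  exact ⟨fun i => (he.smooth i).mono hs, fun i t ht => he.mem i t (hs ht),
    fun i t ht => he.second_deriv_mem i t (hs ht), fun i j t ht => he.darboux_fe i j t (hs ht),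
    fun i j t ht => he.darboux_ee i j t (hs ht), fun i j t ht => he.darboux_ff i j t (hs ht)⟩

end Symplectic

/-! ### Finsler Lagrangians in coordinates and their Legendre transform -/

section Lagrangian

open Set Filter

variable {n : ℕ}

theorem basisCovec_apply (i : Fin n) (x : Coord n) : basisCovec i x = x i := rfl

theorem basisVec_apply (i j : Fin n) : (basisVec i : Coord n) j = if j = i then 1 else 0 := by
  simp [basisVec]

theorem sum_smul_basisVec (x : Coord n) : ∑ i, x i • basisVec i = x := by
  ext j
  simp [basisVec_apply]

theorem sum_smul_basisCovec (p : Dual n) : ∑ i, p (basisVec i) • basisCovec i = p := by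
  ext x
  conv_rhs => rw [← sum_smul_basisVec x]
  simp [basisCovec_apply, mul_comm]

/-- The pairs `(x, v)` with `x ∈ U` and `v ≠ 0`. -/
def slit (U : Set (Coord n)) : Set (Coord n × Coord n) := {z | z.1 ∈ U ∧ z.2 ≠ 0}

/-- `L` is the Lagrangian `F² / 2` of a Finsler metric `F` on the open set `U ⊆ ℝⁿ`. -/
structure IsFinslerLagrangian (U : Set (Coord n)) (L : Coord n × Coord n → ℝ) : Prop where
  isOpen : IsOpen U
  smooth : ContDiffOn ℝ ∞ L (slit U)
  homogeneous : ∀ x v (c : ℝ), 0 < c → L (x, c • v) = c ^ 2 * L (x, v)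
  nonneg : ∀ z, 0 ≤ L z
  hessian_pos : ∀ z ∈ slit U, ∀ u ≠ 0, 0 < fderiv ℝ (fderiv ℝ L) z (0, u) (0, u)

theorem isOpen_slit {U : Set (Coord n)} (hU : IsOpen U) : IsOpen (slit U) :=
  (hU.preimage continuous_fst).inter (isOpen_compl_singleton.preimage continuous_snd)

theorem smul_mem_slit {U : Set (Coord n)} {z : Coord n × Coord n} (hz : z ∈ slit U) {c : ℝ}
    (hc : 0 < c) : (z.1, c • z.2) ∈ slit U := ⟨hz.1, smul_ne_zero hc.ne' hz.2⟩

namespace IsFinslerLagrangian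

variable {U : Set (Coord n)} {L : Coord n × Coord n → ℝ} (hL : IsFinslerLagrangian U L)
include hL

theorem slit_mem_nhds {z : Coord n × Coord n} (hz : z ∈ slit U) : slit U ∈ 𝓝 z :=
  (isOpen_slit hL.isOpen).mem_nhds hz

theorem contDiffAt {z : Coord n × Coord n} (hz : z ∈ slit U) : ContDiffAt ℝ ∞ L z :=
  hL.smooth.contDiffAt (hL.slit_mem_nhds hz)

theorem contDiffOn_fderiv : ContDiffOn ℝ ∞ (fderiv ℝ L) (slit U) :=
  hL.smooth.fderiv_of_isOpen (isOpen_slit hL.isOpen) (by simp)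

theorem hasFDerivAt {z : Coord n × Coord n} (hz : z ∈ slit U) :
    HasFDerivAt L (fderiv ℝ L z) z :=
  ((hL.contDiffAt hz).differentiableAt (by simp)).hasFDerivAt

theorem hasFDerivAt_fderiv {z : Coord n × Coord n} (hz : z ∈ slit U) :
    HasFDerivAt (fderiv ℝ L) (fderiv ℝ (fderiv ℝ L) z) z :=
  ((hL.contDiffOn_fderiv.contDiffAt (hL.slit_mem_nhds hz)).differentiableAt
    (by simp)).hasFDerivAt

omit hL in
theorem hasFDerivAt_scale (c : ℝ) (z : Coord n × Coord n) :
    HasFDerivAt (fun y : Coord n × Coord n => (y.1, c • y.2))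
      ((ContinuousLinearMap.fst ℝ (Coord n) (Coord n)).prod
        (c • ContinuousLinearMap.snd ℝ (Coord n) (Coord n))) z :=
  hasFDerivAt_fst.prodMk (hasFDerivAt_snd.const_smul c)

theorem fderiv_scale {z : Coord n × Coord n} (hz : z ∈ slit U) {c : ℝ} (hc : 0 < c)
    (a b : Coord n) :
    fderiv ℝ L (z.1, c • z.2) (a, c • b) = c ^ 2 * fderiv ℝ L z (a, b) := by
  have h1 := (hL.hasFDerivAt (smul_mem_slit hz hc)).comp z (hasFDerivAt_scale c z)
  have h2 : HasFDerivAt (L ∘ fun y : Coord n × Coord n => (y.1, c • y.2))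
      (c ^ 2 • fderiv ℝ L z) z := by
    refine ((hL.hasFDerivAt hz).const_smul (c ^ 2)).congr_of_eventuallyEq ?_
    exact Eventually.of_forall fun y => by simp [hL.homogeneous y.1 y.2 c hc]
  simpa using congrArg (fun T => T (a, b)) (h1.unique h2)

theorem fderiv_fderiv_scale {z : Coord n × Coord n} (hz : z ∈ slit U) {c : ℝ} (hc : 0 < c)
    (a b a' b' : Coord n) :
    fderiv ℝ (fderiv ℝ L) (z.1, c • z.2) (a, c • b) (a', c • b') =
      c ^ 2 * fderiv ℝ (fderiv ℝ L) z (a, b) (a', b') := by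
  have h1 := ((hL.hasFDerivAt_fderiv (smul_mem_slit hz hc)).comp z
    (hasFDerivAt_scale c z)).clm_apply (hasFDerivAt_const (a', c • b') z)
  have h2 : HasFDerivAt (fun y : Coord n × Coord n => fderiv ℝ L (y.1, c • y.2) (a', c • b'))
      (c ^ 2 • (fderiv ℝ (fderiv ℝ L) z).flip (a', b')) z := by
    refine HasFDerivAt.congr_of_eventuallyEq
      (f := fun y => c ^ 2 • fderiv ℝ L y (a', b')) ?_ ?_
    · exact (((hL.hasFDerivAt_fderiv hz).clm_apply (hasFDerivAt_const (a', b') z)).const_smul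
        (c ^ 2)).congr_fderiv (by ext <;> simp)
    · filter_upwards [hL.slit_mem_nhds hz] with y hy
      simpa using hL.fderiv_scale hy hc a' b'
  simpa using congrArg (fun T => T (a, b)) (h1.unique h2)

/-- Euler's relation for the Lagrangian. -/
theorem fderiv_self {z : Coord n × Coord n} (hz : z ∈ slit U) :
    fderiv ℝ L z (0, z.2) = 2 * L z := by
  have hc : HasDerivAt (fun c : ℝ => (z.1, c • z.2)) (0, z.2) 1 := by
    have := (hasDerivAt_const (1 : ℝ) z.1).prodMk ((hasDerivAt_id (1 : ℝ)).smul_const z.2)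
    simpa using this
  have h1 : HasDerivAt (fun c : ℝ => L (z.1, c • z.2)) (fderiv ℝ L z (0, z.2)) 1 := by
    have h := hL.hasFDerivAt hz
    have e : (z.1, (1 : ℝ) • z.2) = z := by simp
    rw [← e] at h
    exact (h.comp_hasDerivAt (1 : ℝ) hc).congr_deriv (by simp)
  have h2 : HasDerivAt (fun c : ℝ => L (z.1, c • z.2)) (2 * L z) 1 := by
    refine HasDerivAt.congr_of_eventuallyEq (f := fun c : ℝ => c ^ 2 * L z) ?_ ?_
    · simpa using (hasDerivAt_pow 2 (1 : ℝ)).mul_const (L z)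
    · filter_upwards [lt_mem_nhds (zero_lt_one (α := ℝ))] with c hc
      exact hL.homogeneous z.1 z.2 c hc
  exact h1.unique h2

/-- The Lagrangian lies above its tangent planes in the fibres. On segments through the zero
vector, where `L` need not be smooth, this follows from `0 ≤ L` and Euler's relation. -/
theorem add_fderiv_le {z : Coord n × Coord n} (hz : z ∈ slit U) (w : Coord n) :
    L z + fderiv ℝ L z (0, w - z.2) ≤ L (z.1, w) := by
  by_cases hw : ∃ s : ℝ, 0 ≤ s ∧ w = -(s • z.2)
  · obtain ⟨s, hs, rfl⟩ := hw
    have e : ((0 : Coord n), -(s • z.2) - z.2) = (-(s + 1)) • ((0 : Coord n), z.2) := by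
      ext <;> simp
      ring
    rw [e, map_smul, hL.fderiv_self hz, smul_eq_mul]
    have h1 := hL.nonneg z
    have h2 := hL.nonneg (z.1, -(s • z.2))
    nlinarith [mul_nonneg hs h1]
  · set c : ℝ → Coord n × Coord n := fun t => (z.1, z.2 + t • (w - z.2)) with hc
    have hmem : ∀ t ∈ Icc (0 : ℝ) 1, c t ∈ slit U := by
      refine fun t ht => ⟨hz.1, fun h0 => hw ?_⟩
      have h0' : z.2 + t • (w - z.2) = 0 := h0
      have ht0 : t ≠ 0 := by
        rintro rfl
        exact hz.2 (by simpa using h0')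
      refine ⟨(1 - t) / t, div_nonneg (by linarith [ht.2]) ht.1, ?_⟩
      have h3 : t • w = -((1 - t) • z.2) := by
        rw [← sub_eq_zero, ← h0']
        simp only [smul_sub, sub_smul, one_smul]
        abel
      rw [div_eq_inv_mul, mul_smul, ← smul_neg, ← h3, smul_smul, inv_mul_cancel₀ ht0, one_smul]
    have hcd : ∀ t, HasDerivAt c (0, w - z.2) t := fun t => by
      have := (hasDerivAt_const t z.1).prodMk
        (((hasDerivAt_id t).smul_const (w - z.2)).const_add z.2)
      simpa using this
    have hf : ∀ t ∈ Icc (0 : ℝ) 1,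
        HasDerivAt (fun t => L (c t)) (fderiv ℝ L (c t) (0, w - z.2)) t := fun t ht =>
      (hL.hasFDerivAt (hmem t ht)).comp_hasDerivAt t (hcd t)
    have hf' : ∀ t ∈ Icc (0 : ℝ) 1, HasDerivAt (fun t => fderiv ℝ L (c t) (0, w - z.2))
        (fderiv ℝ (fderiv ℝ L) (c t) (0, w - z.2) (0, w - z.2)) t := fun t ht =>
      (((hL.hasFDerivAt_fderiv (hmem t ht)).comp_hasDerivAt t (hcd t)).clm_apply
        (hasDerivAt_const t (0, w - z.2))).congr_deriv (by simp)
    have hmono : MonotoneOn (fun t => fderiv ℝ L (c t) (0, w - z.2)) (Icc 0 1) := by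
      refine monotoneOn_of_deriv_nonneg (convex_Icc 0 1)
        (fun t ht => (hf' t ht).continuousAt.continuousWithinAt)
        (fun t ht => (hf' t (interior_subset ht)).differentiableAt.differentiableWithinAt)
        fun t ht => ?_
      rw [(hf' t (interior_subset ht)).deriv]
      by_cases hu : w - z.2 = 0
      · rw [hu, ← Prod.zero_eq_mk]; simp
      · exact (hL.hessian_pos _ (hmem t (interior_subset ht)) _ hu).le
    obtain ⟨t, ht, he⟩ := exists_hasDerivAt_eq_slope (fun t => L (c t))
      (fun t => fderiv ℝ L (c t) (0, w - z.2)) zero_lt_one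
      (fun t ht => (hf t ht).continuousAt.continuousWithinAt)
      (fun t ht => hf t (Ioo_subset_Icc_self ht))
    have hle := hmono (left_mem_Icc.2 zero_le_one) (Ioo_subset_Icc_self ht) ht.1.le
    have h0 : c 0 = z := by simp [hc]
    have h1 : c 1 = (z.1, w) := by simp [hc]
    simp only [h0, h1, sub_zero, div_one] at he hle
    linarith

omit hL in
/-- The Legendre map sends `(x, v)` to `(x, L_v(x, v))`. -/
theorem _root_.FinslerCurvature.legendreCoord_eq (L : Coord n × Coord n → ℝ) (z : Coord n × Coord n) :
    legendreCoord L z = (z.1, (fderiv ℝ L z).comp (.inr ℝ (Coord n) (Coord n))) := by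
  have := sum_smul_basisCovec ((fderiv ℝ L z).comp (.inr ℝ (Coord n) (Coord n)))
  rw [← this]
  rfl

theorem contDiffOn_legendreCoord : ContDiffOn ℝ ∞ (legendreCoord L) (slit U) := by
  rw [funext (legendreCoord_eq L)]
  exact contDiffOn_fst.prodMk (hL.contDiffOn_fderiv.clm_comp contDiffOn_const)

theorem contDiffAt_legendreCoord {z : Coord n × Coord n} (hz : z ∈ slit U) :
    ContDiffAt ℝ ∞ (legendreCoord L) z :=
  hL.contDiffOn_legendreCoord.contDiffAt (hL.slit_mem_nhds hz)

theorem hasFDerivAt_legendreCoord {z : Coord n × Coord n} (hz : z ∈ slit U) :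
    HasFDerivAt (legendreCoord L) (fderiv ℝ (legendreCoord L) z) z :=
  ((hL.contDiffAt_legendreCoord hz).differentiableAt (by simp)).hasFDerivAt

theorem fderiv_legendreCoord_apply {z : Coord n × Coord n} (hz : z ∈ slit U)
    (a : Coord n × Coord n) : fderiv ℝ (legendreCoord L) z a =
      (a.1, (fderiv ℝ (fderiv ℝ L) z a).comp (.inr ℝ (Coord n) (Coord n))) := by
  have h : HasFDerivAt (legendreCoord L) ((ContinuousLinearMap.fst ℝ (Coord n) (Coord n)).prod
      (((ContinuousLinearMap.compL ℝ (Coord n) (Coord n × Coord n) ℝ).flip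
        (.inr ℝ (Coord n) (Coord n))).comp (fderiv ℝ (fderiv ℝ L) z))) z := by
    rw [funext (legendreCoord_eq L)]
    exact hasFDerivAt_fst.prodMk
      (((ContinuousLinearMap.compL ℝ (Coord n) (Coord n × Coord n) ℝ).flip
        (.inr ℝ (Coord n) (Coord n))).hasFDerivAt.comp z (hL.hasFDerivAt_fderiv hz))
  rw [h.fderiv]
  rfl

theorem fderiv_legendreCoord_fst {z : Coord n × Coord n} (hz : z ∈ slit U)
    (a : Coord n × Coord n) : (fderiv ℝ (legendreCoord L) z a).1 = a.1 := by
  rw [hL.fderiv_legendreCoord_apply hz]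

theorem fderiv_legendreCoord_snd {z : Coord n × Coord n} (hz : z ∈ slit U)
    (a : Coord n × Coord n) (w : Coord n) :
    (fderiv ℝ (legendreCoord L) z a).2 w = fderiv ℝ (fderiv ℝ L) z a (0, w) := by
  rw [hL.fderiv_legendreCoord_apply hz]
  simp

theorem fderiv_legendreCoord_bijective {z : Coord n × Coord n} (hz : z ∈ slit U) :
    Function.Bijective (fderiv ℝ (legendreCoord L) z) := by
  have hinj : Function.Injective (fderiv ℝ (legendreCoord L) z).toLinearMap := by
    refine (injective_iff_map_eq_zero _).2 fun a ha => ?_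
    have ha' : fderiv ℝ (legendreCoord L) z a = 0 := ha
    have h1 : a.1 = 0 := by
      simpa [ha'] using (hL.fderiv_legendreCoord_fst hz a).symm
    have h2 : a.2 = 0 := by
      by_contra h
      have hpos := hL.hessian_pos z hz a.2 h
      have := hL.fderiv_legendreCoord_snd hz a a.2
      rw [ha', show a = (0, a.2) from Prod.ext h1 rfl] at this
      simp only [Prod.snd_zero, _root_.zero_apply] at this
      linarith
    exact Prod.ext h1 h2
  refine ⟨hinj, (LinearMap.injective_iff_surjective_of_finrank_eq_finrank ?_).1 hinj⟩
  rw [finrank_phaseSpace]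
  simp

end IsFinslerLagrangian

/-- The Hamiltonian vector field `(h_p, -h_x)` of a function `h` on `ℝⁿ × (ℝⁿ)*`. -/
def coordField (h : Coord n × Dual n → ℝ) (y : Coord n × Dual n) : Coord n × Dual n :=
  (∑ i, fderiv ℝ h y (0, basisCovec i) • basisVec i,
    -∑ i, fderiv ℝ h y (basisVec i, 0) • basisCovec i)

/-- The vector with components `(ℓ(0, eⁱ), -ℓ(eᵢ, 0))` represents `-ℓ` with respect to `ω`. -/
theorem omega_gradient (l : Coord n × Dual n →L[ℝ] ℝ) (b : Coord n × Dual n) :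
    omega n (∑ i, l (0, basisCovec i) • basisVec i, -∑ i, l (basisVec i, 0) • basisCovec i) b =
      -l b := by
  have e : b = ∑ i, b.1 i • ((basisVec i, 0) : Coord n × Dual n) +
      ∑ i, b.2 (basisVec i) • ((0, basisCovec i) : Coord n × Dual n) := by
    refine Prod.ext ?_ ?_
    · simp only [Prod.fst_add, Prod.fst_sum, Prod.smul_fst, smul_zero, Finset.sum_const_zero,
        add_zero, sum_smul_basisVec]
    · simp only [Prod.snd_add, Prod.snd_sum, Prod.smul_snd, smul_zero, Finset.sum_const_zero,
        zero_add, sum_smul_basisCovec]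
  conv_rhs => rw [e]
  simp only [omega_apply, map_add, map_sum, map_smul, _root_.neg_apply,
    _root_.sum_apply, _root_.smul_apply, basisCovec_apply, smul_eq_mul]
  simp only [mul_comm]
  ring

theorem omega_coordField (h : Coord n × Dual n → ℝ) (y b : Coord n × Dual n) :
    omega n (coordField h y) b = -fderiv ℝ h y b :=
  omega_gradient _ b

theorem contDiffOn_coordField {h : Coord n × Dual n → ℝ} {O : Set (Coord n × Dual n)}
    (hO : IsOpen O) (hh : ContDiffOn ℝ ∞ h O) : ContDiffOn ℝ ∞ (coordField h) O := by
  have h1 : ContDiffOn ℝ ∞ (fderiv ℝ h) O := hh.fderiv_of_isOpen hO (by simp)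
  refine ContDiffOn.prodMk (ContDiffOn.sum fun i _ => ?_) (ContDiffOn.neg (ContDiffOn.sum
    fun i _ => ?_))
  · exact (h1.clm_apply contDiffOn_const).smul contDiffOn_const
  · exact (h1.clm_apply contDiffOn_const).smul contDiffOn_const

theorem _root_.ContDiffAt.hasDerivAt_fderiv_apply_line {X : Type*} [NormedAddCommGroup X]
    [NormedSpace ℝ X] {h : X → ℝ} {y : X} (hh : ContDiffAt ℝ ∞ h y) (a b : X) :
    HasDerivAt (fun t : ℝ => fderiv ℝ h (y + t • a) b) (fderiv ℝ (fderiv ℝ h) y a b) 0 := by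
  have h1 : HasFDerivAt (fderiv ℝ h) (fderiv ℝ (fderiv ℝ h) y) y :=
    ((hh.fderiv_right (m := ∞) (by simp)).differentiableAt (by simp)).hasFDerivAt
  have hline : HasDerivAt (fun t : ℝ => y + t • a) a 0 := by
    simpa using ((hasDerivAt_id (0 : ℝ)).smul_const a).const_add y
  simpa using (h1.comp_hasDerivAt_of_eq (0 : ℝ) hline (by simp)).clm_apply
    (hasDerivAt_const (0 : ℝ) b)

theorem _root_.ContDiffAt.hasFDerivAt_fderiv_apply {X Y : Type*} [NormedAddCommGroup X]
    [NormedSpace ℝ X] [NormedAddCommGroup Y] [NormedSpace ℝ Y] {h : X → Y} {y : X}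
    (hh : ContDiffAt ℝ ∞ h y) (b : X) :
    HasFDerivAt (fun y => fderiv ℝ h y b) ((fderiv ℝ (fderiv ℝ h) y).flip b) y := by
  have h1 : HasFDerivAt (fderiv ℝ h) (fderiv ℝ (fderiv ℝ h) y) y :=
    ((hh.fderiv_right (m := ∞) (by simp)).differentiableAt (by simp)).hasFDerivAt
  simpa using h1.clm_apply (hasFDerivAt_const b y)

theorem _root_.ContDiffAt.fderiv_fderiv_comm {X : Type*} [NormedAddCommGroup X]
    [NormedSpace ℝ X] {h : X → ℝ} {y : X} (hh : ContDiffAt ℝ ∞ h y) (a b : X) :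
    fderiv ℝ (fderiv ℝ h) y a b = fderiv ℝ (fderiv ℝ h) y b a :=
  hh.isSymmSndFDerivAt (by
    rw [minSmoothness_of_isRCLikeNormedField]
    exact WithTop.coe_le_coe.2 le_top) a b

/-- The linearisation of a Hamiltonian vector field is skew with respect to `ω`. -/
theorem omega_fderiv_coordField {h : Coord n × Dual n → ℝ} {O : Set (Coord n × Dual n)}
    (hO : IsOpen O) (hh : ContDiffOn ℝ ∞ h O) {y : Coord n × Dual n} (hy : y ∈ O)
    (a b : Coord n × Dual n) :
    omega n (fderiv ℝ (coordField h) y a) b + omega n a (fderiv ℝ (coordField h) y b) = 0 := by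
  have hat : ContDiffAt ℝ ∞ h y := hh.contDiffAt (hO.mem_nhds hy)
  have hX : HasFDerivAt (coordField h) (fderiv ℝ (coordField h) y) y :=
    (((contDiffOn_coordField hO hh).contDiffAt (hO.mem_nhds hy)).differentiableAt
      (by simp)).hasFDerivAt
  have key : ∀ a b, omega n (fderiv ℝ (coordField h) y a) b = -fderiv ℝ (fderiv ℝ h) y a b := by
    intro a b
    have hline : HasDerivAt (fun t : ℝ => y + t • a) a 0 := by
      simpa using ((hasDerivAt_id (0 : ℝ)).smul_const a).const_add y
    have h2 : HasDerivAt (fun t : ℝ => coordField h (y + t • a))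
        (fderiv ℝ (coordField h) y a) 0 :=
      hX.comp_hasDerivAt_of_eq (0 : ℝ) hline (by simp)
    have h4 := h2.omega (hasDerivAt_const (0 : ℝ) b)
    simp only [omega_coordField, map_zero, add_zero] at h4
    exact h4.unique (hat.hasDerivAt_fderiv_apply_line a b).neg
  rw [omega_swap a, key, key, hat.fderiv_fderiv_comm a b]
  ring

end Lagrangian

/-! ### The Hamiltonian in coordinates and the geodesic spray -/

section Spray

open Set Filter

variable {n : ℕ} {U : Set (Coord n)} {L : Coord n × Coord n → ℝ} {h : Coord n × Dual n → ℝ}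

/-- The geodesic spray coefficients `Gⁱ` as a vector. -/
def sprayVec (L : Coord n × Coord n → ℝ) (h : Coord n × Dual n → ℝ) (z : Coord n × Coord n) :
    Coord n :=
  ∑ i, sprayCoeff L h i z • basisVec i

theorem sprayVec_apply (z : Coord n × Coord n) (i : Fin n) :
    sprayVec L h z i = sprayCoeff L h i z := by
  simp [sprayVec, basisVec_apply]

/-- The function `h` on `ℝⁿ × (ℝⁿ)*` is, on the image of the Legendre map, the Legendre transform
`L_v v - L` of `L`. -/
def IsLegendreTransform (U : Set (Coord n)) (L : Coord n × Coord n → ℝ)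
    (h : Coord n × Dual n → ℝ) : Prop :=
  ∀ z ∈ slit U, h (legendreCoord L z) = fderiv ℝ L z (0, z.2) - L z

namespace IsFinslerLagrangian

variable (hL : IsFinslerLagrangian U L)
include hL

theorem exists_local_inverse {z : Coord n × Coord n} (hz : z ∈ slit U) :
    ∃ g : Coord n × Dual n → Coord n × Coord n, ContDiffAt ℝ ∞ g (legendreCoord L z) ∧
      g (legendreCoord L z) = z ∧ ∀ᶠ y in 𝓝 (legendreCoord L z), legendreCoord L (g y) = y := by
  let T : (Coord n × Coord n) ≃L[ℝ] (Coord n × Dual n) :=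
    (LinearEquiv.ofBijective (fderiv ℝ (legendreCoord L) z).toLinearMap
      (hL.fderiv_legendreCoord_bijective hz)).toContinuousLinearEquiv
  have hT : HasFDerivAt (legendreCoord L) (T : (Coord n × Coord n) →L[ℝ] (Coord n × Dual n)) z :=
    hL.hasFDerivAt_legendreCoord hz
  have hc := hL.contDiffAt_legendreCoord hz
  have hs : HasStrictFDerivAt (legendreCoord L)
      (T : (Coord n × Coord n) →L[ℝ] (Coord n × Dual n)) z :=
    hc.hasStrictFDerivAt' hT (by simp)
  exact ⟨hc.localInverse hT (by simp), hc.to_localInverse hT (by simp),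
    hc.localInverse_apply_image hT (by simp), hs.eventually_right_inverse⟩

theorem isOpen_image_legendreCoord : IsOpen (legendreCoord L '' slit U) := by
  rw [isOpen_iff_mem_nhds]
  rintro _ ⟨z, hz, rfl⟩
  obtain ⟨g, hg, hgz, hr⟩ := hL.exists_local_inverse hz
  filter_upwards [hr, hg.continuousAt.eventually_mem (by rw [hgz]; exact hL.slit_mem_nhds hz)]
    with y hy hy'
  exact ⟨g y, hy', hy⟩

variable (hh : IsLegendreTransform U L h)
include hh

theorem contDiffOn_hamiltonian : ContDiffOn ℝ ∞ h (legendreCoord L '' slit U) := by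
  rintro _ ⟨z, hz, rfl⟩
  obtain ⟨g, hg, hgz, hr⟩ := hL.exists_local_inverse hz
  have hE : ContDiffAt ℝ ∞ (fun z : Coord n × Coord n => fderiv ℝ L z (0, z.2) - L z)
      (g (legendreCoord L z)) := by
    rw [hgz]
    exact ((hL.contDiffOn_fderiv.contDiffAt (hL.slit_mem_nhds hz)).clm_apply
      (contDiffAt_const.prodMk contDiffAt_snd)).sub (hL.contDiffAt hz)
  refine ((hE.comp _ hg).congr_of_eventuallyEq ?_).contDiffWithinAt
  filter_upwards [hr, hg.continuousAt.eventually_mem (by rw [hgz]; exact hL.slit_mem_nhds hz)]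
    with y hy hy'
  simp only [Function.comp_apply]
  rw [← hh _ hy', hy]

theorem contDiffAt_hamiltonian {z : Coord n × Coord n} (hz : z ∈ slit U) :
    ContDiffAt ℝ ∞ h (legendreCoord L z) :=
  (hL.contDiffOn_hamiltonian hh).contDiffAt
    (hL.isOpen_image_legendreCoord.mem_nhds ⟨z, hz, rfl⟩)

/-- `h_p = v` and `h_x = -L_x`. -/
theorem fderiv_hamiltonian {z : Coord n × Coord n} (hz : z ∈ slit U) (b : Coord n × Dual n) :
    fderiv ℝ h (legendreCoord L z) b = b.2 z.2 - fderiv ℝ L z (b.1, 0) := by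
  obtain ⟨a, rfl⟩ := (hL.fderiv_legendreCoord_bijective hz).2 b
  have hhd : HasFDerivAt h (fderiv ℝ h (legendreCoord L z)) (legendreCoord L z) :=
    ((hL.contDiffAt_hamiltonian hh hz).differentiableAt (by simp)).hasFDerivAt
  have h1 := hhd.comp z (hL.hasFDerivAt_legendreCoord hz)
  have hp : HasFDerivAt (fun z : Coord n × Coord n => ((0 : Coord n), z.2))
      ((0 : (Coord n × Coord n) →L[ℝ] Coord n).prod
        (ContinuousLinearMap.snd ℝ (Coord n) (Coord n))) z :=
    (hasFDerivAt_const 0 z).prodMk hasFDerivAt_snd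
  have h2 : HasFDerivAt (h ∘ legendreCoord L) _ z :=
    (((hL.hasFDerivAt_fderiv hz).clm_apply hp).sub (hL.hasFDerivAt hz)).congr_of_eventuallyEq
      (by filter_upwards [hL.slit_mem_nhds hz] with y hy using hh y hy)
  have h3 := congrArg (fun T => T a) (h1.unique h2)
  simp only [ContinuousLinearMap.comp_apply, _root_.sub_apply, _root_.add_apply,
    ContinuousLinearMap.flip_apply, ContinuousLinearMap.prod_apply, _root_.zero_apply,
    ContinuousLinearMap.coe_snd'] at h3
  rw [h3, hL.fderiv_legendreCoord_snd hz, hL.fderiv_legendreCoord_fst hz]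
  have e : a = (a.1, 0) + (0, a.2) := by ext <;> simp
  have e' : fderiv ℝ L z a = fderiv ℝ L z (a.1, 0) + fderiv ℝ L z (0, a.2) := by
    rw [← map_add, ← e]
  rw [e']
  ring

/-- The Hamiltonian vector field at `𝕃(x, v)` is `(v, L_x)`. -/
theorem coordField_legendreCoord {z : Coord n × Coord n} (hz : z ∈ slit U) :
    coordField h (legendreCoord L z) =
      (z.2, (fderiv ℝ L z).comp (.inl ℝ (Coord n) (Coord n))) := by
  rw [← sub_eq_zero]
  refine eq_zero_of_omega_eq_zero fun b => ?_
  rw [map_sub, LinearMap.sub_apply, omega_coordField, hL.fderiv_hamiltonian hh hz, omega_apply]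
  simp

/-- `∂²h/∂p∂p` is inverse to the fibre Hessian of `L`. -/
theorem fderiv_dP {z : Coord n × Coord n} (hz : z ∈ slit U) (l : Fin n)
    (a : Coord n × Coord n) :
    fderiv ℝ (dP l h) (legendreCoord L z) (fderiv ℝ (legendreCoord L) z a) = a.2 l := by
  have hd : HasFDerivAt (dP l h) (fderiv ℝ (dP l h) (legendreCoord L z)) (legendreCoord L z) := by
    have : ContDiffAt ℝ ∞ (dP l h) (legendreCoord L z) :=
      ((hL.contDiffAt_hamiltonian hh hz).fderiv_right (m := ∞) (by simp)).clm_apply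
        contDiffAt_const
    exact (this.differentiableAt (by simp)).hasFDerivAt
  have h1 := hd.comp z (hL.hasFDerivAt_legendreCoord hz)
  have h2 : HasFDerivAt (dP l h ∘ legendreCoord L)
      ((EuclideanSpace.proj l : Coord n →L[ℝ] ℝ).comp
        (ContinuousLinearMap.snd ℝ (Coord n) (Coord n))) z := by
    refine HasFDerivAt.congr_of_eventuallyEq (ContinuousLinearMap.hasFDerivAt _) ?_
    filter_upwards [hL.slit_mem_nhds hz] with y hy
    simp only [Function.comp_apply, dP]
    rw [hL.fderiv_hamiltonian hh hy, ← Prod.zero_eq_mk, map_zero, sub_zero]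
    rfl
  exact congrArg (fun T => T a) (h1.unique h2)

theorem dP_dP_comm {z : Coord n × Coord n} (hz : z ∈ slit U) (i l : Fin n) :
    dP i (dP l h) (legendreCoord L z) = dP l (dP i h) (legendreCoord L z) := by
  have hc := hL.contDiffAt_hamiltonian hh hz
  have hd : ∀ l : Fin n, HasFDerivAt (dP l h)
      ((fderiv ℝ (fderiv ℝ h) (legendreCoord L z)).flip (0, basisCovec l))
      (legendreCoord L z) := fun l => hc.hasFDerivAt_fderiv_apply _
  have hd' : ∀ i l : Fin n, dP i (dP l h) (legendreCoord L z) =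
      fderiv ℝ (fderiv ℝ h) (legendreCoord L z) (0, basisCovec i) (0, basisCovec l) :=
    fun i l => by rw [dP, (hd l).fderiv]; rfl
  rw [hd', hd', hc.fderiv_fderiv_comm]

omit hh in
theorem dX_dV {z : Coord n × Coord n} (hz : z ∈ slit U) (k l : Fin n) :
    dX k (dV l L) z = fderiv ℝ (fderiv ℝ L) z (basisVec k, 0) (0, basisVec l) := by
  have h1 : HasFDerivAt (dV l L) ((fderiv ℝ (fderiv ℝ L) z).flip (0, basisVec l)) z :=
    (hL.contDiffAt hz).hasFDerivAt_fderiv_apply _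
  rw [dX, h1.fderiv]
  rfl

/-- The Euler-Lagrange equation: the spray coefficients satisfy
`L_vv(2G, ·) = L_xv(v, ·) - L_x`. -/
theorem hessian_sprayVec {z : Coord n × Coord n} (hz : z ∈ slit U) (w : Coord n) :
    fderiv ℝ (fderiv ℝ L) z (0, (2 : ℝ) • sprayVec L h z) (0, w) =
      fderiv ℝ (fderiv ℝ L) z (z.2, 0) (0, w) - fderiv ℝ L z (w, 0) := by
  -- `θ` is the covector on the right-hand side.
  set θ : Dual n := (fderiv ℝ (fderiv ℝ L) z (z.2, 0)).comp (.inr ℝ (Coord n) (Coord n)) -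
    (fderiv ℝ L z).comp (.inl ℝ (Coord n) (Coord n)) with hθ
  obtain ⟨a, ha⟩ := (hL.fderiv_legendreCoord_bijective hz).2 (0, θ)
  have ha1 : a.1 = 0 := by
    rw [← hL.fderiv_legendreCoord_fst hz a, ha]
  have hθl : ∀ l, θ (basisVec l) = (∑ k, dX k (dV l L) z * z.2 k) - dX l L z := by
    intro l
    have e : ((z.2, 0) : Coord n × Coord n) = ∑ k, z.2 k • ((basisVec k, 0) : Coord n × Coord n) := by
      refine Prod.ext ?_ ?_
      · simp only [Prod.fst_sum, Prod.smul_fst, sum_smul_basisVec]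
      · simp only [Prod.snd_sum, Prod.smul_snd, smul_zero, Finset.sum_const_zero]
    simp only [hL.dX_dV hz]
    rw [hθ, _root_.sub_apply, ContinuousLinearMap.comp_apply, ContinuousLinearMap.comp_apply,
      ContinuousLinearMap.inr_apply, ContinuousLinearMap.inl_apply, e, map_sum, _root_.sum_apply]
    simp only [map_smul, _root_.smul_apply, smul_eq_mul, dX, mul_comm]
  have ha2 : a.2 = (2 : ℝ) • sprayVec L h z := by
    ext i
    rw [← hL.fderiv_dP hh hz i a, ha]
    have e : ((0, θ) : Coord n × Dual n) =
        ∑ l, θ (basisVec l) • ((0, basisCovec l) : Coord n × Dual n) := by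
      refine Prod.ext ?_ ?_
      · simp only [Prod.fst_sum, Prod.smul_fst, smul_zero, Finset.sum_const_zero]
      · simp only [Prod.snd_sum, Prod.smul_snd, sum_smul_basisCovec]
    rw [e, map_sum, PiLp.smul_apply, sprayVec_apply, sprayCoeff, smul_eq_mul, ← mul_assoc,
      show (2 : ℝ) * (1 / 2) = 1 by norm_num, one_mul]
    refine Finset.sum_congr rfl fun l _ => ?_
    rw [map_smul, hθl, hL.dP_dP_comm hh hz i l, mul_comm, smul_eq_mul]
    rfl
  have h1 := hL.fderiv_legendreCoord_snd hz a w
  rw [ha, show a = (0, (2 : ℝ) • sprayVec L h z) from Prod.ext ha1 ha2] at h1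
  rw [← h1, hθ]
  simp

/-- The Legendre map sends the geodesic spray `(v, -2G)` to the Hamiltonian vector field. -/
theorem fderiv_legendreCoord_spray {z : Coord n × Coord n} (hz : z ∈ slit U) :
    fderiv ℝ (legendreCoord L) z (z.2, -((2 : ℝ) • sprayVec L h z)) =
      coordField h (legendreCoord L z) := by
  rw [hL.coordField_legendreCoord hh hz]
  refine Prod.ext (hL.fderiv_legendreCoord_fst hz _) ?_
  ext w
  rw [hL.fderiv_legendreCoord_snd hz]
  have e : ((z.2, -((2 : ℝ) • sprayVec L h z)) : Coord n × Coord n) =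
      (z.2, 0) - (0, (2 : ℝ) • sprayVec L h z) := by ext <;> simp
  rw [e, map_sub, _root_.sub_apply, hL.hessian_sprayVec hh hz]
  simp

theorem contDiffOn_sprayVec : ContDiffOn ℝ ∞ (sprayVec L h) (slit U) := by
  have hO := isOpen_slit hL.isOpen
  have hV : ∀ l, ContDiffOn ℝ ∞ (dV l L) (slit U) := fun l =>
    hL.contDiffOn_fderiv.clm_apply contDiffOn_const
  have hX : ∀ l, ContDiffOn ℝ ∞ (dX l L) (slit U) := fun l =>
    hL.contDiffOn_fderiv.clm_apply contDiffOn_const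
  have hXV : ∀ k l, ContDiffOn ℝ ∞ (dX k (dV l L)) (slit U) := fun k l =>
    ((hV l).fderiv_of_isOpen hO (m := ∞) (by simp)).clm_apply contDiffOn_const
  have hO' := hL.isOpen_image_legendreCoord
  have hP : ∀ l, ContDiffOn ℝ ∞ (dP l h) (legendreCoord L '' slit U) := fun l =>
    ((hL.contDiffOn_hamiltonian hh).fderiv_of_isOpen hO' (m := ∞) (by simp)).clm_apply
      contDiffOn_const
  have hPP : ∀ i l, ContDiffOn ℝ ∞ (dP i (dP l h)) (legendreCoord L '' slit U) := fun i l =>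
    ((hP l).fderiv_of_isOpen hO' (m := ∞) (by simp)).clm_apply contDiffOn_const
  have hcoord : ∀ k : Fin n, ContDiffOn ℝ ∞ (fun z : Coord n × Coord n => z.2 k) (slit U) :=
    fun k => ((EuclideanSpace.proj k : Coord n →L[ℝ] ℝ).contDiff.comp contDiff_snd).contDiffOn
  have hG : ∀ i, ContDiffOn ℝ ∞ (sprayCoeff L h i) (slit U) := by
    refine fun i => contDiffOn_const.mul (ContDiffOn.sum fun l _ => ContDiffOn.mul ?_ ?_)
    · exact (hPP i l).comp hL.contDiffOn_legendreCoord (mapsTo_image _ _)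
    · exact (ContDiffOn.sum fun k _ => (hXV k l).mul (hcoord k)).sub (hX l)
  exact ContDiffOn.sum fun i _ => (hG i).smul contDiffOn_const

/-- The spray coefficients are positively homogeneous of degree two. -/
theorem sprayVec_scale {z : Coord n × Coord n} (hz : z ∈ slit U) {c : ℝ} (hc : 0 < c) :
    sprayVec L h (z.1, c • z.2) = c ^ 2 • sprayVec L h z := by
  have hzc := smul_mem_slit hz hc
  have hc0 := hc.ne'
  have key : ∀ w, fderiv ℝ (fderiv ℝ L) (z.1, c • z.2)
      (0, (2 : ℝ) • (sprayVec L h (z.1, c • z.2) - c ^ 2 • sprayVec L h z)) (0, c • w) = 0 := by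
    intro w
    have e1 : ((0 : Coord n), (2 : ℝ) • (sprayVec L h (z.1, c • z.2) - c ^ 2 • sprayVec L h z)) =
        (0, (2 : ℝ) • sprayVec L h (z.1, c • z.2)) -
          c • (0, c • (2 : ℝ) • sprayVec L h z) := by
      ext <;> simp
      ring
    rw [e1, map_sub, _root_.sub_apply, map_smul, _root_.smul_apply,
      hL.fderiv_fderiv_scale hz hc, hL.hessian_sprayVec hh hz, hL.hessian_sprayVec hh hzc]
    have e2 : ((c • z.2, 0) : Coord n × Coord n) = c • (z.2, c • (0 : Coord n)) := by simp
    have e3 : ((c • w, 0) : Coord n × Coord n) = c • (w, c • (0 : Coord n)) := by simp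
    rw [e2, e3, map_smul, _root_.smul_apply, map_smul, hL.fderiv_fderiv_scale hz hc,
      hL.fderiv_scale hz hc]
    simp only [smul_eq_mul]
    ring
  by_contra hne
  have hne' : (2 : ℝ) • (sprayVec L h (z.1, c • z.2) - c ^ 2 • sprayVec L h z) ≠ 0 :=
    smul_ne_zero two_ne_zero (sub_ne_zero.2 hne)
  have hpos := hL.hessian_pos _ hzc _ hne'
  have h0 := key (c⁻¹ • ((2 : ℝ) • (sprayVec L h (z.1, c • z.2) - c ^ 2 • sprayVec L h z)))
  rw [smul_inv_smul₀ hc0] at h0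
  linarith

theorem hasFDerivAt_sprayVec {z : Coord n × Coord n} (hz : z ∈ slit U) :
    HasFDerivAt (sprayVec L h) (fderiv ℝ (sprayVec L h) z) z :=
  (((hL.contDiffOn_sprayVec hh).contDiffAt (hL.slit_mem_nhds hz)).differentiableAt
    (by simp)).hasFDerivAt

theorem contDiffOn_fderiv_sprayVec : ContDiffOn ℝ ∞ (fderiv ℝ (sprayVec L h)) (slit U) :=
  (hL.contDiffOn_sprayVec hh).fderiv_of_isOpen (isOpen_slit hL.isOpen) (by simp)

theorem hasFDerivAt_fderiv_sprayVec {z : Coord n × Coord n} (hz : z ∈ slit U) :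
    HasFDerivAt (fderiv ℝ (sprayVec L h)) (fderiv ℝ (fderiv ℝ (sprayVec L h)) z) z :=
  (((hL.contDiffOn_fderiv_sprayVec hh).contDiffAt (hL.slit_mem_nhds hz)).differentiableAt
    (by simp)).hasFDerivAt

/-- Euler's relation for the spray coefficients: `∑ⱼ vʲ Nⱼ = 2 G`. -/
theorem fderiv_sprayVec_self {z : Coord n × Coord n} (hz : z ∈ slit U) :
    fderiv ℝ (sprayVec L h) z (0, z.2) = (2 : ℝ) • sprayVec L h z := by
  have hc : HasDerivAt (fun c : ℝ => (z.1, c • z.2)) (0, z.2) 1 := by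
    have := (hasDerivAt_const (1 : ℝ) z.1).prodMk ((hasDerivAt_id (1 : ℝ)).smul_const z.2)
    simpa using this
  have h1 : HasDerivAt (fun c : ℝ => sprayVec L h (z.1, c • z.2))
      (fderiv ℝ (sprayVec L h) z (0, z.2)) 1 :=
    (hL.hasFDerivAt_sprayVec hh hz).comp_hasDerivAt_of_eq (1 : ℝ) hc (by simp)
  have h2 : HasDerivAt (fun c : ℝ => sprayVec L h (z.1, c • z.2))
      ((2 : ℝ) • sprayVec L h z) 1 := by
    refine HasDerivAt.congr_of_eventuallyEq (f := fun c : ℝ => c ^ 2 • sprayVec L h z) ?_ ?_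
    · simpa using (hasDerivAt_pow 2 (1 : ℝ)).smul_const (sprayVec L h z)
    · filter_upwards [lt_mem_nhds (zero_lt_one (α := ℝ))] with c hc
      exact hL.sprayVec_scale hh hz hc
  exact h1.unique h2

end IsFinslerLagrangian

/-- The curvature `u ↦ 2 G_x u - S(N) u - N (N u)` of the spray `S = (v, -2G)`, where
`N u = G_v u`. -/
def sprayCurvature (L : Coord n × Coord n → ℝ) (h : Coord n × Dual n → ℝ) (z : Coord n × Coord n)
    (u : Coord n) : Coord n :=
  (2 : ℝ) • fderiv ℝ (sprayVec L h) z (u, 0) -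
    fderiv ℝ (fderiv ℝ (sprayVec L h)) z (z.2, -((2 : ℝ) • sprayVec L h z)) (0, u) -
    fderiv ℝ (sprayVec L h) z (0, fderiv ℝ (sprayVec L h) z (0, u))

namespace IsFinslerLagrangian

variable (hL : IsFinslerLagrangian U L) (hh : IsLegendreTransform U L h)
include hL hh

theorem horizontalField_eq {z : Coord n × Coord n} (hz : z ∈ slit U) (i : Fin n) :
    horizontalField L h i z = (basisVec i, -fderiv ℝ (sprayVec L h) z (0, basisVec i)) := by
  have hc : ∀ j, connCoeff L h i j z = fderiv ℝ (sprayVec L h) z (0, basisVec i) j := by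
    intro j
    have h1 : HasFDerivAt (sprayCoeff L h j)
        ((EuclideanSpace.proj j : Coord n →L[ℝ] ℝ).comp (fderiv ℝ (sprayVec L h) z)) z := by
      refine ((EuclideanSpace.proj j : Coord n →L[ℝ] ℝ).hasFDerivAt.comp z
        (hL.hasFDerivAt_sprayVec hh hz)).congr_of_eventuallyEq (Eventually.of_forall fun y => ?_)
      exact (sprayVec_apply y j).symm
    rw [connCoeff, dV, h1.fderiv]
    rfl
  simp only [horizontalField, hc, sum_smul_basisVec]

theorem hasFDerivAt_horizontalField {z : Coord n × Coord n} (hz : z ∈ slit U) (i : Fin n) :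
    HasFDerivAt (horizontalField L h i) ((0 : (Coord n × Coord n) →L[ℝ] Coord n).prod
      (-(fderiv ℝ (fderiv ℝ (sprayVec L h)) z).flip (0, basisVec i))) z := by
  refine HasFDerivAt.congr_of_eventuallyEq (f := fun z =>
    (basisVec i, -fderiv ℝ (sprayVec L h) z (0, basisVec i))) ?_ ?_
  · refine (hasFDerivAt_const _ z).prodMk (HasFDerivAt.neg ?_)
    simpa using (hL.hasFDerivAt_fderiv_sprayVec hh hz).clm_apply
      (hasFDerivAt_const ((0, basisVec i) : Coord n × Coord n) z)
  · filter_upwards [hL.slit_mem_nhds hz] with y hy using hL.horizontalField_eq hh hy i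

/-- The Riemann curvature, contracted with `v`, is the curvature of the spray. -/
theorem sum_mul_curvCoeff {z : Coord n × Coord n} (hz : z ∈ slit U) (i l : Fin n) :
    ∑ j, z.2 j * curvCoeff L h i j l z = sprayCurvature L h z (basisVec i) l := by
  have hcurv : ∀ j, curvCoeff L h i j l z =
      (fderiv ℝ (fderiv ℝ (sprayVec L h)) z (horizontalField L h i z) (0, basisVec j) -
        fderiv ℝ (fderiv ℝ (sprayVec L h)) z (horizontalField L h j z) (0, basisVec i)) l := by
    intro j
    rw [curvCoeff, VectorField.lieBracket, (hL.hasFDerivAt_horizontalField hh hz i).fderiv,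
      (hL.hasFDerivAt_horizontalField hh hz j).fderiv]
    simp
    ring
  have hv : ∑ j, z.2 j • ((0, basisVec j) : Coord n × Coord n) = (0, z.2) := by
    refine Prod.ext ?_ ?_
    · simp only [Prod.fst_sum, Prod.smul_fst, smul_zero, Finset.sum_const_zero]
    · simp only [Prod.snd_sum, Prod.smul_snd, sum_smul_basisVec]
  have hS : ∑ j, z.2 j • horizontalField L h j z = (z.2, -((2 : ℝ) • sprayVec L h z)) := by
    simp only [hL.horizontalField_eq hh hz]
    refine Prod.ext ?_ ?_
    · simp only [Prod.fst_sum, Prod.smul_fst, sum_smul_basisVec]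
    · simp only [Prod.snd_sum, Prod.smul_snd, smul_neg, Finset.sum_neg_distrib]
      rw [← hL.fderiv_sprayVec_self hh hz, ← hv, map_sum]
      simp only [map_smul]
  have hsum : ∑ j, z.2 j * curvCoeff L h i j l z =
      (fderiv ℝ (fderiv ℝ (sprayVec L h)) z (horizontalField L h i z) (0, z.2) -
        fderiv ℝ (fderiv ℝ (sprayVec L h)) z (z.2, -((2 : ℝ) • sprayVec L h z))
          (0, basisVec i)) l := by
    rw [← hS, ← hv]
    simp only [hcurv, map_sum, map_smul, _root_.sum_apply, _root_.smul_apply]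
    rw [← Finset.sum_sub_distrib]
    simp only [← smul_sub]
    simp
  -- Differentiate Euler's relation `N v = 2 G`.
  have hE : ∀ a, fderiv ℝ (fderiv ℝ (sprayVec L h)) z a (0, z.2) +
      fderiv ℝ (sprayVec L h) z (0, a.2) = (2 : ℝ) • fderiv ℝ (sprayVec L h) z a := by
    intro a
    have hp : HasFDerivAt (fun z : Coord n × Coord n => ((0 : Coord n), z.2))
        ((0 : (Coord n × Coord n) →L[ℝ] Coord n).prod
          (ContinuousLinearMap.snd ℝ (Coord n) (Coord n))) z :=
      (hasFDerivAt_const 0 z).prodMk hasFDerivAt_snd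
    have h1 := (hL.hasFDerivAt_fderiv_sprayVec hh hz).clm_apply hp
    have h2 := ((hL.hasFDerivAt_sprayVec hh hz).const_smul (2 : ℝ)).congr_of_eventuallyEq
      (f₁ := fun z => fderiv ℝ (sprayVec L h) z (0, z.2))
      (by filter_upwards [hL.slit_mem_nhds hz] with y hy using hL.fderiv_sprayVec_self hh hy)
    have h3 := congrArg (fun T => T a) (h1.unique h2)
    simp only [ContinuousLinearMap.comp_apply, _root_.add_apply, _root_.smul_apply,
      ContinuousLinearMap.flip_apply, ContinuousLinearMap.prod_apply, _root_.zero_apply,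
      ContinuousLinearMap.coe_snd'] at h3
    rw [← h3]
    abel
  have hEi := hE (horizontalField L h i z)
  rw [hL.horizontalField_eq hh hz i] at hEi hsum
  have e : ((basisVec i, -fderiv ℝ (sprayVec L h) z (0, basisVec i)) : Coord n × Coord n) =
      (basisVec i, 0) - (0, fderiv ℝ (sprayVec L h) z (0, basisVec i)) := by ext <;> simp
  have e' : ((0, -fderiv ℝ (sprayVec L h) z (0, basisVec i)) : Coord n × Coord n) =
      -(0, fderiv ℝ (sprayVec L h) z (0, basisVec i)) := by ext <;> simp
  rw [hsum, sprayCurvature]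
  rw [← eq_sub_iff_add_eq] at hEi
  refine congrArg (fun x : Coord n => x l) ?_
  rw [hEi, e, map_sub]
  simp only [Prod.snd_sub, zero_sub]
  rw [e', map_neg, smul_sub, two_smul ℝ (fderiv ℝ (sprayVec L h) z
    (0, fderiv ℝ (sprayVec L h) z (0, basisVec i)))]
  abel

end IsFinslerLagrangian

end Spray

/-! ### Parallel frames along geodesics -/

section ParallelFrame

open Set Filter

section Generic

variable {V W K : Type*} [NormedAddCommGroup V] [NormedSpace ℝ V] [NormedAddCommGroup W]
  [NormedSpace ℝ W] [NormedAddCommGroup K] [NormedSpace ℝ K]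

/-- An integral curve `c` of `S`, together with the solutions `B` and `P` of the linear equations
`Ḃ = -B DS(c)` (inverse linearised flow) and `Ṗ = -N(c) P` (parallel transport). -/
theorem exists_parallel_transport [CompleteSpace V] [CompleteSpace W] [CompleteSpace K]
    {S : V → V} {N : V → K →L[ℝ] K} {Ω : Set V} (hΩ : IsOpen Ω) (hS : ContDiffOn ℝ ∞ S Ω)
    (hN : ContDiffOn ℝ ∞ N Ω) {z₀ : V} (hz₀ : z₀ ∈ Ω) (B₀ : V →L[ℝ] W) :
    ∃ ε > (0 : ℝ), ∃ (c : ℝ → V) (B : ℝ → V →L[ℝ] W) (P : ℝ → K →L[ℝ] K),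
      c 0 = z₀ ∧ B 0 = B₀ ∧ P 0 = 1 ∧ ContDiffOn ℝ ∞ B (Ioo (-ε) ε) ∧
      ContDiffOn ℝ ∞ P (Ioo (-ε) ε) ∧ ∀ t ∈ Ioo (-ε) ε, c t ∈ Ω ∧ HasDerivAt c (S (c t)) t ∧
        HasDerivAt B (-(B t).comp (fderiv ℝ S (c t))) t ∧
        HasDerivAt P (-(N (c t)).comp (P t)) t := by
  let f : V × (V →L[ℝ] W) × (K →L[ℝ] K) → V × (V →L[ℝ] W) × (K →L[ℝ] K) := fun p =>
    (S p.1, -p.2.1.comp (fderiv ℝ S p.1), -(N p.1).comp p.2.2)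
  have hO : IsOpen (Prod.fst ⁻¹' Ω : Set (V × (V →L[ℝ] W) × (K →L[ℝ] K))) :=
    hΩ.preimage continuous_fst
  have hmaps : MapsTo Prod.fst (Prod.fst ⁻¹' Ω : Set (V × (V →L[ℝ] W) × (K →L[ℝ] K))) Ω :=
    fun p hp => hp
  have hf : ContDiffOn ℝ ∞ f (Prod.fst ⁻¹' Ω) := by
    have hS' : ContDiffOn ℝ ∞ (fderiv ℝ S) Ω := hS.fderiv_of_isOpen hΩ (by simp)
    have h21 : ContDiffOn ℝ ∞ (fun p : V × (V →L[ℝ] W) × (K →L[ℝ] K) => p.2.1)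
        (Prod.fst ⁻¹' Ω) := (contDiff_fst.comp contDiff_snd).contDiffOn
    have h22 : ContDiffOn ℝ ∞ (fun p : V × (V →L[ℝ] W) × (K →L[ℝ] K) => p.2.2)
        (Prod.fst ⁻¹' Ω) := (contDiff_snd.comp contDiff_snd).contDiffOn
    exact (hS.comp contDiffOn_fst hmaps).prodMk
      ((h21.clm_comp (hS'.comp contDiffOn_fst hmaps)).neg.prodMk
        ((hN.comp contDiffOn_fst hmaps).clm_comp h22).neg)
  obtain ⟨ε, hε, c, hc0, hc, hd⟩ := exists_smooth_integralCurve hO hf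
    (x₀ := (z₀, B₀, (1 : K →L[ℝ] K))) hz₀
  refine ⟨ε, hε, fun t => (c t).1, fun t => (c t).2.1, fun t => (c t).2.2, by simp [hc0],
    by simp [hc0], by simp [hc0], hc.snd.fst, hc.snd.snd, fun t ht => ?_⟩
  obtain ⟨h1, h2⟩ := hd t ht
  have hsnd : HasDerivAt (fun t => (c t).2) (f (c t)).2 t := h1.snd
  exact ⟨h2, h1.fst, hsnd.fst, hsnd.snd⟩

/-- If `ℓ` sends the vector field `S` to the vector field `X`, then it intertwines the linearised
flows: `A B = Dℓ(c)`, where `A` is the linearised flow of `X` along `γ` and `B` is the composition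
of the initial value `Dℓ(z₀)` with the inverse of the linearised flow of `S` along `c`. -/
theorem eventually_comp_eq_fderiv {S : V → V} {X : W → W} {l : V → W} {Ω : Set V} {O : Set W}
    (hΩ : IsOpen Ω) (hO : IsOpen O) (hS : ContDiffOn ℝ ∞ S Ω) (hX : ContDiffOn ℝ ∞ X O)
    (hl : ContDiffOn ℝ ∞ l Ω) (hlO : MapsTo l Ω O)
    (hlS : ∀ z ∈ Ω, fderiv ℝ l z (S z) = X (l z)) {c : ℝ → V} {γ : ℝ → W} {B : ℝ → V →L[ℝ] W}
    {A : ℝ → W →L[ℝ] W} (hc0 : c 0 ∈ Ω) (hγ0 : γ 0 = l (c 0)) (hB0 : B 0 = fderiv ℝ l (c 0))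
    (hA0 : A 0 = 1) (hc : ∀ᶠ t in 𝓝 (0 : ℝ), HasDerivAt c (S (c t)) t)
    (hγ : ∀ᶠ t in 𝓝 (0 : ℝ), HasDerivAt γ (X (γ t)) t)
    (hB : ∀ᶠ t in 𝓝 (0 : ℝ), HasDerivAt B (-(B t).comp (fderiv ℝ S (c t))) t)
    (hA : ∀ᶠ t in 𝓝 (0 : ℝ), HasDerivAt A ((fderiv ℝ X (γ t)).comp (A t)) t) :
    ∀ᶠ t in 𝓝 (0 : ℝ), (A t).comp (B t) = fderiv ℝ l (c t) := by
  have hle : (1 : WithTop ℕ∞) ≤ ∞ := by exact_mod_cast le_top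
  have hmem : ∀ᶠ t in 𝓝 (0 : ℝ), c t ∈ Ω :=
    hc.self_of_nhds.continuousAt.eventually_mem (hΩ.mem_nhds hc0)
  have hlat : ∀ z ∈ Ω, ContDiffAt ℝ ∞ l z := fun z hz => hl.contDiffAt (hΩ.mem_nhds hz)
  have hl' : ContDiffOn ℝ ∞ (fderiv ℝ l) Ω := hl.fderiv_of_isOpen hΩ (by simp)
  have hS' : ContDiffOn ℝ ∞ (fderiv ℝ S) Ω := hS.fderiv_of_isOpen hΩ (by simp)
  have hX' : ContDiffOn ℝ ∞ (fderiv ℝ X) O := hX.fderiv_of_isOpen hO (by simp)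
  have hld : ∀ z ∈ Ω, HasFDerivAt l (fderiv ℝ l z) z := fun z hz =>
    ((hlat z hz).differentiableAt (by simp)).hasFDerivAt
  have hld' : ∀ z ∈ Ω, HasFDerivAt (fderiv ℝ l) (fderiv ℝ (fderiv ℝ l) z) z := fun z hz =>
    ((hl'.contDiffAt (hΩ.mem_nhds hz)).differentiableAt (by simp)).hasFDerivAt
  have hSd : ∀ z ∈ Ω, HasFDerivAt S (fderiv ℝ S z) z := fun z hz =>
    ((hS.contDiffAt (hΩ.mem_nhds hz)).differentiableAt (by simp)).hasFDerivAt
  have hXd : ∀ z ∈ O, HasFDerivAt X (fderiv ℝ X z) z := fun z hz =>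
    ((hX.contDiffAt (hO.mem_nhds hz)).differentiableAt (by simp)).hasFDerivAt
  have heq : γ =ᶠ[𝓝 0] fun t => l (c t) := by
    refine integralCurve_eventuallyEq (f := X) ?_ hγ ?_ hγ0
    · rw [hγ0]
      exact (hX.contDiffAt (hO.mem_nhds (hlO hc0))).of_le hle
    · filter_upwards [hmem, hc] with t h1 h2
      rw [← hlS _ h1]
      exact (hld _ h1).comp_hasDerivAt t h2
  let f : V × (V →L[ℝ] W) → V × (V →L[ℝ] W) := fun p =>
    (S p.1, (fderiv ℝ X (l p.1)).comp p.2 - p.2.comp (fderiv ℝ S p.1))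
  have hf : ContDiffAt ℝ 1 f (c 0, (A 0).comp (B 0)) := by
    have h1 : ContDiffAt ℝ ∞ (fun p : V × (V →L[ℝ] W) => S p.1) (c 0, (A 0).comp (B 0)) :=
      (hS.contDiffAt (hΩ.mem_nhds hc0)).comp (c 0, (A 0).comp (B 0)) contDiffAt_fst
    have h2 : ContDiffAt ℝ ∞ (fun p : V × (V →L[ℝ] W) => fderiv ℝ S p.1)
        (c 0, (A 0).comp (B 0)) :=
      (hS'.contDiffAt (hΩ.mem_nhds hc0)).comp (c 0, (A 0).comp (B 0)) contDiffAt_fst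
    have h3 : ContDiffAt ℝ ∞ (fun p : V × (V →L[ℝ] W) => l p.1) (c 0, (A 0).comp (B 0)) :=
      (hlat _ hc0).comp (c 0, (A 0).comp (B 0)) contDiffAt_fst
    have h4 : ContDiffAt ℝ ∞ (fun p : V × (V →L[ℝ] W) => fderiv ℝ X (l p.1))
        (c 0, (A 0).comp (B 0)) :=
      (hX'.contDiffAt (hO.mem_nhds (hlO hc0))).comp (c 0, (A 0).comp (B 0)) h3
    exact (h1.prodMk ((h4.clm_comp contDiffAt_snd).sub (contDiffAt_snd.clm_comp h2))).of_le hle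
  have := integralCurve_eventuallyEq (f := f) (c := fun t => (c t, (A t).comp (B t)))
    (d := fun t => (c t, fderiv ℝ l (c t))) hf ?_ ?_ (by rw [hA0, hB0]; rfl)
  · filter_upwards [this] with t ht using congrArg Prod.snd ht
  · filter_upwards [hc, hA, hB, heq] with t h1 h2 h3 h4
    refine h1.prodMk ((h2.clm_comp h3).congr_deriv ?_)
    rw [h4]
    ext x
    simp [sub_eq_add_neg]
  · filter_upwards [hc, hmem] with t h1 h2
    refine h1.prodMk (((hld' _ h2).comp_hasDerivAt t h1).congr_deriv ?_)
    -- Differentiate `Dℓ(z) S(z) = X(ℓ(z))` and use the symmetry of the second derivative.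
    have e1 := (hld' _ h2).clm_apply (hSd _ h2)
    have e2 := ((hXd _ (hlO h2)).comp (c t) (hld _ h2)).congr_of_eventuallyEq
      (f₁ := fun z => fderiv ℝ l z (S z))
      (by filter_upwards [hΩ.mem_nhds h2] with z hz using hlS z hz)
    have e3 := e1.unique e2
    ext b
    have e4 := congrArg (fun T => T b) e3
    simp only [_root_.add_apply, ContinuousLinearMap.comp_apply,
      ContinuousLinearMap.flip_apply] at e4
    have hsymm : fderiv ℝ (fderiv ℝ l) (c t) (S (c t)) b =
        fderiv ℝ (fderiv ℝ l) (c t) b (S (c t)) :=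
      (hlat _ h2).isSymmSndFDerivAt (by
        rw [minSmoothness_of_isRCLikeNormedField]
        exact WithTop.coe_le_coe.2 le_top) _ _
    simp only [_root_.sub_apply, ContinuousLinearMap.comp_apply]
    rw [hsymm, ← e4]
    abel

end Generic

variable {n : ℕ} {U : Set (Coord n)} {L : Coord n × Coord n → ℝ} {h : Coord n × Dual n → ℝ}

/-- The geodesic spray `(v, -2G)`. -/
def sprayField (L : Coord n × Coord n → ℝ) (h : Coord n × Dual n → ℝ) (z : Coord n × Coord n) :
    Coord n × Coord n :=
  (z.2, -((2 : ℝ) • sprayVec L h z))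

namespace IsFinslerLagrangian

variable (hL : IsFinslerLagrangian U L) (hh : IsLegendreTransform U L h)
include hL hh

theorem contDiffOn_sprayField : ContDiffOn ℝ ∞ (sprayField L h) (slit U) :=
  contDiffOn_snd.prodMk ((hL.contDiffOn_sprayVec hh).const_smul (2 : ℝ)).neg

theorem fderiv_sprayField_apply {z : Coord n × Coord n} (hz : z ∈ slit U)
    (a : Coord n × Coord n) :
    fderiv ℝ (sprayField L h) z a = (a.2, -((2 : ℝ) • fderiv ℝ (sprayVec L h) z a)) := by
  have h1 : HasFDerivAt (sprayField L h) ((ContinuousLinearMap.snd ℝ (Coord n) (Coord n)).prod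
      (-((2 : ℝ) • fderiv ℝ (sprayVec L h) z))) z :=
    hasFDerivAt_snd.prodMk ((hL.hasFDerivAt_sprayVec hh hz).const_smul (2 : ℝ)).neg
  rw [h1.fderiv]
  rfl

/-- The curves `e_u(t) = (dΦ_t)⁻¹ 𝕃_*(0, P_t u)`, where `P_t u` is parallel along the geodesic,
satisfy `ë_u = -(dΦ_t)⁻¹ 𝕃_*(0, R P_t u)`, where `R` is the curvature of the spray. In particular
`e_u` and `ë_u` lie in the Jacobi curve. -/
theorem exists_parallel_jacobi_fields {z₀ : Coord n × Coord n} (hz₀ : z₀ ∈ slit U)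
    {γ : ℝ → Coord n × Dual n} {A : ℝ → (Coord n × Dual n) →L[ℝ] (Coord n × Dual n)}
    (hγ0 : γ 0 = legendreCoord L z₀) (hA0 : A 0 = 1)
    (hγ : ∀ᶠ t in 𝓝 (0 : ℝ), HasDerivAt γ (coordField h (γ t)) t)
    (hA : ∀ᶠ t in 𝓝 (0 : ℝ), HasDerivAt A ((fderiv ℝ (coordField h) (γ t)).comp (A t)) t) :
    ∃ ε > (0 : ℝ), ∃ e : Coord n → ℝ → Coord n × Dual n, ∀ u,
      ContDiffOn ℝ ∞ (e u) (Ioo (-ε) ε) ∧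
      (∀ t ∈ Ioo (-ε) ε, (A t (e u t)).1 = 0 ∧ (A t (deriv (deriv (e u)) t)).1 = 0) ∧
      e u 0 = fderiv ℝ (legendreCoord L) z₀ (0, u) ∧
      deriv (e u) 0 = -fderiv ℝ (legendreCoord L) z₀
        (u, -fderiv ℝ (sprayVec L h) z₀ (0, u)) ∧
      deriv (deriv (e u)) 0 = -fderiv ℝ (legendreCoord L) z₀ (0, sprayCurvature L h z₀ u) := by
  set N : Coord n × Coord n → Coord n →L[ℝ] Coord n := fun z =>
    (fderiv ℝ (sprayVec L h) z).comp (.inr ℝ (Coord n) (Coord n)) with hNdef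
  have hN : ContDiffOn ℝ ∞ N (slit U) :=
    (hL.contDiffOn_fderiv_sprayVec hh).clm_comp contDiffOn_const
  have hΩ := isOpen_slit hL.isOpen
  obtain ⟨ε, hε, c, B, P, hc0, hB0, hP0, hBs, hPs, hd⟩ := exists_parallel_transport hΩ
    (hL.contDiffOn_sprayField hh) hN hz₀ (fderiv ℝ (legendreCoord L) z₀)
  have h0 : (0 : ℝ) ∈ Ioo (-ε) ε := ⟨by linarith, hε⟩
  have hI : ∀ᶠ t in 𝓝 (0 : ℝ), t ∈ Ioo (-ε) ε := isOpen_Ioo.mem_nhds h0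
  have hAB : ∀ᶠ t in 𝓝 (0 : ℝ), (A t).comp (B t) = fderiv ℝ (legendreCoord L) (c t) := by
    refine eventually_comp_eq_fderiv hΩ hL.isOpen_image_legendreCoord
      (hL.contDiffOn_sprayField hh) (contDiffOn_coordField hL.isOpen_image_legendreCoord
        (hL.contDiffOn_hamiltonian hh)) hL.contDiffOn_legendreCoord (mapsTo_image _ _)
      (fun z hz => hL.fderiv_legendreCoord_spray hh hz) (by rwa [hc0]) (by rw [hγ0, hc0])
      (by rw [hB0, hc0]) hA0 ?_ hγ ?_ hA
    · filter_upwards [hI] with t ht using (hd t ht).2.1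
    · filter_upwards [hI] with t ht using (hd t ht).2.2.1
  obtain ⟨δ, hδ, hABδ⟩ := Metric.eventually_nhds_iff.1 hAB
  set e : Coord n → ℝ → Coord n × Dual n := fun u t => B t (0, P t u) with he
  have he1 : ∀ u, ∀ t ∈ Ioo (-ε) ε, HasDerivAt (e u) (-B t (P t u, -N (c t) (P t u))) t := by
    intro u t ht
    obtain ⟨hz, -, hBd, hPd⟩ := hd t ht
    have hp : HasDerivAt (fun t => ((0 : Coord n), P t u)) (0, -N (c t) (P t u)) t := by
      simpa using (hasDerivAt_const t (0 : Coord n)).prodMk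
        (hPd.clm_apply (hasDerivAt_const t u))
    refine (hBd.clm_apply hp).congr_deriv ?_
    rw [_root_.neg_apply, ContinuousLinearMap.comp_apply, hL.fderiv_sprayField_apply hh hz]
    change -(B t (P t u, -((2 : ℝ) • N (c t) (P t u)))) + B t (0, -N (c t) (P t u)) = _
    have key : ((P t u, -N (c t) (P t u)) : Coord n × Coord n) =
        (P t u, -((2 : ℝ) • N (c t) (P t u))) - (0, -N (c t) (P t u)) := by
      refine Prod.ext (by simp) ?_
      simp only [Prod.snd_sub, two_smul]
      abel
    rw [key, map_sub]
    abel
  have hNd : ∀ t ∈ Ioo (-ε) ε, HasDerivAt (fun t => N (c t))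
      ((fderiv ℝ (fderiv ℝ (sprayVec L h)) (c t) (sprayField L h (c t))).comp
        (.inr ℝ (Coord n) (Coord n))) t := by
    intro t ht
    obtain ⟨hz, hcd, -, -⟩ := hd t ht
    simpa using ((hL.hasFDerivAt_fderiv_sprayVec hh hz).comp_hasDerivAt t hcd).clm_comp
      (hasDerivAt_const t (ContinuousLinearMap.inr ℝ (Coord n) (Coord n)))
  have he2 : ∀ u, ∀ t ∈ Ioo (-ε) ε,
      HasDerivAt (deriv (e u)) (-B t (0, sprayCurvature L h (c t) (P t u))) t := by
    intro u t ht
    obtain ⟨hz, -, hBd, hPd⟩ := hd t ht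
    have hPu : HasDerivAt (fun t => P t u) (-N (c t) (P t u)) t := by
      simpa using hPd.clm_apply (hasDerivAt_const t u)
    have hp := hPu.prodMk ((hNd t ht).clm_apply hPu).neg
    have h1 : HasDerivAt (deriv (e u)) _ t :=
      (hBd.clm_apply hp).neg.congr_of_eventuallyEq (by
        filter_upwards [isOpen_Ioo.mem_nhds ht] with s hs using (he1 u s hs).deriv)
    refine h1.congr_deriv ?_
    rw [_root_.neg_apply, ContinuousLinearMap.comp_apply, hL.fderiv_sprayField_apply hh hz]
    set w := P t u
    set D : Coord n := fderiv ℝ (fderiv ℝ (sprayVec L h)) (c t) (sprayField L h (c t)) (0, w)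
    change -(-(B t (-N (c t) w, -((2 : ℝ) • fderiv ℝ (sprayVec L h) (c t) (w, -N (c t) w)))) +
      B t (-N (c t) w, -(D + N (c t) (-N (c t) w)))) = _
    have e1 : ((w, -N (c t) w) : Coord n × Coord n) = (w, 0) - (0, N (c t) w) := by
      ext <;> simp
    have key : ((0, sprayCurvature L h (c t) w) : Coord n × Coord n) =
        (-N (c t) w, -(D + N (c t) (-N (c t) w))) -
          (-N (c t) w, -((2 : ℝ) • fderiv ℝ (sprayVec L h) (c t) (w, -N (c t) w))) := by
      refine Prod.ext (by simp) ?_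
      rw [e1, map_sub]
      change (2 : ℝ) • fderiv ℝ (sprayVec L h) (c t) (w, 0) - D - N (c t) (N (c t) w) =
        -(D + N (c t) (-N (c t) w)) -
          -((2 : ℝ) • (fderiv ℝ (sprayVec L h) (c t) (w, 0) - N (c t) (N (c t) w)))
      rw [map_neg, smul_sub, two_smul ℝ (N (c t) (N (c t) w))]
      abel
    rw [key, map_sub]
    abel
  refine ⟨min ε δ, lt_min hε hδ, e, fun u => ⟨?_, fun t ht => ?_, ?_, ?_, ?_⟩⟩
  · refine ContDiffOn.mono ?_ (Ioo_subset_Ioo (neg_le_neg (min_le_left ε δ)) (min_le_left ε δ))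
    exact hBs.clm_apply (contDiffOn_const.prodMk (hPs.clm_apply contDiffOn_const))
  · have ht1 : t ∈ Ioo (-ε) ε :=
      Ioo_subset_Ioo (neg_le_neg (min_le_left ε δ)) (min_le_left ε δ) ht
    have ht2 : (A t).comp (B t) = fderiv ℝ (legendreCoord L) (c t) := by
      refine hABδ ?_
      rw [Real.dist_eq, sub_zero, abs_lt]
      exact Ioo_subset_Ioo (neg_le_neg (min_le_right ε δ)) (min_le_right ε δ) ht
    have ht3 : ∀ a, A t (B t a) = fderiv ℝ (legendreCoord L) (c t) a := fun a =>
      congrArg (fun T => T a) ht2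
    refine ⟨?_, ?_⟩
    · simp only [he]
      rw [ht3, hL.fderiv_legendreCoord_fst (hd t ht1).1]
    · rw [(he2 u t ht1).deriv, map_neg, ht3, Prod.fst_neg,
        hL.fderiv_legendreCoord_fst (hd t ht1).1, neg_zero]
  · simp [he, hB0, hP0]
  · rw [(he1 u 0 h0).deriv, hB0, hP0, hc0]
    rfl
  · rw [(he2 u 0 h0).deriv, hB0, hP0, hc0]
    rfl

end IsFinslerLagrangian

/-- A symmetric positive definite bilinear form has an orthonormal basis. -/
theorem exists_orthonormal_basis {B : LinearMap.BilinForm ℝ (Coord n)}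
    (hB : ∀ u w, B u w = B w u)
    (hpos : ∀ u ≠ 0, 0 < B u u) :
    ∃ b : Module.Basis (Fin n) ℝ (Coord n), ∀ i j, B (b i) (b j) = if i = j then 1 else 0 := by
  obtain ⟨b', hb'⟩ := LinearMap.BilinForm.exists_orthogonal_basis (B := B) ⟨hB⟩
  have hfr : Module.finrank ℝ (Coord n) = n := by simp
  let b := b'.reindex (finCongr hfr)
  have hb : ∀ i j, i ≠ j → B (b i) (b j) = 0 := by
    intro i j hij
    simp only [b, Module.Basis.reindex_apply]
    exact hb' ((finCongr hfr).symm.injective.ne hij)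
  have hbpos : ∀ i, 0 < B (b i) (b i) := fun i => hpos _ (b.ne_zero i)
  let w : Fin n → ℝˣ := fun i => Units.mk0 (Real.sqrt (B (b i) (b i)))⁻¹
    (inv_ne_zero (Real.sqrt_pos.2 (hbpos i)).ne')
  refine ⟨b.unitsSMul w, fun i j => ?_⟩
  simp only [Module.Basis.unitsSMul_apply, Units.smul_def, map_smul, LinearMap.smul_apply,
    smul_eq_mul, w, Units.val_mk0]
  split_ifs with hij
  · subst hij
    have := Real.mul_self_sqrt (hbpos i).le
    have h0 := (Real.sqrt_pos.2 (hbpos i)).ne'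
    field_simp
    rw [sq, this]
  · rw [hb i j hij]
    simp

end ParallelFrame

/-! ### Canonical charts of the cotangent bundle -/

section Cotangent

open Set Filter

variable {n : ℕ} {M : Type*} [TopologicalSpace M] [ChartedSpace (Coord n) M]

/-- The differential of a chart `φ` at `x`, as an endomorphism of `ℝⁿ` (on which Mathlib models
`T_x M`). -/
def chartDeriv (φ : OpenPartialHomeomorph M (Coord n)) (x : M) : Coord n →L[ℝ] Coord n :=
  mfderiv (𝓡 n) 𝓘(ℝ, Coord n) φ x

/-- The differential of the inverse of a chart `φ` at `y`, as an endomorphism of `ℝⁿ`. -/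
def chartSymmDeriv (φ : OpenPartialHomeomorph M (Coord n)) (y : Coord n) : Coord n →L[ℝ] Coord n :=
  mfderiv 𝓘(ℝ, Coord n) (𝓡 n) φ.symm y

theorem mdifferentiable_of_mem_maximalAtlas {φ : OpenPartialHomeomorph M (Coord n)}
    (hφ : φ ∈ IsManifold.maximalAtlas (𝓡 n) ∞ M) : φ.MDifferentiable (𝓡 n) (𝓡 n) :=
  ⟨(contMDiffOn_of_mem_maximalAtlas hφ).mdifferentiableOn (by simp),
    (contMDiffOn_symm_of_mem_maximalAtlas hφ).mdifferentiableOn (by simp)⟩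

/-- The covector of a point of `T*M`, as a linear form on `ℝⁿ`. -/
def covector (q : CoTM n M) : Dual n := q.snd

/-- The point of `T*M` over `x` given by a linear form on `ℝⁿ`. -/
def coMk (x : M) (p : Dual n) : CoTM n M := ⟨x, p⟩

theorem coMk_covector (q : CoTM n M) : coMk q.proj (covector q) = q := rfl

/-- The coordinates `(x, p)` on `T*M` induced by the chart `φ` of `M`. -/
def cotCoord (φ : OpenPartialHomeomorph M (Coord n)) (q : CoTM n M) : Coord n × Dual n :=
  (φ q.proj, (covector q).comp (chartDeriv φ q.proj).inverse)

/-- The point of `T*M` with given coordinates `(x, p)`. -/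
def cotPoint (φ : OpenPartialHomeomorph M (Coord n)) (z : Coord n × Dual n) : CoTM n M :=
  coMk (φ.symm z.1) (z.2.comp (chartDeriv φ (φ.symm z.1)))

theorem chartDeriv_comp_symm {φ : OpenPartialHomeomorph M (Coord n)}
    (hφ : φ ∈ IsManifold.maximalAtlas (𝓡 n) ∞ M) {x : M} (hx : x ∈ φ.source) :
    (chartDeriv φ x).comp (chartSymmDeriv φ (φ x)) =
      ContinuousLinearMap.id ℝ (Coord n) := by
  have := (mdifferentiable_of_mem_maximalAtlas hφ).comp_symm_deriv (φ.map_source hx)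
  rw [φ.left_inv hx] at this
  exact this

theorem symm_comp_chartDeriv {φ : OpenPartialHomeomorph M (Coord n)}
    (hφ : φ ∈ IsManifold.maximalAtlas (𝓡 n) ∞ M) {x : M} (hx : x ∈ φ.source) :
    (chartSymmDeriv φ (φ x)).comp (chartDeriv φ x) =
      ContinuousLinearMap.id ℝ (Coord n) :=
  (mdifferentiable_of_mem_maximalAtlas hφ).symm_comp_deriv hx

theorem chartDeriv_inverse {φ : OpenPartialHomeomorph M (Coord n)}
    (hφ : φ ∈ IsManifold.maximalAtlas (𝓡 n) ∞ M) {x : M} (hx : x ∈ φ.source) :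
    (chartDeriv φ x).inverse = (chartSymmDeriv φ (φ x)) :=
  ContinuousLinearMap.inverse_eq (chartDeriv_comp_symm hφ hx) (symm_comp_chartDeriv hφ hx)

theorem chartDeriv_comp_inverse {φ : OpenPartialHomeomorph M (Coord n)}
    (hφ : φ ∈ IsManifold.maximalAtlas (𝓡 n) ∞ M) {x : M} (hx : x ∈ φ.source) :
    (chartDeriv φ x).comp (chartDeriv φ x).inverse = ContinuousLinearMap.id ℝ (Coord n) := by
  rw [chartDeriv_inverse hφ hx, chartDeriv_comp_symm hφ hx]

theorem inverse_comp_chartDeriv {φ : OpenPartialHomeomorph M (Coord n)}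
    (hφ : φ ∈ IsManifold.maximalAtlas (𝓡 n) ∞ M) {x : M} (hx : x ∈ φ.source) :
    (chartDeriv φ x).inverse.comp (chartDeriv φ x) = ContinuousLinearMap.id ℝ (Coord n) := by
  rw [chartDeriv_inverse hφ hx, symm_comp_chartDeriv hφ hx]

theorem cotCoord_cotPoint {φ : OpenPartialHomeomorph M (Coord n)}
    (hφ : φ ∈ IsManifold.maximalAtlas (𝓡 n) ∞ M) {z : Coord n × Dual n} (hz : z.1 ∈ φ.target) :
    cotCoord φ (cotPoint φ z) = z := by
  refine Prod.ext (φ.right_inv hz) ?_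
  change (z.2.comp (chartDeriv φ (φ.symm z.1))).comp (chartDeriv φ (φ.symm z.1)).inverse = z.2
  rw [ContinuousLinearMap.comp_assoc, chartDeriv_comp_inverse hφ (φ.map_target hz),
    ContinuousLinearMap.comp_id]

theorem cotPoint_cotCoord {φ : OpenPartialHomeomorph M (Coord n)}
    (hφ : φ ∈ IsManifold.maximalAtlas (𝓡 n) ∞ M) {q : CoTM n M} (hq : q.proj ∈ φ.source) :
    cotPoint φ (cotCoord φ q) = q := by
  have key : ∀ y, y = q.proj → coMk y (((covector q).comp (chartDeriv φ q.proj).inverse).comp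
      (chartDeriv φ y)) = q := by
    rintro y rfl
    rw [ContinuousLinearMap.comp_assoc, inverse_comp_chartDeriv hφ hq,
      ContinuousLinearMap.comp_id, coMk_covector]
  exact key _ (φ.left_inv hq)

theorem chartDeriv_comp_chartSymmDeriv {φ ψ : OpenPartialHomeomorph M (Coord n)}
    (hφ : φ ∈ IsManifold.maximalAtlas (𝓡 n) ∞ M) (hψ : ψ ∈ IsManifold.maximalAtlas (𝓡 n) ∞ M)
    {y : Coord n} (hy : y ∈ φ.target) (hy' : φ.symm y ∈ ψ.source) :
    (chartDeriv ψ (φ.symm y)).comp (chartSymmDeriv φ y) = fderiv ℝ (ψ ∘ φ.symm) y := by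
  rw [← mfderiv_eq_fderiv]
  exact (mfderiv_comp (I := 𝓘(ℝ, Coord n)) (I' := 𝓡 n) (I'' := 𝓘(ℝ, Coord n)) y
    ((mdifferentiable_of_mem_maximalAtlas hψ).mdifferentiableAt hy')
    ((mdifferentiable_of_mem_maximalAtlas hφ).mdifferentiableAt_symm hy)).symm

theorem contDiffAt_chart_change {φ ψ : OpenPartialHomeomorph M (Coord n)}
    (hφ : φ ∈ IsManifold.maximalAtlas (𝓡 n) ∞ M) (hψ : ψ ∈ IsManifold.maximalAtlas (𝓡 n) ∞ M)
    {y : Coord n} (hy : y ∈ φ.target) (hy' : φ.symm y ∈ ψ.source) :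
    ContDiffAt ℝ ∞ (ψ ∘ φ.symm) y := by
  rw [← contMDiffAt_iff_contDiffAt]
  exact (contMDiffAt_of_mem_maximalAtlas hψ hy').comp y
    (contMDiffAt_symm_of_mem_maximalAtlas hφ hy)

theorem cotCoord_cotPoint_eq {φ ψ : OpenPartialHomeomorph M (Coord n)}
    (hφ : φ ∈ IsManifold.maximalAtlas (𝓡 n) ∞ M) (hψ : ψ ∈ IsManifold.maximalAtlas (𝓡 n) ∞ M)
    {z : Coord n × Dual n} (hz : z.1 ∈ ψ.target) (hz' : ψ.symm z.1 ∈ φ.source) :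
    cotCoord φ (cotPoint ψ z) = ((φ ∘ ψ.symm) z.1,
      z.2.comp (fderiv ℝ (ψ ∘ φ.symm) ((φ ∘ ψ.symm) z.1))) := by
  have hx : φ.symm (φ (ψ.symm z.1)) = ψ.symm z.1 := φ.left_inv hz'
  refine Prod.ext rfl ?_
  change (z.2.comp (chartDeriv ψ (ψ.symm z.1))).comp (chartDeriv φ (ψ.symm z.1)).inverse = _
  have h1 := chartDeriv_comp_chartSymmDeriv hφ hψ (φ.map_source hz')
    (by rw [hx]; exact ψ.map_target hz)
  rw [Function.comp_apply, ← h1, hx, chartDeriv_inverse hφ hz', ContinuousLinearMap.comp_assoc]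

variable [IsManifold (𝓡 n) ∞ M]

/-- Mathlib's charts of `T*M` are the canonical charts induced by the preferred charts of `M`. -/
theorem extChartAt_cotangent (q₀ : CoTM n M) {q : CoTM n M}
    (hq : q.proj ∈ (chartAt (Coord n) q₀.proj).source) :
    extChartAt (coModel n) q₀ q = cotCoord (chartAt (Coord n) q₀.proj) q := by
  have h1 : extChartAt (coModel n) q₀ q =
      chartAt (ModelProd (Coord n) (Dual n)) q₀ q := rfl
  rw [h1, hom_chart]
  refine Prod.ext rfl ?_
  have h2 := TangentBundle.symmL_trivializationAt (I := 𝓡 n) hq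
  rw [modelWithCornersSelf_coe, range_id, mfderivWithin_univ] at h2
  change _ = (covector q).comp (chartDeriv _ q.proj).inverse
  rw [chartDeriv_inverse (IsManifold.chart_mem_maximalAtlas q₀.proj) hq]
  have h3 := Bundle.Trivial.continuousLinearMapAt_trivialization ℝ M ℝ q.proj
  ext u
  change (Bundle.Trivialization.continuousLinearMapAt ℝ
    (Bundle.Trivial.trivialization M ℝ) q.proj) _ = _
  rw [h3]
  exact congrArg (fun T : Coord n →L[ℝ] Coord n => covector q (T u)) h2

theorem extChartAt_cotangent_source (q₀ : CoTM n M) : (extChartAt (coModel n) q₀).source =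
    {q | q.proj ∈ (chartAt (Coord n) q₀.proj).source} := by
  rw [FiberBundle.extChartAt]
  ext q
  simp only [hom_trivializationAt_source, mfld_simps]
  exact ⟨fun h => h.1.1, fun h => ⟨⟨h, mem_univ _⟩, h⟩⟩

theorem extChartAt_cotangent_symm (q₀ : CoTM n M) {z : Coord n × Dual n}
    (hz : z.1 ∈ (chartAt (Coord n) q₀.proj).target) :
    (extChartAt (coModel n) q₀).symm z = cotPoint (chartAt (Coord n) q₀.proj) z := by
  have hc := IsManifold.chart_mem_maximalAtlas (I := 𝓡 n) (n := ∞) q₀.proj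
  have hs : (cotPoint (chartAt (Coord n) q₀.proj) z).proj ∈
      (chartAt (Coord n) q₀.proj).source := (chartAt (Coord n) q₀.proj).map_target hz
  have h1 := extChartAt_cotangent q₀ hs
  rw [cotCoord_cotPoint hc hz] at h1
  conv_lhs => rw [← h1]
  exact (extChartAt (coModel n) q₀).left_inv (by rw [extChartAt_cotangent_source]; exact hs)

/-- The cotangent lift `(x, p) ↦ (f(x), p ∘ Df(x)⁻¹)` of a local diffeomorphism `f` with local
inverse `g` is smooth. -/
theorem contDiffAt_cotangentLift {f g : Coord n → Coord n} {z : Coord n × Dual n}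
    (hf : ContDiffAt ℝ ∞ f z.1) (hg : ContDiffAt ℝ ∞ g (f z.1)) :
    ContDiffAt ℝ ∞ (fun y : Coord n × Dual n => (f y.1, y.2.comp (fderiv ℝ g (f y.1)))) z := by
  have h1 : ContDiffAt ℝ ∞ (fun y : Coord n × Dual n => f y.1) z :=
    ContDiffAt.comp z hf contDiffAt_fst
  have h2 : ContDiffAt ℝ ∞ (fderiv ℝ g) (f z.1) := hg.fderiv_right (by simp)
  exact h1.prodMk (contDiffAt_snd.clm_comp
    (ContDiffAt.comp (f := fun y : Coord n × Dual n => f y.1) z h2 h1))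

/-- The cotangent lift of a local diffeomorphism is symplectic. -/
theorem omega_fderiv_cotangentLift {f g : Coord n → Coord n} {z : Coord n × Dual n}
    (hf : ContDiffAt ℝ ∞ f z.1) (hg : ContDiffAt ℝ ∞ g (f z.1))
    (hgf : ∀ᶠ x in 𝓝 z.1, g (f x) = x) (a b : Coord n × Dual n) :
    omega n
      (fderiv ℝ (fun y : Coord n × Dual n => (f y.1, y.2.comp (fderiv ℝ g (f y.1)))) z a)
      (fderiv ℝ (fun y : Coord n × Dual n => (f y.1, y.2.comp (fderiv ℝ g (f y.1)))) z b) =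
      omega n a b := by
  have hfd : HasFDerivAt f (fderiv ℝ f z.1) z.1 := (hf.differentiableAt (by simp)).hasFDerivAt
  have hgd : HasFDerivAt g (fderiv ℝ g (f z.1)) (f z.1) :=
    (hg.differentiableAt (by simp)).hasFDerivAt
  have hgd2 : HasFDerivAt (fderiv ℝ g) (fderiv ℝ (fderiv ℝ g) (f z.1)) (f z.1) :=
    ((hg.fderiv_right (m := ∞) (by simp)).differentiableAt (by simp)).hasFDerivAt
  have hinv : ∀ v, fderiv ℝ g (f z.1) (fderiv ℝ f z.1 v) = v := by
    intro v
    have h1 := (hgd.comp z.1 hfd).unique ((hasFDerivAt_id z.1).congr_of_eventuallyEq hgf)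
    exact congrArg (fun T => T v) h1
  have hsymm : ∀ v w, fderiv ℝ (fderiv ℝ g) (f z.1) v w = fderiv ℝ (fderiv ℝ g) (f z.1) w v :=
    fun v w => hg.isSymmSndFDerivAt (by
      rw [minSmoothness_of_isRCLikeNormedField]
      exact WithTop.coe_le_coe.2 le_top) v w
  have hΨ := ((contDiffAt_cotangentLift hf hg).differentiableAt (by simp)).hasFDerivAt
  have key : ∀ a : Coord n × Dual n,
      fderiv ℝ (fun y : Coord n × Dual n => (f y.1, y.2.comp (fderiv ℝ g (f y.1)))) z a =
        (fderiv ℝ f z.1 a.1, a.2.comp (fderiv ℝ g (f z.1)) +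
          z.2.comp (fderiv ℝ (fderiv ℝ g) (f z.1) (fderiv ℝ f z.1 a.1))) := by
    intro a
    have hline : HasDerivAt (fun t : ℝ => z + t • a) a 0 := by
      simpa using ((hasDerivAt_id (0 : ℝ)).smul_const a).const_add z
    have hl1 : HasDerivAt (fun t : ℝ => (z + t • a).1) a.1 0 := hline.fst
    have hl2 : HasDerivAt (fun t : ℝ => (z + t • a).2) a.2 0 := hline.snd
    have hf1 : HasDerivAt (fun t : ℝ => f (z + t • a).1) (fderiv ℝ f z.1 a.1) 0 :=
      hfd.comp_hasDerivAt_of_eq (0 : ℝ) hl1 (by simp)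
    have hg1 : HasDerivAt (fun t : ℝ => fderiv ℝ g (f (z + t • a).1))
        (fderiv ℝ (fderiv ℝ g) (f z.1) (fderiv ℝ f z.1 a.1)) 0 :=
      hgd2.comp_hasDerivAt_of_eq (0 : ℝ) hf1 (by simp)
    have h1 := hΨ.comp_hasDerivAt_of_eq (0 : ℝ) hline (by simp)
    have h2 := h1.unique (hf1.prodMk (hl2.clm_comp hg1))
    rw [h2]
    simp
  rw [key, key]
  simp only [omega_apply, _root_.add_apply, ContinuousLinearMap.comp_apply, hinv]
  rw [hsymm (fderiv ℝ f z.1 a.1)]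
  ring

end Cotangent

/-! ### Smoothness of the canonical charts -/

section CotangentCharts

open Set Filter

variable {n : ℕ} {M : Type*} [TopologicalSpace M] [ChartedSpace (Coord n) M]

theorem cotCoord_cotPoint_eventuallyEq {φ ψ : OpenPartialHomeomorph M (Coord n)}
    (hφ : φ ∈ IsManifold.maximalAtlas (𝓡 n) ∞ M) (hψ : ψ ∈ IsManifold.maximalAtlas (𝓡 n) ∞ M)
    {z : Coord n × Dual n} (hz : z.1 ∈ ψ.target) (hz' : ψ.symm z.1 ∈ φ.source) :
    cotCoord φ ∘ cotPoint ψ =ᶠ[𝓝 z] fun y : Coord n × Dual n => ((φ ∘ ψ.symm) y.1,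
      y.2.comp (fderiv ℝ (ψ ∘ φ.symm) ((φ ∘ ψ.symm) y.1))) := by
  have h1 : ψ.target ∩ ψ.symm ⁻¹' φ.source ∈ 𝓝 z.1 :=
    (ψ.isOpen_inter_preimage_symm φ.open_source).mem_nhds ⟨hz, hz'⟩
  filter_upwards [continuous_fst.continuousAt.preimage_mem_nhds h1] with y hy
  exact cotCoord_cotPoint_eq hφ hψ hy.1 hy.2

theorem contDiffAt_cotCoord_cotPoint {φ ψ : OpenPartialHomeomorph M (Coord n)}
    (hφ : φ ∈ IsManifold.maximalAtlas (𝓡 n) ∞ M) (hψ : ψ ∈ IsManifold.maximalAtlas (𝓡 n) ∞ M)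
    {z : Coord n × Dual n} (hz : z.1 ∈ ψ.target) (hz' : ψ.symm z.1 ∈ φ.source) :
    ContDiffAt ℝ ∞ (cotCoord φ ∘ cotPoint ψ) z := by
  refine ContDiffAt.congr_of_eventuallyEq ?_ (cotCoord_cotPoint_eventuallyEq hφ hψ hz hz')
  refine contDiffAt_cotangentLift (contDiffAt_chart_change hψ hφ hz hz')
    (contDiffAt_chart_change hφ hψ (φ.map_source hz') ?_)
  rw [Function.comp_apply, φ.left_inv hz']
  exact ψ.map_target hz

theorem omega_fderiv_cotCoord_cotPoint {φ ψ : OpenPartialHomeomorph M (Coord n)}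
    (hφ : φ ∈ IsManifold.maximalAtlas (𝓡 n) ∞ M) (hψ : ψ ∈ IsManifold.maximalAtlas (𝓡 n) ∞ M)
    {z : Coord n × Dual n} (hz : z.1 ∈ ψ.target) (hz' : ψ.symm z.1 ∈ φ.source)
    (a b : Coord n × Dual n) :
    omega n (fderiv ℝ (cotCoord φ ∘ cotPoint ψ) z a) (fderiv ℝ (cotCoord φ ∘ cotPoint ψ) z b) =
      omega n a b := by
  rw [(cotCoord_cotPoint_eventuallyEq hφ hψ hz hz').fderiv_eq]
  have hx : φ.symm ((φ ∘ ψ.symm) z.1) = ψ.symm z.1 := φ.left_inv hz'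
  refine omega_fderiv_cotangentLift (contDiffAt_chart_change hψ hφ hz hz')
    (contDiffAt_chart_change hφ hψ (φ.map_source hz') ?_) ?_ a b
  · rw [hx]
    exact ψ.map_target hz
  · have h1 : ψ.target ∩ ψ.symm ⁻¹' φ.source ∈ 𝓝 z.1 :=
      (ψ.isOpen_inter_preimage_symm φ.open_source).mem_nhds ⟨hz, hz'⟩
    filter_upwards [h1] with x hx
    simp only [Function.comp_apply]
    rw [φ.left_inv hx.2, ψ.right_inv hx.1]

variable [IsManifold (𝓡 n) ∞ M]

theorem continuous_cotangent_proj : Continuous fun q : CoTM n M => q.proj :=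
  FiberBundle.continuous_proj _ _

theorem contMDiff_cotangent_proj :
    ContMDiff (coModel n) (𝓡 n) ∞ fun q : CoTM n M => q.proj :=
  Bundle.contMDiff_proj _

theorem extChartAt_cotangent_mem (q : CoTM n M) :
    (extChartAt (coModel n) q q).1 ∈ (chartAt (Coord n) q.proj).target ∧
      (chartAt (Coord n) q.proj).symm (extChartAt (coModel n) q q).1 = q.proj := by
  rw [extChartAt_cotangent q (mem_chart_source _ _)]
  exact ⟨mem_chart_target _ _, (chartAt (Coord n) q.proj).left_inv (mem_chart_source _ _)⟩

theorem cotCoord_comp_extChartAt_symm_eventuallyEq (φ : OpenPartialHomeomorph M (Coord n))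
    (q : CoTM n M) :
    cotCoord φ ∘ (extChartAt (coModel n) q).symm =ᶠ[𝓝 (extChartAt (coModel n) q q)]
      cotCoord φ ∘ cotPoint (chartAt (Coord n) q.proj) := by
  have h1 := (chartAt (Coord n) q.proj).open_target.mem_nhds (extChartAt_cotangent_mem q).1
  filter_upwards [continuous_fst.continuousAt.preimage_mem_nhds h1] with y hy
  simp only [Function.comp_apply]
  rw [extChartAt_cotangent_symm q hy]

/-- The canonical coordinates are smooth. -/
theorem contMDiffAt_cotCoord {φ : OpenPartialHomeomorph M (Coord n)}
    (hφ : φ ∈ IsManifold.maximalAtlas (𝓡 n) ∞ M) {q : CoTM n M} (hq : q.proj ∈ φ.source) :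
    ContMDiffAt (coModel n) 𝓘(ℝ, Coord n × Dual n) ∞ (cotCoord φ) q := by
  have hc := IsManifold.chart_mem_maximalAtlas (I := 𝓡 n) (n := ∞) q.proj
  have hq' := extChartAt_cotangent_mem q
  have h1 : ContDiffAt ℝ ∞ (cotCoord φ ∘ cotPoint (chartAt (Coord n) q.proj))
      (extChartAt (coModel n) q q) :=
    contDiffAt_cotCoord_cotPoint hφ hc hq'.1 (by rw [hq'.2]; exact hq)
  have h2 := h1.contMDiffAt.comp q (contMDiffAt_extChartAt (I := coModel n) (n := ∞) (x := q))
  refine h2.congr_of_eventuallyEq ?_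
  have h3 : (extChartAt (coModel n) q).source ∈ 𝓝 q := extChartAt_source_mem_nhds q
  filter_upwards [h3] with y hy
  rw [extChartAt_cotangent_source] at hy
  simp only [Function.comp_apply]
  rw [extChartAt_cotangent q hy, cotPoint_cotCoord hc hy]

/-- The differential of the canonical coordinates induced by `φ`, as a map between
components. -/
def cotDeriv (φ : OpenPartialHomeomorph M (Coord n)) (q : CoTM n M) :
    Coord n × Dual n →L[ℝ] Coord n × Dual n :=
  mfderiv (coModel n) 𝓘(ℝ, Coord n × Dual n) (cotCoord φ) q

theorem cotDeriv_eq {φ : OpenPartialHomeomorph M (Coord n)}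
    (hφ : φ ∈ IsManifold.maximalAtlas (𝓡 n) ∞ M) {q : CoTM n M} (hq : q.proj ∈ φ.source) :
    cotDeriv φ q = fderiv ℝ (cotCoord φ ∘ cotPoint (chartAt (Coord n) q.proj))
      (extChartAt (coModel n) q q) := by
  rw [← (cotCoord_comp_extChartAt_symm_eventuallyEq φ q).fderiv_eq, cotDeriv,
    ((contMDiffAt_cotCoord hφ hq).mdifferentiableAt (by simp)).mfderiv]
  have hr : range (coModel n) = univ := (coModel n).range_eq_univ
  rw [hr, fderivWithin_univ]
  rfl

/-- The canonical coordinates are Darboux coordinates. -/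
theorem omega_cotDeriv {φ : OpenPartialHomeomorph M (Coord n)}
    (hφ : φ ∈ IsManifold.maximalAtlas (𝓡 n) ∞ M) {q : CoTM n M} (hq : q.proj ∈ φ.source)
    (a b : Coord n × Dual n) :
    omega n (cotDeriv φ q a) (cotDeriv φ q b) = omega n a b := by
  have hc := IsManifold.chart_mem_maximalAtlas (I := 𝓡 n) (n := ∞) q.proj
  have hq' := extChartAt_cotangent_mem q
  rw [cotDeriv_eq hφ hq]
  exact omega_fderiv_cotCoord_cotPoint hφ hc hq'.1 (by rw [hq'.2]; exact hq) a b

theorem cotDeriv_bijective {φ : OpenPartialHomeomorph M (Coord n)}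
    (hφ : φ ∈ IsManifold.maximalAtlas (𝓡 n) ∞ M) {q : CoTM n M} (hq : q.proj ∈ φ.source) :
    Function.Bijective (cotDeriv φ q) := by
  have hinj : Function.Injective (cotDeriv φ q) := by
    refine (injective_iff_map_eq_zero _).2 fun a ha => eq_zero_of_omega_eq_zero fun b => ?_
    rw [← omega_cotDeriv hφ hq, ha, map_zero, LinearMap.zero_apply]
  exact ⟨hinj, (LinearMap.injective_iff_surjective (f := (cotDeriv φ q).toLinearMap)).1 hinj⟩

theorem contMDiffAt_cotPoint {φ : OpenPartialHomeomorph M (Coord n)}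
    (hφ : φ ∈ IsManifold.maximalAtlas (𝓡 n) ∞ M) {z : Coord n × Dual n} (hz : z.1 ∈ φ.target) :
    ContMDiffAt 𝓘(ℝ, Coord n × Dual n) (coModel n) ∞ (cotPoint φ) z := by
  set q := cotPoint φ z with hqdef
  have hc := IsManifold.chart_mem_maximalAtlas (I := 𝓡 n) (n := ∞) q.proj
  have hq : q.proj = φ.symm z.1 := rfl
  have hzc : φ.symm z.1 ∈ (chartAt (Coord n) q.proj).source := mem_chart_source _ _
  have h1 := (contDiffAt_cotCoord_cotPoint hc hφ hz hzc).contMDiffAt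
  have h2 : ContMDiffAt 𝓘(ℝ, Coord n × Dual n) (coModel n) ∞ (extChartAt (coModel n) q).symm
      ((cotCoord (chartAt (Coord n) q.proj) ∘ cotPoint φ) z) := by
    have h3 : (cotCoord (chartAt (Coord n) q.proj) ∘ cotPoint φ) z =
        extChartAt (coModel n) q q := (extChartAt_cotangent q hzc).symm
    rw [h3]
    exact (contMDiffOn_extChartAt_symm q).contMDiffAt (extChartAt_target_mem_nhds q)
  refine (h2.comp z h1).congr_of_eventuallyEq ?_
  have h4 : φ.target ∩ φ.symm ⁻¹' (chartAt (Coord n) q.proj).source ∈ 𝓝 z.1 :=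
    (φ.isOpen_inter_preimage_symm (chartAt (Coord n) q.proj).open_source).mem_nhds ⟨hz, hzc⟩
  filter_upwards [continuous_fst.continuousAt.preimage_mem_nhds h4] with y hy
  have hy' : (cotPoint φ y).proj ∈ (chartAt (Coord n) q.proj).source := hy.2
  simp only [Function.comp_apply]
  rw [← extChartAt_cotangent q hy', (extChartAt (coModel n) q).left_inv]
  rw [extChartAt_cotangent_source]
  exact hy'

/-- The canonical chart of `T*M` induced by a chart `φ` of `M`. -/
def cotChart (φ : OpenPartialHomeomorph M (Coord n))
    (hφ : φ ∈ IsManifold.maximalAtlas (𝓡 n) ∞ M) :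
    OpenPartialHomeomorph (CoTM n M) (Coord n × Dual n) where
  toFun := cotCoord φ
  invFun := cotPoint φ
  source := {q | q.proj ∈ φ.source}
  target := {z | z.1 ∈ φ.target}
  map_source' _ hq := φ.map_source hq
  map_target' _ hz := φ.map_target hz
  left_inv' _ hq := cotPoint_cotCoord hφ hq
  right_inv' _ hz := cotCoord_cotPoint hφ hz
  open_source := φ.open_source.preimage continuous_cotangent_proj
  open_target := φ.open_target.preimage continuous_fst
  continuousOn_toFun _ hq := (contMDiffAt_cotCoord hφ hq).continuousAt.continuousWithinAt
  continuousOn_invFun _ hz := (contMDiffAt_cotPoint hφ hz).continuousAt.continuousWithinAt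

instance t2Space_cotangent [T2Space M] : T2Space (CoTM n M) := by
  refine ⟨fun q q' hne => ?_⟩
  by_cases hp : q.proj = q'.proj
  · have hφ := IsManifold.chart_mem_maximalAtlas (I := 𝓡 n) (n := ∞) q.proj
    have hq : q ∈ (cotChart _ hφ).source := mem_chart_source (Coord n) q.proj
    have hq' : q' ∈ (cotChart _ hφ).source := by
      change q'.proj ∈ (chartAt (Coord n) q.proj).source
      rw [← hp]
      exact mem_chart_source (Coord n) q.proj
    have hne' : cotChart _ hφ q ≠ cotChart _ hφ q' := fun h =>
      hne ((cotChart _ hφ).injOn hq hq' h)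
    obtain ⟨u, v, hu, hv, hqu, hqv, huv⟩ := t2_separation hne'
    refine ⟨_, _, (cotChart _ hφ).isOpen_inter_preimage hu,
      (cotChart _ hφ).isOpen_inter_preimage hv, ⟨hq, hqu⟩, ⟨hq', hqv⟩, ?_⟩
    exact (huv.preimage _).mono inter_subset_right inter_subset_right
  · obtain ⟨u, v, hu, hv, hqu, hqv, huv⟩ := t2_separation hp
    exact ⟨_, _, hu.preimage continuous_cotangent_proj, hv.preimage continuous_cotangent_proj,
      hqu, hqv, huv.preimage _⟩

/-- In canonical coordinates, the vertical space is the space of directions `∂_{pᵢ}`. -/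
theorem mem_vertical_iff {φ : OpenPartialHomeomorph M (Coord n)}
    (hφ : φ ∈ IsManifold.maximalAtlas (𝓡 n) ∞ M) {q : CoTM n M} (hq : q.proj ∈ φ.source)
    (ξ : TCoTM q) : ξ ∈ vertical q ↔ (cotDeriv φ q (comps ξ)).1 = 0 := by
  have h1 := (contMDiffAt_cotCoord hφ hq).mdifferentiableAt (by simp)
  have h2 := (contMDiff_cotangent_proj (n := n) (M := M) q).mdifferentiableAt (by simp)
  have h3 := (mdifferentiable_of_mem_maximalAtlas hφ).mdifferentiableAt hq
  have h4 := (contDiff_fst (𝕜 := ℝ) (E := Coord n) (F := Dual n) (n := ∞)).contMDiff.contMDiffAt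
    (x := cotCoord φ q) |>.mdifferentiableAt (by simp)
  have e1 := mfderiv_comp (I := coModel n) (I' := 𝓘(ℝ, Coord n × Dual n)) (I'' := 𝓘(ℝ, Coord n))
    q h4 h1
  have e2 := mfderiv_comp (I := coModel n) (I' := 𝓡 n) (I'' := 𝓘(ℝ, Coord n)) q h3 h2
  have e3 : ((Prod.fst : Coord n × Dual n → Coord n) ∘ cotCoord φ) = φ ∘ fun q : CoTM n M => q.proj :=
    rfl
  rw [e3, e2] at e1
  have e4 := congrArg (fun T : Coord n × Dual n →L[ℝ] Coord n => T (comps ξ)) e1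
  have e5 : chartDeriv φ q.proj (mfderiv (coModel n) (𝓡 n) (fun q' : CoTM n M => q'.proj) q ξ) =
      (cotDeriv φ q (comps ξ)).1 := by
    refine e4.trans ?_
    rw [mfderiv_eq_fderiv, fderiv_fst]
    rfl
  rw [← e5]
  change mfderiv (coModel n) (𝓡 n) (fun q' : CoTM n M => q'.proj) q ξ = 0 ↔ _
  refine ⟨fun h => by rw [h]; exact map_zero _, fun h => ?_⟩
  have h6 := congrArg (fun T : Coord n →L[ℝ] Coord n =>
    T (mfderiv (coModel n) (𝓡 n) (fun q' : CoTM n M => q'.proj) q ξ))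
    (inverse_comp_chartDeriv hφ hq)
  refine h6.symm.trans ?_
  change (chartDeriv φ q.proj).inverse (chartDeriv φ q.proj _) = _
  rw [h]
  exact map_zero _

end CotangentCharts

/-! ### Hamiltonian vector fields in canonical coordinates -/

section HamiltonianField

open Set Filter

variable {n : ℕ} {M : Type*} [TopologicalSpace M] [ChartedSpace (Coord n) M]
  [IsManifold (𝓡 n) ∞ M]

theorem differential_eq {φ : OpenPartialHomeomorph M (Coord n)}
    (hφ : φ ∈ IsManifold.maximalAtlas (𝓡 n) ∞ M) {q : CoTM n M} (hq : q.proj ∈ φ.source)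
    {H : CoTM n M → ℝ} (hH : DifferentiableAt ℝ (cotangentExpr φ H) (cotCoord φ q)) :
    differential H q = (fderiv ℝ (cotangentExpr φ H) (cotCoord φ q)).comp (cotDeriv φ q) := by
  have h1 : H =ᶠ[𝓝 q] cotangentExpr φ H ∘ cotCoord φ := by
    filter_upwards [(cotChart φ hφ).open_source.mem_nhds hq] with y hy
    exact congrArg H (cotPoint_cotCoord hφ hy).symm
  have h2 := mfderiv_comp (I := coModel n) (I' := 𝓘(ℝ, Coord n × Dual n)) (I'' := 𝓘(ℝ, ℝ)) q
    hH.mdifferentiableAt ((contMDiffAt_cotCoord hφ hq).mdifferentiableAt (by simp))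
  rw [mfderiv_eq_fderiv] at h2
  have h3 : mfderiv (coModel n) 𝓘(ℝ, ℝ) H q =
      mfderiv (coModel n) 𝓘(ℝ, ℝ) (cotangentExpr φ H ∘ cotCoord φ) q := h1.mfderiv_eq
  exact h3.trans h2

/-- Canonical charts preserve Hamiltonian vector fields. -/
theorem cotDeriv_hamiltonianVectorField {φ : OpenPartialHomeomorph M (Coord n)}
    (hφ : φ ∈ IsManifold.maximalAtlas (𝓡 n) ∞ M) {q : CoTM n M} (hq : q.proj ∈ φ.source)
    {H : CoTM n M → ℝ} (hH : DifferentiableAt ℝ (cotangentExpr φ H) (cotCoord φ q)) :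
    cotDeriv φ q (comps (hamiltonianVectorField H q)) =
      coordField (cotangentExpr φ H) (cotCoord φ q) := by
  rw [← sub_eq_zero]
  refine eq_zero_of_omega_eq_zero fun b => ?_
  obtain ⟨b, rfl⟩ := (cotDeriv_bijective hφ hq).2 b
  have h1 : omega n (comps (hamiltonianVectorField H q)) b = -differential H q b :=
    omega_gradient _ b
  rw [map_sub, LinearMap.sub_apply, omega_cotDeriv hφ hq, h1, omega_coordField,
    differential_eq hφ hq hH, ContinuousLinearMap.comp_apply, sub_self]

theorem IsHamiltonianFlow.continuous {H : CoTM n M → ℝ} {Φ : ℝ → CoTM n M → CoTM n M}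
    (hΦ : IsHamiltonianFlow H Φ) (q : CoTM n M) : Continuous fun t => Φ t q :=
  continuous_iff_continuousAt.2 fun t => (hΦ.integralCurve q t).continuousAt

theorem IsHamiltonianFlow.hasDerivAt {H : CoTM n M → ℝ} {Φ : ℝ → CoTM n M → CoTM n M}
    (hΦ : IsHamiltonianFlow H Φ) {φ : OpenPartialHomeomorph M (Coord n)}
    (hφ : φ ∈ IsManifold.maximalAtlas (𝓡 n) ∞ M) (q : CoTM n M) (t : ℝ)
    (hq : (Φ t q).proj ∈ φ.source)
    (hH : DifferentiableAt ℝ (cotangentExpr φ H) (cotCoord φ (Φ t q))) :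
    HasDerivAt (fun s => cotCoord φ (Φ s q))
      (coordField (cotangentExpr φ H) (cotCoord φ (Φ t q))) t := by
  have h1 := ((contMDiffAt_cotCoord hφ hq).mdifferentiableAt (by simp)).hasMFDerivAt.comp t
    (hΦ.integralCurve q t)
  have h2 : HasFDerivAt (fun s => cotCoord φ (Φ s q))
      ((cotDeriv φ (Φ t q)).comp ((1 : ℝ →L[ℝ] ℝ).smulRight
        (comps (hamiltonianVectorField H (Φ t q))))) t :=
    hasMFDerivAt_iff_hasFDerivAt.1 h1
  rw [← cotDeriv_hamiltonianVectorField hφ hq hH]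
  exact h2.hasDerivAt.congr_deriv (by simp)

end HamiltonianField

/-! ### Canonical charts of the tangent bundle -/

section Tangent

open Set Filter

variable {n : ℕ} {M : Type*} [TopologicalSpace M] [ChartedSpace (Coord n) M]

/-- The point of `TM` over `x` given by a vector of `ℝⁿ`. -/
def tanMk (x : M) (v : Coord n) : TM n M := ⟨x, v⟩

/-- The point of `TM` with given coordinates `(x, v)`. -/
def tanPoint (φ : OpenPartialHomeomorph M (Coord n)) (z : Coord n × Coord n) : TM n M :=
  tanMk (φ.symm z.1) ((chartDeriv φ (φ.symm z.1)).inverse z.2)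

variable [IsManifold (𝓡 n) ∞ M]

/-- Mathlib's trivializations of `TM` are given by the differentials of the preferred charts. -/
theorem trivializationAt_tanMk {x₀ x : M} (hx : x ∈ (chartAt (Coord n) x₀).source) (v : Coord n) :
    (trivializationAt (Coord n) (TangentSpace (𝓡 n)) x₀ (tanMk x v)).2 =
      chartDeriv (chartAt (Coord n) x₀) x v := by
  have h1 := TangentBundle.continuousLinearMapAt_trivializationAt (I := 𝓡 n) hx
  have h2 : (trivializationAt (Coord n) (TangentSpace (𝓡 n)) x₀).continuousLinearMapAt ℝ x v =
      (trivializationAt (Coord n) (TangentSpace (𝓡 n)) x₀ (tanMk x v)).2 :=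
    congrFun ((trivializationAt (Coord n) (TangentSpace (𝓡 n)) x₀).coe_linearMapAt_of_mem
      (R := ℝ) hx) v
  rw [← h2]
  exact congrArg (fun T : Coord n →L[ℝ] Coord n => T v) h1

theorem contMDiffAt_tanPoint {φ : OpenPartialHomeomorph M (Coord n)}
    (hφ : φ ∈ IsManifold.maximalAtlas (𝓡 n) ∞ M) {z : Coord n × Coord n} (hz : z.1 ∈ φ.target) :
    ContMDiffAt 𝓘(ℝ, Coord n × Coord n) (𝓡 n).tangent ∞ (tanPoint φ) z := by
  have hfst : ContMDiffAt 𝓘(ℝ, Coord n × Coord n) 𝓘(ℝ, Coord n) ∞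
      (Prod.fst : Coord n × Coord n → Coord n) z := contDiffAt_fst.contMDiffAt
  refine Bundle.contMDiffAt_totalSpace.2 ⟨?_, ?_⟩
  · exact (contMDiffAt_symm_of_mem_maximalAtlas hφ hz).comp z hfst
  · set c := chartAt (Coord n) (φ.symm z.1) with hc
    have hcA : c ∈ IsManifold.maximalAtlas (𝓡 n) ∞ M := IsManifold.chart_mem_maximalAtlas _
    have hzc : φ.symm z.1 ∈ c.source := mem_chart_source _ _
    have h1 : ContDiffAt ℝ ∞ (fun y : Coord n × Coord n => fderiv ℝ (c ∘ φ.symm) y.1 y.2) z :=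
      (ContDiffAt.comp z ((contDiffAt_chart_change hφ hcA hz hzc).fderiv_right (m := ∞) (by simp))
        contDiffAt_fst).clm_apply contDiffAt_snd
    refine h1.contMDiffAt.congr_of_eventuallyEq ?_
    have h4 : φ.target ∩ φ.symm ⁻¹' c.source ∈ 𝓝 z.1 :=
      (φ.isOpen_inter_preimage_symm c.open_source).mem_nhds ⟨hz, hzc⟩
    filter_upwards [continuous_fst.continuousAt.preimage_mem_nhds h4] with y hy
    refine (trivializationAt_tanMk hy.2 _).trans ?_
    rw [chartDeriv_inverse hφ (φ.map_target hy.1), φ.right_inv hy.1,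
      ← chartDeriv_comp_chartSymmDeriv hφ hcA hy.1 hy.2]
    rfl

theorem contMDiffAt_tangentCoords {φ : OpenPartialHomeomorph M (Coord n)}
    (hφ : φ ∈ IsManifold.maximalAtlas (𝓡 n) ∞ M) {ξ : TM n M} (hξ : ξ.proj ∈ φ.source) :
    ContMDiffAt (𝓡 n).tangent 𝓘(ℝ, Coord n × Coord n) ∞ (tangentCoords φ) ξ := by
  set c := chartAt (Coord n) ξ.proj with hc
  have hcA : c ∈ IsManifold.maximalAtlas (𝓡 n) ∞ M := IsManifold.chart_mem_maximalAtlas _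
  have hξc : ξ.proj ∈ c.source := mem_chart_source _ _
  obtain ⟨hid1, hid2⟩ := Bundle.contMDiffAt_totalSpace.1
    (contMDiffAt_id (I := (𝓡 n).tangent) (n := ∞) (x := ξ))
  have h1 : ContMDiffAt (𝓡 n).tangent 𝓘(ℝ, Coord n) ∞ (fun η : TM n M => φ η.proj) ξ :=
    (contMDiffAt_of_mem_maximalAtlas hφ hξ).comp ξ hid1
  have h2 : ContMDiffAt (𝓡 n).tangent 𝓘(ℝ, Coord n) ∞ (fun η : TM n M => c η.proj) ξ :=
    (contMDiffAt_of_mem_maximalAtlas hcA hξc).comp ξ hid1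
  have hcξ : c.symm (c ξ.proj) = ξ.proj := c.left_inv hξc
  have h3 : ContDiffAt ℝ ∞ (fun y : Coord n × Coord n => fderiv ℝ (φ ∘ c.symm) y.1 y.2)
      (c ξ.proj, (trivializationAt (Coord n) (TangentSpace (𝓡 n)) ξ.proj ξ).2) :=
    (ContDiffAt.comp (f := (Prod.fst : Coord n × Coord n → Coord n)) (c ξ.proj, _)
      ((contDiffAt_chart_change hcA hφ (c.map_source hξc)
      (by rw [hcξ]; exact hξ)).fderiv_right (m := ∞) (by simp)) contDiffAt_fst).clm_apply
      contDiffAt_snd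
  have h4 := h3.contMDiffAt.comp ξ (h2.prodMk_space hid2)
  refine ContMDiffAt.prodMk_space h1 (h4.congr_of_eventuallyEq ?_)
  have h5 : (fun η : TM n M => η.proj) ⁻¹' (φ.source ∩ c.source) ∈ 𝓝 ξ :=
    hid1.continuousAt.preimage_mem_nhds
      ((φ.open_source.inter c.open_source).mem_nhds ⟨hξ, hξc⟩)
  filter_upwards [h5] with η hη
  have h6 : c.symm (c η.proj) = η.proj := c.left_inv hη.2
  have h7 : (trivializationAt (Coord n) (TangentSpace (𝓡 n)) ξ.proj η).2 =
      chartDeriv c η.proj η.snd := trivializationAt_tanMk hη.2 η.snd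
  change chartDeriv φ η.proj η.snd = fderiv ℝ (φ ∘ c.symm) (c η.proj)
    (trivializationAt (Coord n) (TangentSpace (𝓡 n)) ξ.proj η).2
  rw [h7, ← chartDeriv_comp_chartSymmDeriv hcA hφ (c.map_source hη.2) (by rw [h6]; exact hη.1),
    h6, ContinuousLinearMap.comp_apply]
  have h8 := congrArg (fun T : Coord n →L[ℝ] Coord n => T η.snd) (symm_comp_chartDeriv hcA hη.2)
  exact congrArg (chartDeriv φ η.proj) h8.symm

theorem contMDiffAt_tanMk (x : M) (v : Coord n) :
    ContMDiffAt 𝓘(ℝ, Coord n) (𝓡 n).tangent ∞ (tanMk x) v := by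
  refine Bundle.contMDiffAt_totalSpace.2 ⟨contMDiffAt_const, ?_⟩
  refine (((chartDeriv (chartAt (Coord n) x) x).contDiff (n := ∞)).contDiffAt.contMDiffAt
    ).congr_of_eventuallyEq (Eventually.of_forall fun w => ?_)
  exact trivializationAt_tanMk (mem_chart_source _ _) w

omit [IsManifold (𝓡 n) ∞ M] in
theorem tangentExpr_eq (φ : OpenPartialHomeomorph M (Coord n)) (L : TM n M → ℝ)
    (z : Coord n × Coord n) : tangentExpr φ L z = L (tanPoint φ z) := by
  have h : ∑ i, z.2 i • (chartDeriv φ (φ.symm z.1)).inverse (basisVec i) =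
      (chartDeriv φ (φ.symm z.1)).inverse z.2 := by
    simp only [← map_smul, ← map_sum, sum_smul_basisVec]
  exact congrArg (fun v : Coord n => L (tanMk (φ.symm z.1) v)) h

omit [IsManifold (𝓡 n) ∞ M] in
theorem tanPoint_chart {φ : OpenPartialHomeomorph M (Coord n)} {x : M} (hx : x ∈ φ.source)
    (w : Coord n) : tanPoint φ (φ x, w) = tanMk x ((chartDeriv φ x).inverse w) := by
  have key : ∀ y, y = x → tanMk y ((chartDeriv φ y).inverse w) =
      tanMk x ((chartDeriv φ x).inverse w) := by
    rintro y rfl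
    rfl
  exact key _ (φ.left_inv hx)

omit [IsManifold (𝓡 n) ∞ M] in
theorem tanPoint_tangentCoords {φ : OpenPartialHomeomorph M (Coord n)}
    (hφ : φ ∈ IsManifold.maximalAtlas (𝓡 n) ∞ M) {x : M} (hx : x ∈ φ.source) (v : Coord n) :
    tanPoint φ (φ x, chartDeriv φ x v) = tanMk x v := by
  rw [tanPoint_chart hx]
  have h := congrArg (fun T : Coord n →L[ℝ] Coord n => T v) (inverse_comp_chartDeriv hφ hx)
  exact congrArg (tanMk x) h

omit [IsManifold (𝓡 n) ∞ M] in
theorem tangentExpr_tangentCoords {φ : OpenPartialHomeomorph M (Coord n)}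
    (hφ : φ ∈ IsManifold.maximalAtlas (𝓡 n) ∞ M) (L : TM n M → ℝ) {x : M} (hx : x ∈ φ.source)
    (v : Coord n) : tangentExpr φ L (φ x, chartDeriv φ x v) = L (tanMk x v) := by
  rw [tangentExpr_eq, tanPoint_tangentCoords hφ hx]

end Tangent

/-! ### Finsler metrics and the Legendre map in canonical coordinates -/

section Finsler

open Set Filter

variable {n : ℕ} {M : Type*} [TopologicalSpace M] [ChartedSpace (Coord n) M]

theorem chartDeriv_injective {φ : OpenPartialHomeomorph M (Coord n)}
    (hφ : φ ∈ IsManifold.maximalAtlas (𝓡 n) ∞ M) {x : M} (hx : x ∈ φ.source) :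
    Function.Injective (chartDeriv φ x) := fun v w h => by
  have h1 := congrArg (fun T : Coord n →L[ℝ] Coord n => T v) (inverse_comp_chartDeriv hφ hx)
  have h2 := congrArg (fun T : Coord n →L[ℝ] Coord n => T w) (inverse_comp_chartDeriv hφ hx)
  simp only [ContinuousLinearMap.comp_apply, ContinuousLinearMap.id_apply] at h1 h2
  rw [← h1, h, h2]

theorem chartDeriv_inverse_apply {φ : OpenPartialHomeomorph M (Coord n)}
    (hφ : φ ∈ IsManifold.maximalAtlas (𝓡 n) ∞ M) {x : M} (hx : x ∈ φ.source) (v : Coord n) :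
    chartDeriv φ x ((chartDeriv φ x).inverse v) = v :=
  congrArg (fun T : Coord n →L[ℝ] Coord n => T v) (chartDeriv_comp_inverse hφ hx)

theorem chartDeriv_inverse_ne_zero {φ : OpenPartialHomeomorph M (Coord n)}
    (hφ : φ ∈ IsManifold.maximalAtlas (𝓡 n) ∞ M) {x : M} (hx : x ∈ φ.source) {v : Coord n}
    (hv : v ≠ 0) : (chartDeriv φ x).inverse v ≠ 0 := fun h => hv (by
  rw [← chartDeriv_inverse_apply hφ hx v, h, map_zero])

theorem tangentCoords_mem_slit {φ : OpenPartialHomeomorph M (Coord n)}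
    (hφ : φ ∈ IsManifold.maximalAtlas (𝓡 n) ∞ M) {ξ : TM n M} (hξ : ξ.proj ∈ φ.source)
    (hv : ξ.snd ≠ 0) : tangentCoords φ ξ ∈ slit φ.target := by
  refine ⟨φ.map_source hξ, fun h => hv ?_⟩
  have h' : chartDeriv φ ξ.proj ξ.snd = chartDeriv φ ξ.proj 0 :=
    Eq.trans h (map_zero (chartDeriv φ ξ.proj)).symm
  exact chartDeriv_injective hφ hξ h'

variable [IsManifold (𝓡 n) ∞ M]

theorem contDiffOn_tangentExpr_lagrangian {F : TM n M → ℝ} (hF : IsFinslerMetric F)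
    {φ : OpenPartialHomeomorph M (Coord n)} (hφ : φ ∈ IsManifold.maximalAtlas (𝓡 n) ∞ M) :
    ContDiffOn ℝ ∞ (tangentExpr φ (lagrangian F)) (slit φ.target) := by
  have hopen : IsOpen {ξ : TM n M | ξ.snd ≠ 0} := by
    rw [isOpen_iff_mem_nhds]
    intro ξ hξ
    have hc : chartAt (Coord n) ξ.proj ∈ IsManifold.maximalAtlas (𝓡 n) ∞ M :=
      IsManifold.chart_mem_maximalAtlas _
    have h1 := (contMDiffAt_tangentCoords hc (mem_chart_source (Coord n) ξ.proj)).continuousAt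
    have h2 := tangentCoords_mem_slit hc (mem_chart_source (Coord n) ξ.proj) hξ
    filter_upwards [h1.eventually_mem ((isOpen_slit (chartAt (Coord n) ξ.proj).open_target).mem_nhds
      h2)] with η hη h0
    refine hη.2 ?_
    change chartDeriv (chartAt (Coord n) ξ.proj) η.proj η.snd = 0
    rw [h0]
    exact map_zero _
  intro z hz
  have h1 : ContMDiffAt (𝓡 n).tangent 𝓘(ℝ, ℝ) ∞ F (tanPoint φ z) := by
    refine (hF.smooth _ ?_).contMDiffAt (hopen.mem_nhds ?_) <;>
    exact chartDeriv_inverse_ne_zero hφ (φ.map_target hz.1) hz.2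
  have h2 : ContDiffAt ℝ ∞ (fun y => F (tanPoint φ y)) z :=
    (h1.comp z (contMDiffAt_tanPoint hφ hz.1)).contDiffAt
  refine ContDiffAt.contDiffWithinAt (((h2.pow 2).div_const 2).congr_of_eventuallyEq
    (Eventually.of_forall fun y => tangentExpr_eq φ _ y))

/-- In canonical coordinates, `F² / 2` is a Finsler Lagrangian. -/
theorem isFinslerLagrangian {F : TM n M → ℝ} (hF : IsFinslerMetric F)
    {φ : OpenPartialHomeomorph M (Coord n)} (hφ : φ ∈ IsManifold.maximalAtlas (𝓡 n) ∞ M) :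
    IsFinslerLagrangian φ.target (tangentExpr φ (lagrangian F)) where
  isOpen := φ.open_target
  smooth := contDiffOn_tangentExpr_lagrangian hF hφ
  homogeneous x v c hc := by
    rw [tangentExpr_eq, tangentExpr_eq]
    have h1 : tanPoint φ (x, c • v) =
        tanMk (φ.symm x) (c • (chartDeriv φ (φ.symm x)).inverse v) :=
      congrArg (tanMk (φ.symm x)) (map_smul _ _ _)
    have h2 : F (tanMk (φ.symm x) (c • (chartDeriv φ (φ.symm x)).inverse v)) =
        c * F (tanPoint φ (x, v)) := hF.homogeneous _ _ c hc
    rw [h1, lagrangian, h2, lagrangian]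
    ring
  nonneg z := by
    rw [tangentExpr_eq, lagrangian]
    positivity
  hessian_pos z hz u hu := by
    have hs := contDiffOn_tangentExpr_lagrangian hF hφ
    have hO := isOpen_slit φ.open_target
    have hline : ∀ t : ℝ, HasDerivAt (fun t : ℝ => z + t • ((0 : Coord n), u)) (0, u) t :=
      fun t => by simpa using ((hasDerivAt_id t).smul_const ((0 : Coord n), u)).const_add z
    have hnear : ∀ᶠ t : ℝ in 𝓝 0, z + t • ((0 : Coord n), u) ∈ slit φ.target := by
      refine (hline 0).continuousAt.eventually_mem (hO.mem_nhds ?_)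
      simpa using hz
    have heq : ∀ t : ℝ, F (tanMk (φ.symm z.1) ((chartDeriv φ (φ.symm z.1)).inverse z.2 +
        t • (chartDeriv φ (φ.symm z.1)).inverse u)) ^ 2 =
        2 * tangentExpr φ (lagrangian F) (z + t • ((0 : Coord n), u)) := by
      intro t
      have e : z + t • ((0 : Coord n), u) = (z.1, z.2 + t • u) := by ext <;> simp
      rw [e, tangentExpr_eq, lagrangian, tanPoint, map_add, map_smul]
      ring
    have h1 : deriv (fun t : ℝ => F (tanMk (φ.symm z.1) ((chartDeriv φ (φ.symm z.1)).inverse z.2 +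
        t • (chartDeriv φ (φ.symm z.1)).inverse u)) ^ 2) =ᶠ[𝓝 0] fun t =>
        2 * fderiv ℝ (tangentExpr φ (lagrangian F)) (z + t • ((0 : Coord n), u)) (0, u) := by
      filter_upwards [hnear] with t ht
      rw [funext heq]
      have hd : HasFDerivAt (tangentExpr φ (lagrangian F)) _ (z + t • ((0 : Coord n), u)) :=
        ((hs.contDiffAt (hO.mem_nhds ht)).differentiableAt (by simp)).hasFDerivAt
      exact ((hd.comp_hasDerivAt t (hline t)).const_mul 2).deriv
    have h2 := hF.hessian_pos (φ.symm z.1) ((chartDeriv φ (φ.symm z.1)).inverse z.2)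
      ((chartDeriv φ (φ.symm z.1)).inverse u)
      (chartDeriv_inverse_ne_zero hφ (φ.map_target hz.1) hz.2)
      (chartDeriv_inverse_ne_zero hφ (φ.map_target hz.1) hu)
    have h3 := h1.deriv_eq.trans
      (((hs.contDiffAt (hO.mem_nhds hz)).hasDerivAt_fderiv_apply_line (0, u) (0, u)).const_mul
        2).deriv
    have h4 : 0 < deriv (deriv fun t : ℝ => F (tanMk (φ.symm z.1)
      ((chartDeriv φ (φ.symm z.1)).inverse z.2 +
        t • (chartDeriv φ (φ.symm z.1)).inverse u)) ^ 2) 0 := h2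
    rw [h3] at h4
    linarith

/-- In canonical coordinates, the Hamiltonian is the Legendre transform of the Lagrangian: by
convexity, the supremum over `w` of `p(w) - L(x, w)`, `p = L_v(x, v)`, is attained at `v`. -/
theorem isLegendreTransform {F : TM n M → ℝ} (hF : IsFinslerMetric F)
    {φ : OpenPartialHomeomorph M (Coord n)} (hφ : φ ∈ IsManifold.maximalAtlas (𝓡 n) ∞ M) :
    IsLegendreTransform φ.target (tangentExpr φ (lagrangian F))
      (cotangentExpr φ (hamiltonian (lagrangian F))) := by
  intro z hz
  have hL := isFinslerLagrangian hF hφ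
  set L := tangentExpr φ (lagrangian F) with hLdef
  have hx := φ.map_target hz.1
  set x := φ.symm z.1 with hxdef
  have hval : ∀ v : Coord n, (legendreCoord L z).2 (chartDeriv φ x v) - lagrangian F (tanMk x v) =
      fderiv ℝ L z (0, chartDeriv φ x v) - L (z.1, chartDeriv φ x v) := by
    intro v
    have h1 := tangentExpr_tangentCoords hφ (lagrangian F) hx v
    rw [φ.right_inv hz.1] at h1
    rw [← h1, legendreCoord_eq]
    rfl
  have hle : ∀ v : Coord n, (legendreCoord L z).2 (chartDeriv φ x v) - lagrangian F (tanMk x v) ≤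
      fderiv ℝ L z (0, z.2) - L z := by
    intro v
    have h1 := hL.add_fderiv_le hz (chartDeriv φ x v)
    have e : ((0 : Coord n), chartDeriv φ x v - z.2) = (0, chartDeriv φ x v) - (0, z.2) := by
      ext <;> simp
    rw [e, map_sub] at h1
    rw [hval]
    linarith
  change (⨆ v : Coord n, ((legendreCoord L z).2 (chartDeriv φ x v) - lagrangian F (tanMk x v))) = _
  refine le_antisymm (ciSup_le hle) ?_
  refine le_trans (le_of_eq ?_) (le_ciSup (f := fun v : Coord n =>
    (legendreCoord L z).2 (chartDeriv φ x v) - lagrangian F (tanMk x v))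
    ⟨_, forall_mem_range.2 hle⟩ ((chartDeriv φ x).inverse z.2))
  rw [hval, chartDeriv_inverse_apply hφ hx]

/-- The Legendre map in canonical coordinates. -/
theorem cotCoord_legendreMap {F : TM n M → ℝ} (hF : IsFinslerMetric F)
    {φ : OpenPartialHomeomorph M (Coord n)} (hφ : φ ∈ IsManifold.maximalAtlas (𝓡 n) ∞ M)
    {ξ : TM n M} (hξ : ξ.proj ∈ φ.source) (hv : ξ.snd ≠ 0) :
    cotCoord φ (legendreMap (lagrangian F) ξ) =
      legendreCoord (tangentExpr φ (lagrangian F)) (tangentCoords φ ξ) := by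
  have hL := isFinslerLagrangian hF hφ
  have hz := tangentCoords_mem_slit hφ hξ hv
  rw [legendreCoord_eq]
  refine Prod.ext rfl ?_
  change (fderiv ℝ (fun v : Coord n => lagrangian F (tanMk ξ.proj v)) ξ.snd).comp
    (chartDeriv φ ξ.proj).inverse = _
  have h1 : (fun v : Coord n => lagrangian F (tanMk ξ.proj v)) =
      fun v => tangentExpr φ (lagrangian F) (φ ξ.proj, chartDeriv φ ξ.proj v) :=
    funext fun v => (tangentExpr_tangentCoords hφ _ hξ v).symm
  have h2 : HasFDerivAt (fun v : Coord n => (φ ξ.proj, chartDeriv φ ξ.proj v))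
      ((0 : Coord n →L[ℝ] Coord n).prod (chartDeriv φ ξ.proj)) ξ.snd :=
    (hasFDerivAt_const _ _).prodMk (chartDeriv φ ξ.proj).hasFDerivAt
  have h3 : HasFDerivAt (fun v : Coord n =>
      tangentExpr φ (lagrangian F) (φ ξ.proj, chartDeriv φ ξ.proj v)) _ ξ.snd :=
    HasFDerivAt.comp (f := fun v : Coord n => (φ ξ.proj, chartDeriv φ ξ.proj v)) ξ.snd
      (hL.hasFDerivAt hz) h2
  rw [h1, h3.fderiv]
  ext w
  simp only [ContinuousLinearMap.comp_apply, ContinuousLinearMap.prod_apply, _root_.zero_apply,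
    ContinuousLinearMap.inr_apply, chartDeriv_inverse_apply hφ hξ]
  rfl

theorem mdifferentiableAt_legendreMap {F : TM n M → ℝ} (hF : IsFinslerMetric F) {ξ : TM n M}
    (hv : ξ.snd ≠ 0) :
    MDifferentiableAt (𝓡 n).tangent (coModel n) (legendreMap (lagrangian F)) ξ := by
  have hφ : chartAt (Coord n) ξ.proj ∈ IsManifold.maximalAtlas (𝓡 n) ∞ M :=
    IsManifold.chart_mem_maximalAtlas _
  set φ := chartAt (Coord n) ξ.proj with hφdef
  have hξ : ξ.proj ∈ φ.source := mem_chart_source _ _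
  have hL := isFinslerLagrangian hF hφ
  have hz := tangentCoords_mem_slit hφ hξ hv
  have h1 := contMDiffAt_tangentCoords hφ hξ
  have h2 := (hL.contDiffAt_legendreCoord hz).contMDiffAt.comp ξ h1
  have h3 : ContMDiffAt 𝓘(ℝ, Coord n × Dual n) (coModel n) ∞ (cotPoint φ)
      (legendreCoord (tangentExpr φ (lagrangian F)) (tangentCoords φ ξ)) :=
    contMDiffAt_cotPoint hφ (φ.map_source hξ)
  refine ((h3.comp ξ h2).congr_of_eventuallyEq ?_).mdifferentiableAt (by simp)
  have h4 : Continuous fun η : TM n M => η.proj := FiberBundle.continuous_proj _ _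
  filter_upwards [h1.continuousAt.eventually_mem (hL.slit_mem_nhds hz),
    h4.continuousAt.eventually_mem (φ.open_source.mem_nhds hξ)] with η hη hη'
  have hη0 : η.snd ≠ 0 := by
    intro h0
    refine hη.2 ?_
    change chartDeriv φ η.proj η.snd = 0
    rw [h0]
    exact map_zero _
  have h5 := cotPoint_cotCoord hφ (q := legendreMap (lagrangian F) η) hη'
  rw [cotCoord_legendreMap hF hφ hη' hη0] at h5
  exact h5.symm

/-- The differential of `𝕃` along the fibres in canonical coordinates. -/
theorem hasFDerivAt_cotCoord_legendreMap_tanMk {F : TM n M → ℝ} (hF : IsFinslerMetric F)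
    {φ : OpenPartialHomeomorph M (Coord n)} (hφ : φ ∈ IsManifold.maximalAtlas (𝓡 n) ∞ M)
    {x : M} (hx : x ∈ φ.source) {v : Coord n} (hv : v ≠ 0) :
    HasFDerivAt (fun w => cotCoord φ (legendreMap (lagrangian F) (tanMk x w)))
      ((fderiv ℝ (legendreCoord (tangentExpr φ (lagrangian F))) (tangentCoords φ (tanMk x v))).comp
        ((0 : Coord n →L[ℝ] Coord n).prod (chartDeriv φ x))) v := by
  have hL := isFinslerLagrangian hF hφ
  have hz : tangentCoords φ (tanMk x v) ∈ slit φ.target := tangentCoords_mem_slit hφ hx hv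
  have h5 : HasFDerivAt (fun w : Coord n => (φ x, chartDeriv φ x w))
      ((0 : Coord n →L[ℝ] Coord n).prod (chartDeriv φ x)) v :=
    (hasFDerivAt_const _ _).prodMk (chartDeriv φ x).hasFDerivAt
  refine (HasFDerivAt.comp (f := fun w : Coord n => (φ x, chartDeriv φ x w)) v
    (hL.hasFDerivAt_legendreCoord hz) h5).congr_of_eventuallyEq ?_
  filter_upwards [isOpen_compl_singleton.mem_nhds (show v ∈ ({0}ᶜ : Set (Coord n)) from hv)]
    with w hw
  exact cotCoord_legendreMap hF hφ (ξ := tanMk x w) hx hw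

/-- The pushforward `𝕃_*` of vertical vectors in canonical coordinates. -/
theorem cotDeriv_legendrePush_partialV {F : TM n M → ℝ} (hF : IsFinslerMetric F)
    {φ : OpenPartialHomeomorph M (Coord n)} (hφ : φ ∈ IsManifold.maximalAtlas (𝓡 n) ∞ M)
    {ξ : TM n M} (hξ : ξ.proj ∈ φ.source) (hv : ξ.snd ≠ 0) (i : Fin n) :
    cotDeriv φ (legendreMap (lagrangian F) ξ)
        (comps (legendrePush (lagrangian F) ξ (partialV φ ξ i))) =
      fderiv ℝ (legendreCoord (tangentExpr φ (lagrangian F))) (tangentCoords φ ξ)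
        (0, basisVec i) := by
  -- The base point and the vector are separated so that the latter has type `ℝⁿ`.
  have key : ∀ (x : M) (v : Coord n), x ∈ φ.source → v ≠ 0 →
      cotDeriv φ (legendreMap (lagrangian F) (tanMk x v))
        (comps (legendrePush (lagrangian F) (tanMk x v) (partialV φ (tanMk x v) i))) =
      fderiv ℝ (legendreCoord (tangentExpr φ (lagrangian F))) (tangentCoords φ (tanMk x v))
        (0, basisVec i) := by
    intro x v hx hv
    have hq : (legendreMap (lagrangian F) (tanMk x v)).proj ∈ φ.source := hx
    have h1 := ((contMDiffAt_tanMk x v).mdifferentiableAt (by simp)).hasMFDerivAt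
    have h2 := (mdifferentiableAt_legendreMap hF (ξ := tanMk x v) hv).hasMFDerivAt
    have h3 := ((contMDiffAt_cotCoord hφ hq).mdifferentiableAt (by simp)).hasMFDerivAt
    let S : Coord n →L[ℝ] Coord n × Dual n :=
      (legendrePush (lagrangian F) (tanMk x v)).comp
        (mfderiv 𝓘(ℝ, Coord n) (𝓡 n).tangent (tanMk x) v)
    have h4 : HasFDerivAt (fun w => cotCoord φ (legendreMap (lagrangian F) (tanMk x w)))
        ((cotDeriv φ (legendreMap (lagrangian F) (tanMk x v))).comp S) v :=
      hasMFDerivAt_iff_hasFDerivAt.1 (HasMFDerivAt.comp v h3 (h2.comp v h1))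
    have h5 := h4.unique (hasFDerivAt_cotCoord_legendreMap_tanMk hF hφ hx hv)
    refine (congrArg (fun T : Coord n →L[ℝ] Coord n × Dual n =>
      T ((chartDeriv φ x).inverse (basisVec i))) h5).trans ?_
    simp only [ContinuousLinearMap.comp_apply, ContinuousLinearMap.prod_apply, _root_.zero_apply,
      chartDeriv_inverse_apply hφ hx]
  exact key ξ.proj ξ.snd hξ hv

/-- The pushforward of the Riemann curvature in canonical coordinates. -/
theorem cotDeriv_legendrePush_riemannCurvature {F : TM n M → ℝ} (hF : IsFinslerMetric F)
    {φ : OpenPartialHomeomorph M (Coord n)} (hφ : φ ∈ IsManifold.maximalAtlas (𝓡 n) ∞ M)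
    {ξ : TM n M} (hξ : ξ.proj ∈ φ.source) (hv : ξ.snd ≠ 0) (i : Fin n) :
    cotDeriv φ (legendreMap (lagrangian F) ξ)
        (comps (legendrePush (lagrangian F) ξ (riemannCurvature F φ ξ i))) =
      fderiv ℝ (legendreCoord (tangentExpr φ (lagrangian F))) (tangentCoords φ ξ)
        (0, sprayCurvature (tangentExpr φ (lagrangian F))
          (cotangentExpr φ (hamiltonian (lagrangian F))) (tangentCoords φ ξ) (basisVec i)) := by
  have hL := isFinslerLagrangian hF hφ
  have hh := isLegendreTransform hF hφ
  have hz := tangentCoords_mem_slit hφ hξ hv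
  let T : TangentSpace (𝓡 n).tangent ξ →ₗ[ℝ] Coord n × Dual n :=
    (cotDeriv φ (legendreMap (lagrangian F) ξ)).toLinearMap.comp
      (legendrePush (lagrangian F) ξ).toLinearMap
  have hT : ∀ i, T (partialV φ ξ i) = fderiv ℝ (legendreCoord (tangentExpr φ (lagrangian F)))
      (tangentCoords φ ξ) (0, basisVec i) := cotDeriv_legendrePush_partialV hF hφ hξ hv
  have h1 : T (riemannCurvature F φ ξ i) = ∑ l, (∑ j, (tangentCoords φ ξ).2 j *
      curvCoeff (tangentExpr φ (lagrangian F)) (cotangentExpr φ (hamiltonian (lagrangian F)))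
      i j l (tangentCoords φ ξ)) • fderiv ℝ (legendreCoord (tangentExpr φ (lagrangian F)))
      (tangentCoords φ ξ) (0, basisVec l) := by
    rw [riemannCurvature, Finset.sum_comm]
    simp only [map_sum, map_smul, hT, ← Finset.sum_smul]
  refine Eq.trans h1 ?_
  simp only [hL.sum_mul_curvCoeff hh hz, ← map_smul, ← map_sum]
  congr 1
  refine Prod.ext ?_ ?_
  · simp only [Prod.fst_sum, Prod.smul_fst, smul_zero, Finset.sum_const_zero]
  · simp only [Prod.snd_sum, Prod.smul_snd, sum_smul_basisVec]

end Finsler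

/-! ### The curvature operator -/

section CurvatureOperator

open Set Filter

variable {n : ℕ} {M : Type*} [TopologicalSpace M] [ChartedSpace (Coord n) M]
  [IsManifold (𝓡 n) ∞ M]

/-- The Jacobi curve, in the components of `comps`. -/
def jacobiSubspace (Φ : ℝ → CoTM n M → CoTM n M) (q : CoTM n M) (t : ℝ) :
    Submodule ℝ (Coord n × Dual n) :=
  jacobiCurve Φ q t

/-- The symplectic form and the components of `T_q T*M` are those of `ℝⁿ × (ℝⁿ)*`, so that canonical
frames can be studied there. -/
theorem isCanonicalFrame_iff {Φ : ℝ → CoTM n M → CoTM n M} {q : CoTM n M} {ε : ℝ}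
    {e : Fin n → ℝ → TCoTM q} : IsCanonicalFrame Φ q ε e ↔
      IsFrameOf (jacobiSubspace Φ q) ε (fun i t => comps (e i t)) :=
  ⟨fun h => ⟨h.smooth, h.mem, h.second_deriv_mem, h.darboux_fe, h.darboux_ee, h.darboux_ff⟩,
    fun h => ⟨h.smooth, h.mem, h.second_deriv_mem, h.darboux_fe, h.darboux_ee, h.darboux_ff⟩⟩

/-- If a map of `T*M` has differential `A` in the canonical coordinates of a chart `φ`, then its
differential maps `a` to the vertical space if and only if `A a` has no `∂_x` component. -/
theorem mfderiv_mem_vertical_iff {φ : OpenPartialHomeomorph M (Coord n)}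
    (hφ : φ ∈ IsManifold.maximalAtlas (𝓡 n) ∞ M) {Ψ : CoTM n M → CoTM n M} {q : CoTM n M}
    (hq : q.proj ∈ φ.source) (hΨq : (Ψ q).proj ∈ φ.source) (hΨ : ContinuousAt Ψ q)
    {A : Coord n × Dual n →L[ℝ] Coord n × Dual n}
    (hA : HasFDerivAt (fun z => cotCoord φ (Ψ (cotPoint φ z))) A (cotCoord φ q))
    (a : TCoTM q) :
    mfderiv (coModel n) (coModel n) Ψ q a ∈ vertical (Ψ q) ↔
      (A (cotDeriv φ q (comps a))).1 = 0 := by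
  have h1 := ((contMDiffAt_cotCoord hφ hq).mdifferentiableAt (by simp)).hasMFDerivAt
  have h2 : HasMFDerivAt (coModel n) 𝓘(ℝ, Coord n × Dual n)
      ((fun z => cotCoord φ (Ψ (cotPoint φ z))) ∘ cotCoord φ) q (A.comp (cotDeriv φ q)) :=
    HasMFDerivAt.comp q (hasMFDerivAt_iff_hasFDerivAt.2 hA) h1
  have hnear : ∀ᶠ y in 𝓝 q, y.proj ∈ φ.source ∧ (Ψ y).proj ∈ φ.source :=
    Filter.Eventually.and ((cotChart φ hφ).open_source.mem_nhds hq)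
      (hΨ.eventually_mem ((cotChart φ hφ).open_source.mem_nhds hΨq))
  have h3 : HasMFDerivAt (coModel n) 𝓘(ℝ, Coord n × Dual n) (cotCoord φ ∘ Ψ) q
      (A.comp (cotDeriv φ q)) := by
    refine h2.congr_of_eventuallyEq ?_
    filter_upwards [hnear] with y hy
    simp only [Function.comp_apply]
    rw [cotPoint_cotCoord hφ hy.1]
  have hz : (cotCoord φ (Ψ q)).1 ∈ φ.target := φ.map_source hΨq
  have h4 : MDifferentiableAt (coModel n) (coModel n) (cotPoint φ ∘ (cotCoord φ ∘ Ψ)) q :=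
    MDifferentiableAt.comp q ((contMDiffAt_cotPoint hφ hz).mdifferentiableAt (by simp))
      h3.mdifferentiableAt
  have h5 : MDifferentiableAt (coModel n) (coModel n) Ψ q := by
    refine h4.congr_of_eventuallyEq ?_
    filter_upwards [hnear] with y hy using (cotPoint_cotCoord hφ hy.2).symm
  have h6 := ((contMDiffAt_cotCoord hφ hΨq).mdifferentiableAt (by simp)).hasMFDerivAt
  have h7 := hasMFDerivAt_unique h3 (HasMFDerivAt.comp q h6 h5.hasMFDerivAt)
  have h8 := congrArg (fun T : Coord n × Dual n →L[ℝ] Coord n × Dual n => T (comps a)) h7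
  rw [mem_vertical_iff hφ hΨq]
  have h9 : A (cotDeriv φ q (comps a)) = cotDeriv φ (Ψ q)
    (comps (mfderiv (coModel n) (coModel n) Ψ q a)) := h8
  rw [h9]

/-- Solutions of the linearised Hamiltonian system preserve the symplectic form. -/
theorem omega_linearised_flow {h : Coord n × Dual n → ℝ} {O : Set (Coord n × Dual n)}
    (hO : IsOpen O) (hh : ContDiffOn ℝ ∞ h O) {ε : ℝ} {γ : ℝ → Coord n × Dual n}
    (hγ : ∀ t ∈ Ioo (-ε) ε, γ t ∈ O) {A : ℝ → Coord n × Dual n →L[ℝ] Coord n × Dual n}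
    (hA0 : A 0 = 1)
    (hA : ∀ t ∈ Ioo (-ε) ε, HasDerivAt A ((fderiv ℝ (coordField h) (γ t)).comp (A t)) t)
    {t : ℝ} (ht : t ∈ Ioo (-ε) ε) (a b : Coord n × Dual n) :
    omega n (A t a) (A t b) = omega n a b := by
  have hd : ∀ s ∈ Ioo (-ε) ε, HasDerivAt (fun s => omega n (A s a) (A s b)) 0 s := by
    intro s hs
    have ha : HasDerivAt (fun s => A s a) (fderiv ℝ (coordField h) (γ s) (A s a)) s := by
      simpa using (hA s hs).clm_apply (hasDerivAt_const s a)
    have hb : HasDerivAt (fun s => A s b) (fderiv ℝ (coordField h) (γ s) (A s b)) s := by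
      simpa using (hA s hs).clm_apply (hasDerivAt_const s b)
    exact (ha.omega hb).congr_deriv (omega_fderiv_coordField hO hh (hγ s hs) _ _)
  have h0 : (0 : ℝ) ∈ Ioo (-ε) ε := ⟨by linarith [ht.1, ht.2], by linarith [ht.1, ht.2]⟩
  have := isOpen_Ioo.is_const_of_deriv_eq_zero isPreconnected_Ioo
    (fun s hs => (hd s hs).differentiableAt.differentiableWithinAt)
    (fun s hs => (hd s hs).deriv) ht h0
  simpa [hA0] using this

/-- On the image of the Legendre map, where the Hamiltonian is smooth, the Hamiltonian flow is the
flow of `(H_p, -H_x)` in canonical coordinates. -/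
theorem hasDerivAt_flow_near_legendreMap {F : TM n M → ℝ} (hF : IsFinslerMetric F)
    {Φ : ℝ → CoTM n M → CoTM n M} (hΦ : IsHamiltonianFlow (hamiltonian (lagrangian F)) Φ)
    {φ : OpenPartialHomeomorph M (Coord n)} (hφ : φ ∈ IsManifold.maximalAtlas (𝓡 n) ∞ M)
    (q : CoTM n M) (t : ℝ) (hq : (Φ t q).proj ∈ φ.source)
    (hO : cotCoord φ (Φ t q) ∈ legendreCoord (tangentExpr φ (lagrangian F)) '' slit φ.target) :
    HasDerivAt (fun s => cotCoord φ (Φ s q))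
      (coordField (cotangentExpr φ (hamiltonian (lagrangian F))) (cotCoord φ (Φ t q))) t := by
  refine hΦ.hasDerivAt hφ q t hq ?_
  obtain ⟨z, hz, hzq⟩ := hO
  rw [← hzq]
  exact ((isFinslerLagrangian hF hφ).contDiffAt_hamiltonian (isLegendreTransform hF hφ)
    hz).differentiableAt (by simp)

/-- In the canonical coordinates of a chart, the Jacobi curve at `𝕃(x, v)` is
`{a | dx (A_t a) = 0}`, where `A_t` is the linearised flow. It is therefore isotropic. -/
theorem exists_linearised_flow [T2Space M] {F : TM n M → ℝ} (hF : IsFinslerMetric F)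
    {Φ : ℝ → CoTM n M → CoTM n M} (hΦ : IsHamiltonianFlow (hamiltonian (lagrangian F)) Φ)
    {ξ : TM n M} (hv : ξ.snd ≠ 0) {φ : OpenPartialHomeomorph M (Coord n)}
    (hφ : φ ∈ IsManifold.maximalAtlas (𝓡 n) ∞ M) (hξ : ξ.proj ∈ φ.source) :
    ∃ ε > 0, ∃ γ : ℝ → Coord n × Dual n, ∃ A : ℝ → Coord n × Dual n →L[ℝ] Coord n × Dual n,
      γ 0 = legendreCoord (tangentExpr φ (lagrangian F)) (tangentCoords φ ξ) ∧ A 0 = 1 ∧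
      ∀ t ∈ Ioo (-ε) ε,
        HasDerivAt γ (coordField (cotangentExpr φ (hamiltonian (lagrangian F))) (γ t)) t ∧
        HasDerivAt A ((fderiv ℝ (coordField (cotangentExpr φ (hamiltonian (lagrangian F))))
          (γ t)).comp (A t)) t ∧
        (∀ a, a ∈ jacobiSubspace Φ (legendreMap (lagrangian F) ξ) t ↔
          (A t (cotDeriv φ (legendreMap (lagrangian F) ξ) a)).1 = 0) ∧
        ∀ a ∈ jacobiSubspace Φ (legendreMap (lagrangian F) ξ) t,
          ∀ b ∈ jacobiSubspace Φ (legendreMap (lagrangian F) ξ) t, omega n a b = 0 := by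
  have hL := isFinslerLagrangian hF hφ
  have hh := isLegendreTransform hF hφ
  have hz := tangentCoords_mem_slit hφ hξ hv
  have hO := hL.isOpen_image_legendreCoord
  have hhO := hL.contDiffOn_hamiltonian hh
  set q := legendreMap (lagrangian F) ξ with hqdef
  have hq : q.proj ∈ φ.source := hξ
  have hqz := cotCoord_legendreMap hF hφ hξ hv
  rw [← hqdef] at hqz
  obtain ⟨ε, hε, A, hA0, hA⟩ := exists_hasFDerivAt_flow (cotChart φ hφ) hΦ.zero hΦ.continuous
    (q₀ := q) hq hO (show cotCoord φ q ∈ _ by rw [hqz]; exact mem_image_of_mem _ hz)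
    ((contDiffOn_coordField hO hhO).of_le 
      (WithTop.coe_le_coe.2 le_top : ((2 : ℕ∞) : WithTop ℕ∞) ≤ ∞))
    (fun q' t h1 h2 => hasDerivAt_flow_near_legendreMap hF hΦ hφ q' t h1 h2)
  have hJ : ∀ t ∈ Ioo (-ε) ε, ∀ a, a ∈ jacobiSubspace Φ q t ↔ (A t (cotDeriv φ q a)).1 = 0 := by
    intro t ht a
    obtain ⟨h1, -, h3, -, h5⟩ := hA t ht
    exact mfderiv_mem_vertical_iff hφ hq h1 h3 h5 a
  refine ⟨ε, hε, fun t => cotCoord φ (Φ t q), A, ?_, hA0, fun t ht => ⟨?_, (hA t ht).2.2.2.1,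
    hJ t ht, fun a ha b hb => ?_⟩⟩
  · simp only [hΦ.zero, hqz]
  · exact hasDerivAt_flow_near_legendreMap hF hΦ hφ q t (hA t ht).1 (hA t ht).2.1
  · rw [hJ t ht] at ha hb
    rw [← omega_cotDeriv hφ hq, ← omega_linearised_flow hO hhO
      (γ := fun t => cotCoord φ (Φ t q)) (fun t ht => (hA t ht).2.1) hA0
      (fun t ht => (hA t ht).2.2.2.1) ht, omega_apply, ha, hb, map_zero, map_zero, sub_zero]

/-- A canonical frame of the Jacobi curve at `𝕃(x, v)`, built from parallel Jacobi fields along the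
geodesic with initial velocities orthonormal for the fibre Hessian of `L`. -/
theorem exists_canonicalFrame [T2Space M] {F : TM n M → ℝ} (hF : IsFinslerMetric F)
    {Φ : ℝ → CoTM n M → CoTM n M} (hΦ : IsHamiltonianFlow (hamiltonian (lagrangian F)) Φ)
    {ξ : TM n M} (hv : ξ.snd ≠ 0) {φ : OpenPartialHomeomorph M (Coord n)}
    (hφ : φ ∈ IsManifold.maximalAtlas (𝓡 n) ∞ M) (hξ : ξ.proj ∈ φ.source) :
    ∃ ε > 0, (∀ t ∈ Ioo (-ε) ε, ∀ a ∈ jacobiSubspace Φ (legendreMap (lagrangian F) ξ) t,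
        ∀ b ∈ jacobiSubspace Φ (legendreMap (lagrangian F) ξ) t, omega n a b = 0) ∧
      ∃ (e : Fin n → ℝ → Coord n × Dual n) (b : Module.Basis (Fin n) ℝ (Coord n)),
        IsFrameOf (jacobiSubspace Φ (legendreMap (lagrangian F) ξ)) ε e ∧
        ∀ i, cotDeriv φ (legendreMap (lagrangian F) ξ) (e i 0) =
            fderiv ℝ (legendreCoord (tangentExpr φ (lagrangian F))) (tangentCoords φ ξ) (0, b i) ∧
          cotDeriv φ (legendreMap (lagrangian F) ξ) (deriv (deriv (e i)) 0) =
            -fderiv ℝ (legendreCoord (tangentExpr φ (lagrangian F))) (tangentCoords φ ξ)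
              (0, sprayCurvature (tangentExpr φ (lagrangian F))
                (cotangentExpr φ (hamiltonian (lagrangian F))) (tangentCoords φ ξ) (b i)) := by
  have hL := isFinslerLagrangian hF hφ
  have hh := isLegendreTransform hF hφ
  have hz := tangentCoords_mem_slit hφ hξ hv
  have hq : (legendreMap (lagrangian F) ξ).proj ∈ φ.source := hξ
  obtain ⟨ε₁, hε₁, γ, A, hγ0, hA0, hγA⟩ := exists_linearised_flow hF hΦ hv hφ hξ
  set q := legendreMap (lagrangian F) ξ
  set L := tangentExpr φ (lagrangian F)
  set z := tangentCoords φ ξ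
  have hI : Ioo (-ε₁) ε₁ ∈ 𝓝 (0 : ℝ) := isOpen_Ioo.mem_nhds ⟨by linarith, hε₁⟩
  obtain ⟨ε₂, hε₂, j, hj⟩ := hL.exists_parallel_jacobi_fields hh hz hγ0 hA0
    (by filter_upwards [hI] with t ht using (hγA t ht).1)
    (by filter_upwards [hI] with t ht using (hγA t ht).2.1)
  -- The fibre Hessian of `L` as a bilinear form.
  let B : LinearMap.BilinForm ℝ (Coord n) := LinearMap.mk₂ ℝ
    (fun u w => fderiv ℝ (fderiv ℝ L) z (ContinuousLinearMap.inr ℝ (Coord n) (Coord n) u)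
      (ContinuousLinearMap.inr ℝ (Coord n) (Coord n) w))
    (fun _ _ _ => by simp only [map_add, _root_.add_apply])
    (fun _ _ _ => by simp only [map_smul, _root_.smul_apply])
    (fun _ _ _ => by simp only [map_add])
    (fun _ _ _ => by simp only [map_smul])
  obtain ⟨b, hb⟩ := exists_orthonormal_basis (B := B)
    (fun u w => (hL.contDiffAt hz).fderiv_fderiv_comm _ _) (fun u hu => hL.hessian_pos z hz u hu)
  let C : (Coord n × Dual n) ≃L[ℝ] (Coord n × Dual n) :=
    (LinearEquiv.ofBijective (cotDeriv φ q).toLinearMap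
      (cotDeriv_bijective hφ hq)).toContinuousLinearEquiv
  have hC : ∀ a, cotDeriv φ q (C.symm a) = a := C.apply_symm_apply
  have hs1 : Ioo (-min ε₁ ε₂) (min ε₁ ε₂) ⊆ Ioo (-ε₁) ε₁ :=
    Ioo_subset_Ioo (neg_le_neg (min_le_left _ _)) (min_le_left _ _)
  have hs2 : Ioo (-min ε₁ ε₂) (min ε₁ ε₂) ⊆ Ioo (-ε₂) ε₂ :=
    Ioo_subset_Ioo (neg_le_neg (min_le_right _ _)) (min_le_right _ _)
  have hpos : 0 < min ε₁ ε₂ := lt_min hε₁ hε₂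
  have hd1 : ∀ u, ∀ t ∈ Ioo (-ε₂) ε₂,
      deriv (fun t => C.symm (j u t)) t = C.symm (deriv (j u) t) := fun u t ht =>
    (C.symm.hasFDerivAt.comp_hasDerivAt t (hasDerivAt_of_contDiffOn_Ioo (hj u).1 ht).1).deriv
  have hd2 : ∀ u, ∀ t ∈ Ioo (-ε₂) ε₂,
      deriv (deriv fun t => C.symm (j u t)) t = C.symm (deriv (deriv (j u)) t) := fun u t ht => by
    have h1 : deriv (fun t => C.symm (j u t)) =ᶠ[𝓝 t] fun t => C.symm (deriv (j u) t) := by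
      filter_upwards [isOpen_Ioo.mem_nhds ht] with s hs using hd1 u s hs
    rw [h1.deriv_eq]
    exact (C.symm.hasFDerivAt.comp_hasDerivAt t
      (hasDerivAt_of_contDiffOn_Ioo (hj u).1 ht).2).deriv
  have h0 : (0 : ℝ) ∈ Ioo (-ε₂) ε₂ := ⟨by linarith, hε₂⟩
  refine ⟨min ε₁ ε₂, hpos, fun t ht => (hγA t (hs1 ht)).2.2.2,
    fun i t => C.symm (j (b i) t), b, ?_, fun i => ⟨?_, ?_⟩⟩
  · refine IsFrameOf.of_normalised (fun t ht => (hγA t (hs1 ht)).2.2.2) (fun i => ?_)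
      (fun i t ht => ?_) (fun i t ht => ?_) (fun i k => ?_)
    · exact (C.symm.contDiff.comp_contDiffOn (hj (b i)).1).mono hs2
    · rw [(hγA t (hs1 ht)).2.2.1, hC]
      exact ((hj (b i)).2.1 t (hs2 ht)).1
    · rw [(hγA t (hs1 ht)).2.2.1, hd2 _ t (hs2 ht), hC]
      exact ((hj (b i)).2.1 t (hs2 ht)).2
    · rw [hd1 _ 0 h0, ← omega_cotDeriv hφ hq, hC, hC, (hj (b i)).2.2.2.1, (hj (b k)).2.2.1,
        omega_apply, Prod.snd_neg, Prod.fst_neg, hL.fderiv_legendreCoord_fst hz,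
        hL.fderiv_legendreCoord_fst hz, map_zero, map_neg, hL.fderiv_legendreCoord_snd hz,
        zero_sub, neg_neg, ← hb i k]
      exact (hL.contDiffAt hz).fderiv_fderiv_comm _ _
  · rw [hC, (hj (b i)).2.2.1]
  · rw [hd2 _ 0 h0, hC, (hj (b i)).2.2.2.2]

/-- The differential of the Legendre map identifies `T_x M`, in the coordinates of a chart, with
the vertical space. -/
theorem exists_vertical_equiv {F : TM n M → ℝ} (hF : IsFinslerMetric F)
    {ξ : TM n M} (hv : ξ.snd ≠ 0) {φ : OpenPartialHomeomorph M (Coord n)}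
    (hφ : φ ∈ IsManifold.maximalAtlas (𝓡 n) ∞ M) (hξ : ξ.proj ∈ φ.source) :
    ∃ κ : Coord n ≃ₗ[ℝ] vertical (legendreMap (lagrangian F) ξ), ∀ u,
      cotDeriv φ (legendreMap (lagrangian F) ξ) (comps (κ u : TCoTM (legendreMap (lagrangian F) ξ)))
        = fderiv ℝ (legendreCoord (tangentExpr φ (lagrangian F))) (tangentCoords φ ξ) (0, u) := by
  have hL := isFinslerLagrangian hF hφ
  have hz := tangentCoords_mem_slit hφ hξ hv
  have hq : (legendreMap (lagrangian F) ξ).proj ∈ φ.source := hξ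
  have hbij := cotDeriv_bijective hφ hq
  set q := legendreMap (lagrangian F) ξ
  set D := fderiv ℝ (legendreCoord (tangentExpr φ (lagrangian F))) (tangentCoords φ ξ)
  let C : (Coord n × Dual n) ≃ₗ[ℝ] (Coord n × Dual n) :=
    LinearEquiv.ofBijective (cotDeriv φ q).toLinearMap hbij
  let T : Coord n →ₗ[ℝ] Coord n × Dual n :=
    C.symm.toLinearMap.comp (D.comp (.inr ℝ (Coord n) (Coord n))).toLinearMap
  have hT : ∀ u, cotDeriv φ q (T u) = D (0, u) := fun u => C.apply_symm_apply _
  have hmem : ∀ u, T u ∈ vertical q := fun u =>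
    (mem_vertical_iff hφ hq (T u)).2 (by
      change (cotDeriv φ q (T u)).1 = 0
      rw [hT, hL.fderiv_legendreCoord_fst hz])
  let K : Coord n →ₗ[ℝ] vertical q := LinearMap.codRestrict (vertical q) T hmem
  have hK : ∀ u, cotDeriv φ q (comps (K u : TCoTM q)) = D (0, u) := hT
  refine ⟨LinearEquiv.ofBijective K ⟨fun u w h => ?_, fun a => ?_⟩, hK⟩
  · have h1 : D (0, u) = D (0, w) := by rw [← hK, ← hK, h]
    exact congrArg Prod.snd ((hL.fderiv_legendreCoord_bijective hz).1 h1)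
  · obtain ⟨y, hy⟩ := (hL.fderiv_legendreCoord_bijective hz).2
      (cotDeriv φ q (comps (a : TCoTM q)))
    have h1 : y.1 = 0 := by
      rw [← hL.fderiv_legendreCoord_fst hz y, hy]
      exact (mem_vertical_iff hφ hq _).1 a.2
    refine ⟨y.2, Subtype.ext (hbij.1 ?_)⟩
    refine (hK y.2).trans ?_
    rw [← show y = (0, y.2) from Prod.ext h1 rfl]
    exact hy

theorem coe_apply_of_eq_sum {W ι : Type*} [AddCommGroup W] [Module ℝ W] [Fintype ι]
    {V : Submodule ℝ W} {R : V →ₗ[ℝ] V} {x y : ι → W}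
    (hx : ∀ i, ∃ h : x i ∈ V, (R ⟨x i, h⟩ : W) = -y i) {U : ι → ℝ} {a : V}
    (ha : (a : W) = ∑ j, U j • x j) : (R a : W) = -∑ j, U j • y j := by
  choose h hR using hx
  have ha' : a = ∑ j, U j • (⟨x j, h j⟩ : V) := Subtype.ext (by
    rw [ha]
    simp)
  rw [ha', map_sum]
  simp only [map_smul, Submodule.coe_sum, Submodule.coe_smul, hR, smul_neg,
    Finset.sum_neg_distrib]

/-- A canonical frame `e` determines the curvature operator: any other canonical frame is a
constant linear combination of the `eᵢ`. Here the vertical space is parametrised by `κ`. -/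
theorem isCurvatureOperator_iff_of_frame {Φ : ℝ → CoTM n M → CoTM n M} {q : CoTM n M} {ε : ℝ}
    (hε : 0 < ε) (hiso : ∀ t ∈ Ioo (-ε) ε, ∀ a ∈ jacobiSubspace Φ q t,
      ∀ b ∈ jacobiSubspace Φ q t, omega n a b = 0)
    {e : Fin n → ℝ → Coord n × Dual n} (he : IsFrameOf (jacobiSubspace Φ q) ε e)
    (κ : Coord n ≃ₗ[ℝ] vertical q) (S : Coord n →ₗ[ℝ] Coord n)
    (b : Module.Basis (Fin n) ℝ (Coord n))
    (he0 : ∀ i, e i 0 = comps (κ (b i) : TCoTM q))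
    (he2 : ∀ i, deriv (deriv (e i)) 0 = -comps (κ (S (b i)) : TCoTM q))
    (R : vertical q →ₗ[ℝ] vertical q) :
    IsCurvatureOperator Φ q R ↔ ∀ u, R (κ u) = κ (S u) := by
  constructor
  · rintro ⟨ε', hε', e', he', hR⟩
    have hs : Ioo (-min ε ε') (min ε ε') ⊆ Ioo (-ε) ε :=
      Ioo_subset_Ioo (neg_le_neg (min_le_left _ _)) (min_le_left _ _)
    obtain ⟨U, hU⟩ := IsFrameOf.exists_eq_sum_zero (lt_min hε hε')
      (fun t ht => hiso t (hs ht)) ((isCanonicalFrame_iff.1 he').mono (min_le_right _ _))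
      (he.mono (min_le_left _ _))
    have hb : ∀ i, R (κ (b i)) = κ (S (b i)) := fun i => by
      refine Subtype.ext ?_
      have h1 : comps (R (κ (b i)) : TCoTM q) =
          -∑ j, U i j • deriv (deriv fun t => comps (e' j t)) 0 :=
        coe_apply_of_eq_sum hR ((he0 i).symm.trans (hU i).1)
      have h2 : comps (κ (S (b i)) : TCoTM q) =
          -∑ j, U i j • deriv (deriv fun t => comps (e' j t)) 0 := by
        rw [← (hU i).2, he2 i, neg_neg]
      exact h1.trans h2.symm
    have h3 : R.comp κ.toLinearMap = κ.toLinearMap.comp S := b.ext hb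
    exact fun u => congrArg (fun T => T u) h3
  · intro h
    refine ⟨ε, hε, e, isCanonicalFrame_iff.2 he, fun i => ?_⟩
    have hmem : e i 0 ∈ vertical q := by
      rw [he0 i]
      exact (κ (b i)).2
    have h1 : (⟨e i 0, hmem⟩ : vertical q) = κ (b i) := Subtype.ext (he0 i)
    refine ⟨hmem, ?_⟩
    have h2 : comps (R ⟨e i 0, hmem⟩ : TCoTM q) = -deriv (deriv (e i)) 0 := by
      rw [h1, h, he2 i, neg_neg]
    exact h2

/-- The curvature of the spray as a linear map. -/
def sprayCurvatureMap (L : Coord n × Coord n → ℝ) (h : Coord n × Dual n → ℝ)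
    (z : Coord n × Coord n) : Coord n →ₗ[ℝ] Coord n :=
  ((2 : ℝ) • (fderiv ℝ (sprayVec L h) z).comp (.inl ℝ (Coord n) (Coord n)) -
    (fderiv ℝ (fderiv ℝ (sprayVec L h)) z (z.2, -((2 : ℝ) • sprayVec L h z))).comp
      (.inr ℝ (Coord n) (Coord n)) -
    ((fderiv ℝ (sprayVec L h) z).comp (.inr ℝ (Coord n) (Coord n))).comp
      ((fderiv ℝ (sprayVec L h) z).comp (.inr ℝ (Coord n) (Coord n)))).toLinearMap

theorem sprayCurvatureMap_apply (L : Coord n × Coord n → ℝ) (h : Coord n × Dual n → ℝ)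
    (z : Coord n × Coord n) (u : Coord n) :
    sprayCurvatureMap L h z u = sprayCurvature L h z u := rfl

/-- In canonical coordinates, the curvature operator is the curvature of the geodesic spray. -/
theorem isCurvatureOperator_iff [T2Space M] {F : TM n M → ℝ} (hF : IsFinslerMetric F)
    {Φ : ℝ → CoTM n M → CoTM n M} (hΦ : IsHamiltonianFlow (hamiltonian (lagrangian F)) Φ)
    {ξ : TM n M} (hv : ξ.snd ≠ 0) {φ : OpenPartialHomeomorph M (Coord n)}
    (hφ : φ ∈ IsManifold.maximalAtlas (𝓡 n) ∞ M) (hξ : ξ.proj ∈ φ.source)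
    {κ : Coord n ≃ₗ[ℝ] vertical (legendreMap (lagrangian F) ξ)}
    (hκ : ∀ u, cotDeriv φ (legendreMap (lagrangian F) ξ)
      (comps (κ u : TCoTM (legendreMap (lagrangian F) ξ))) =
        fderiv ℝ (legendreCoord (tangentExpr φ (lagrangian F))) (tangentCoords φ ξ) (0, u))
    (R : vertical (legendreMap (lagrangian F) ξ) →ₗ[ℝ] vertical (legendreMap (lagrangian F) ξ)) :
    IsCurvatureOperator Φ (legendreMap (lagrangian F) ξ) R ↔
      ∀ u, R (κ u) = κ (sprayCurvature (tangentExpr φ (lagrangian F))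
        (cotangentExpr φ (hamiltonian (lagrangian F))) (tangentCoords φ ξ) u) := by
  obtain ⟨ε, hε, hiso, e, b, he, heb⟩ := exists_canonicalFrame hF hΦ hv hφ hξ
  have hq : (legendreMap (lagrangian F) ξ).proj ∈ φ.source := hξ
  have hinj := (cotDeriv_bijective hφ hq).1
  refine isCurvatureOperator_iff_of_frame hε hiso he κ (sprayCurvatureMap _ _ _) b
    (fun i => hinj ((heb i).1.trans (hκ (b i)).symm)) (fun i => hinj ?_) R
  rw [(heb i).2, map_neg, hκ, sprayCurvatureMap_apply]

end CurvatureOperator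

end FinslerCurvature

end

theorem theorem11p2 {n : ℕ} {M : Type*} [TopologicalSpace M] [T2Space M]
    [ChartedSpace (EuclideanSpace ℝ (Fin n)) M] [IsManifold (𝓡 n) ∞ M]
    (F : TangentBundle (𝓡 n) M → ℝ) (hF : IsFinslerMetric F)
    (Φ : ℝ → CoTM n M → CoTM n M) (hΦ : IsHamiltonianFlow (hamiltonian (lagrangian F)) Φ)
    (ξ : TangentBundle (𝓡 n) M) (hξ : ξ.snd ≠ 0) :
    ∃ R : vertical (legendreMap (lagrangian F) ξ) →ₗ[ℝ] vertical (legendreMap (lagrangian F) ξ),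
      (∀ R', IsCurvatureOperator Φ (legendreMap (lagrangian F) ξ) R' ↔ R' = R) ∧
      ∀ φ ∈ IsManifold.maximalAtlas (𝓡 n) ∞ M, ξ.proj ∈ φ.source → ∀ i : Fin n,
        ∃ h : legendrePush (lagrangian F) ξ (partialV φ ξ i) ∈
            vertical (legendreMap (lagrangian F) ξ),
          (R ⟨legendrePush (lagrangian F) ξ (partialV φ ξ i), h⟩ :
              TCoTM (legendreMap (lagrangian F) ξ)) =
            legendrePush (lagrangian F) ξ (riemannCurvature F φ ξ i) := by
  have hc : chartAt (EuclideanSpace ℝ (Fin n)) ξ.proj ∈ IsManifold.maximalAtlas (𝓡 n) ∞ M :=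
    IsManifold.chart_mem_maximalAtlas _
  have hcξ := mem_chart_source (EuclideanSpace ℝ (Fin n)) ξ.proj
  obtain ⟨κ, hκ⟩ := exists_vertical_equiv hF hξ hc hcξ
  let S := sprayCurvatureMap
    (tangentExpr (chartAt (EuclideanSpace ℝ (Fin n)) ξ.proj) (lagrangian F))
    (cotangentExpr (chartAt (EuclideanSpace ℝ (Fin n)) ξ.proj) (hamiltonian (lagrangian F)))
    (tangentCoords (chartAt (EuclideanSpace ℝ (Fin n)) ξ.proj) ξ)
  let R := (κ.toLinearMap.comp S).comp κ.symm.toLinearMap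
  have hR : ∀ R', IsCurvatureOperator Φ (legendreMap (lagrangian F) ξ) R' ↔ R' = R := by
    intro R'
    rw [isCurvatureOperator_iff hF hΦ hξ hc hcξ hκ]
    have hRκ : ∀ u, R (κ u) = κ (S u) := fun u => by
      change κ (S (κ.symm (κ u))) = _
      rw [κ.symm_apply_apply]
    refine ⟨fun h => LinearMap.ext fun a => ?_, fun h u => ?_⟩
    · obtain ⟨u, rfl⟩ := κ.surjective a
      exact (h u).trans (hRκ u).symm
    · rw [h]
      exact hRκ u
  refine ⟨R, hR, fun φ hφ hφξ i => ?_⟩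
  have hq : (legendreMap (lagrangian F) ξ).proj ∈ φ.source := hφξ
  have hinj := (cotDeriv_bijective hφ hq).1
  obtain ⟨κ', hκ'⟩ := exists_vertical_equiv hF hξ hφ hφξ
  have hRφ := (isCurvatureOperator_iff hF hΦ hξ hφ hφξ hκ' R).1 ((hR R).2 rfl) (basisVec i)
  have h1 : (κ' (basisVec i) : TCoTM (legendreMap (lagrangian F) ξ)) =
      legendrePush (lagrangian F) ξ (partialV φ ξ i) :=
    hinj ((hκ' _).trans (cotDeriv_legendrePush_partialV hF hφ hφξ hξ i).symm)
  have hmem : legendrePush (lagrangian F) ξ (partialV φ ξ i) ∈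
      vertical (legendreMap (lagrangian F) ξ) := h1 ▸ (κ' (basisVec i)).2
  refine ⟨hmem, ?_⟩
  have h2 : (⟨_, hmem⟩ : vertical (legendreMap (lagrangian F) ξ)) = κ' (basisVec i) :=
    Subtype.ext h1.symm
  rw [h2, hRφ]
  exact hinj ((hκ' _).trans (cotDeriv_legendrePush_riemannCurvature hF hφ hφξ hξ i).symm)
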